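/- Let $d\ge 2$, $m\ge 0$, $G=\mathbb{Z}^m$. Let $F:[0,1)\to[0,1)$ be an interval exchange transformation of $d$ intervals $I_i=[x_{i-1},x_i)$ (some of the marked points $0<x_1<\dots<x_{d-1}<1$ may be continuity points of $F$; $x_0=0$, $x_d=1$) satisfying Keane's condition: $F^n(x_i)\notin\{x_1,\dots,x_{d-1}\}$ for all $0\le i\le d-1$ and $n\ge 1$. Let $F^{(n)}:I^{(n)}\to I^{(n)}$, an exchange of intervals $I^{(n)}_j$, denote the $n$-th step of (unnormalised) Rauzy–Veech induction, let $q^{(0,n)}_j$ be the first return time of $I^{(n)}_j$ to $I^{(n)}$ under $F$, and let $A^{(0,n)}_{ij}=\#\{0\le k<q^{(0,n)}_j: F^k(I^{(n)}_j)\subset I_i\}$. Assume that $F$ is infinitely complete, i.e. $A^{(0,n)}_{ij}\to\infty$ as $n\to\infty$ for all $i,j$. Let $\phi:[0,1)\to G$ be constant on each $I_i$, with value $\phi_i$, let $F_\phi(x,a)=(F(x),a+\phi(x))$ on $[0,1)\times G$, and assume that $F_\phi$ is of periodic type: for some $N>0$ the first return map of $F_\phi$ to $I^{(N)}\times G$,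 with the first coordinate rescaled so that $I^{(N)}$ becomes $[0,1)$, is equal to $F_\phi$ (and the rescaled marked points of $F^{(N)}$ are those of $F$). Let $K$ be the Cantor set obtained from $[0,1]$ by splitting into a left and a right copy every point of $D=\bigcup_{n\ge0}\big(F^n(\{F(x_0),\dots,F(x_{d-1})\}\setminus\{0\})\cup F^{-n}(\{x_1,\dots,x_{d-1}\})\big)$; explicitly $K=l((0,1])\cup r([0,1))\subset\mathbb{R}$, where $l(x)=\rho([0,x))$, $r(x)=\rho([0,x])$ and $\rho=\sum_{n\ge 0}2^{-n}\sum_{x\in D_n}\delta_x$, with $D_n$ the set in the union that has index $n$. Let $T:K\to K$ be the continuous extension of $F$, given by $T(r(x))=r(F(x))$ for $x\in[0,1)$ and $T(l(x))=l(\lim_{y\to x^-}F(y))$ for $x\in(0,1]$, and let $\phi:K\to G$ also denote the function with value $\phi_i$ on the copy $K_i=r([x_{i-1},x_i))\cup l((x_{i-1},x_i])$ of $I_i$. Then for every homomorphism $\psi:G\to\mathbb{R}$ there is exactly one Borel probability measure $\nu_\psi$ on $K$ with $$\frac{\mathrm{d}(\nu_\psi\circ T)}{\mathrm{d}\nu_\psi}=e^{-\psi\circ\phi},$$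 and the Maharam measures $\mu_\psi$ on $K\times G$, defined by $\mathrm{d}\mu_\psi(x,a)=\mathrm{d}\nu_\psi(x)\,e^{\psi(a)}\,\mathrm{d}\mu_G(a)$ with $\mu_G$ the counting measure on $G$ (so that $\mu_\psi(K\times\{0\})=1$), depend weak-* continuously on $\psi\in\mathrm{Hom}(G,\mathbb{R})\cong\mathbb{R}^m$ (with its standard topology): for every continuous compactly supported $f:K\times G\to\mathbb{R}$ the map $\psi\mapsto\int f\,\mathrm{d}\mu_\psi$ is continuous. -/

import Mathlib

open Set MeasureTheory Filter Topology

/-- Combinatorial and length data of an interval exchange of `d` labelled intervals based at `0`: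
`top i` is the position (from left to right) of the `i`-th interval before the exchange, `bot i`
its position after the exchange, `len i` its length. -/
structure IntervalExchange (d : ℕ) where
  top : Equiv.Perm (Fin d)
  bot : Equiv.Perm (Fin d)
  len : Fin d → ℝ

namespace IntervalExchange

section Basic

variable {d : ℕ} (F : IntervalExchange d)

/-- Length of the interval on which the exchange acts. -/
noncomputable def total : ℝ := ∑ i, F.len i

/-- Left endpoint of the `j`-th interval. -/
noncomputable def topLeft (j : Fin d) : ℝ := ∑ i, if F.top i < F.top j then F.len i else 0

/-- Left endpoint of the image of the `j`-th interval. -/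
noncomputable def botLeft (j : Fin d) : ℝ := ∑ i, if F.bot i < F.bot j then F.len i else 0

/-- The `j`-th exchanged interval `I_j`. -/
def interval (j : Fin d) : Set ℝ := Ico (F.topLeft j) (F.topLeft j + F.len j)

/-- The same interval, open on the left and closed on the right. -/
def intervalLeft (j : Fin d) : Set ℝ := Ioc (F.topLeft j) (F.topLeft j + F.len j)

/-- The interval exchange map: on `I_j` it is the translation by `botLeft j - topLeft j`. -/
noncomputable def map (x : ℝ) : ℝ :=
  x + ∑ j, (F.interval j).indicator (fun _ => F.botLeft j - F.topLeft j) x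

/-- The left limits of the interval exchange map. -/
noncomputable def mapLeft (x : ℝ) : ℝ :=
  x + ∑ j, (F.intervalLeft j).indicator (fun _ => F.botLeft j - F.topLeft j) x

/-- The `d - 1` marked points `x_1 < ... < x_{d-1}` separating the intervals. -/
def markedPoints : Set ℝ := range F.topLeft \ {0}

/-- The points `y_1 < ... < y_{d-1}` separating the images of the intervals: the images of the
left endpoints `x_0 = 0, x_1, ..., x_{d-1}`, without `0`. -/
def imagePoints : Set ℝ := F.map '' range F.topLeft \ {0}

/-- The data define an exchange of `d` nondegenerate intervals of `[0, 1)`. -/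
structure IsUnitExchange : Prop where
  len_pos : ∀ i, 0 < F.len i
  total_eq_one : F.total = 1

/-- Keane's condition: no forward image (after at least one step) of one of the left endpoints
`x_0 = 0, x_1, ..., x_{d-1}` is a marked point. -/
def Keane : Prop := ∀ i, ∀ n : ℕ, 1 ≤ n → F.map^[n] (F.topLeft i) ∉ F.markedPoints

end Basic

section MapsInto

variable {d : ℕ} {F : IntervalExchange d}

lemma IsUnitExchange.sum_le (hF : F.IsUnitExchange) (p : Equiv.Perm (Fin d)) (j : Fin d) :
    0 ≤ (∑ i, if p i < p j then F.len i else 0) ∧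
      (∑ i, if p i < p j then F.len i else 0) + F.len j ≤ 1 := by
  refine ⟨Finset.sum_nonneg fun i _ => ?_, ?_⟩
  · split_ifs
    · exact (hF.len_pos i).le
    · exact le_rfl
  · have h1 : F.len j = ∑ i, if i = j then F.len i else 0 := by simp
    have h2 := hF.total_eq_one
    unfold total at h2
    rw [h1, ← h2, ← Finset.sum_add_distrib]
    refine Finset.sum_le_sum fun i _ => ?_
    by_cases hij : i = j
    · subst hij; simp
    · have := (hF.len_pos i).le
      simp only [hij, if_false, add_zero]
      split_ifs <;> linarith

lemma IsUnitExchange.topLeft_add_le (hF : F.IsUnitExchange) {i j : Fin d}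
    (h : F.top i < F.top j) : F.topLeft i + F.len i ≤ F.topLeft j := by
  have h1 : F.len i = ∑ k, if k = i then F.len k else 0 := by simp
  unfold topLeft
  rw [h1, ← Finset.sum_add_distrib]
  refine Finset.sum_le_sum fun k _ => ?_
  by_cases hk : k = i
  · subst hk; simp [h]
  · have := (hF.len_pos k).le
    simp only [hk, if_false, add_zero]
    by_cases h3 : F.top k < F.top i
    · simp [h3, h3.trans h]
    · simp only [h3, if_false]; split_ifs <;> linarith

/-- The intervals cover: a cut of the line between `0` and `1` passes through one of them. -/
lemma IsUnitExchange.exists_index (hF : F.IsUnitExchange) (P : ℝ → Prop)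
    (h0 : P 0) (h1 : ¬ P 1) (hP : ∀ a b, a ≤ b → P b → P a) :
    ∃ j, P (F.topLeft j) ∧ ¬ P (F.topLeft j + F.len j) := by
  classical
  by_contra hcon
  push Not at hcon
  have hstep : ∀ (n : ℕ) (_ : n ≤ d), P (∑ i, if (F.top i : ℕ) < n then F.len i else 0) := by
    intro n
    induction n with
    | zero => intro _; simpa using h0
    | succ n ih =>
      intro hn
      have hp := ih (by omega)
      set j := F.top.symm ⟨n, by omega⟩ with hj
      have hjn : (F.top j : ℕ) = n := by simp [hj]
      have e1 : F.topLeft j = ∑ i, if (F.top i : ℕ) < n then F.len i else 0 := by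
        unfold topLeft
        refine Finset.sum_congr rfl fun i _ => ?_
        simp only [Fin.lt_def, hjn]
      have hq := hcon j (e1 ▸ hp)
      refine hP _ _ (le_of_eq ?_) hq
      have h2 : F.len j = ∑ k, if k = j then F.len k else 0 := by simp
      rw [e1, h2, ← Finset.sum_add_distrib]
      refine Finset.sum_congr rfl fun k _ => ?_
      by_cases hk : k = j
      · subst hk; simp [hjn]
      · have : (F.top k : ℕ) ≠ n := by
          intro h
          exact hk (F.top.injective (Fin.ext (h.trans hjn.symm)))
        simp only [hk, if_false, add_zero]
        by_cases h3 : (F.top k : ℕ) < n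
        · simp [h3, h3.trans (Nat.lt_succ_self n)]
        · have h4 : ¬ (F.top k : ℕ) < n + 1 := by omega
          simp [h3, h4]
  refine h1 (hP _ _ (le_of_eq ?_) (hstep d le_rfl))
  rw [← hF.total_eq_one]
  simp [total]

lemma IsUnitExchange.map_eq (hF : F.IsUnitExchange) {x : ℝ} {j : Fin d}
    (hx : x ∈ F.interval j) : F.map x = x + (F.botLeft j - F.topLeft j) := by
  unfold map
  rw [Finset.sum_eq_single j, indicator_of_mem hx]
  · intro i _ hij
    refine indicator_of_notMem (fun hi => ?_) _
    unfold interval at hx hi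
    rcases lt_or_gt_of_ne (fun h => hij (F.top.injective h)) with h | h
    · have := hF.topLeft_add_le h
      linarith [hi.2, hx.1]
    · have := hF.topLeft_add_le h
      linarith [hi.1, hx.2]
  · simp

lemma IsUnitExchange.mapLeft_eq (hF : F.IsUnitExchange) {x : ℝ} {j : Fin d}
    (hx : x ∈ F.intervalLeft j) : F.mapLeft x = x + (F.botLeft j - F.topLeft j) := by
  unfold mapLeft
  rw [Finset.sum_eq_single j, indicator_of_mem hx]
  · intro i _ hij
    refine indicator_of_notMem (fun hi => ?_) _
    unfold intervalLeft at hx hi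
    rcases lt_or_gt_of_ne (fun h => hij (F.top.injective h)) with h | h
    · have := hF.topLeft_add_le h
      linarith [hi.2, hx.1]
    · have := hF.topLeft_add_le h
      linarith [hi.1, hx.2]
  · simp

lemma IsUnitExchange.map_mem (hF : F.IsUnitExchange) {x : ℝ} (hx : x ∈ Ico (0 : ℝ) 1) :
    F.map x ∈ Ico (0 : ℝ) 1 := by
  obtain ⟨j, h1, h2⟩ := hF.exists_index (fun a => a ≤ x) hx.1 (not_le.2 hx.2)
    (fun a b h h' => h.trans h')
  rw [hF.map_eq ⟨h1, not_le.1 h2⟩]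
  have h3 := hF.sum_le F.bot j
  change 0 ≤ F.botLeft j ∧ F.botLeft j + F.len j ≤ 1 at h3
  constructor <;> linarith [h3.1, h3.2, not_le.1 h2]

lemma IsUnitExchange.mapLeft_mem (hF : F.IsUnitExchange) {x : ℝ} (hx : x ∈ Ioc (0 : ℝ) 1) :
    F.mapLeft x ∈ Ioc (0 : ℝ) 1 := by
  obtain ⟨j, h1, h2⟩ := hF.exists_index (fun a => a < x) hx.1 (not_lt.2 hx.2)
    (fun a b h h' => h.trans_lt h')
  rw [hF.mapLeft_eq ⟨h1, not_lt.1 h2⟩]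
  have h3 := hF.sum_le F.bot j
  change 0 ≤ F.botLeft j ∧ F.botLeft j + F.len j ≤ 1 at h3
  constructor <;> linarith [h3.1, h3.2, not_lt.1 h2]

end MapsInto

/-! The compactification of `[0, 1)` and the continuous extension of the map. -/

section Compactification

variable {d : ℕ} (F : IntervalExchange d)

/-- `D_n^+`: the `n`-th forward images of the points `y_i`. -/
def forwardPoints (n : ℕ) : Set ℝ := F.map^[n] '' F.imagePoints

/-- `D_n^-`: the `n`-th preimages in `[0, 1)` of the marked points `x_i`. -/
def backwardPoints (n : ℕ) : Set ℝ := {z | z ∈ Ico (0 : ℝ) 1 ∧ F.map^[n] z ∈ F.markedPoints}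

/-- The atomic measure `ρ = ∑ₙ 2⁻ⁿ ∑ δ_x`, with `x` running over `D_n^+ ∪ D_n^-`. -/
noncomputable def rho : Measure ℝ :=
  Measure.sum fun n : ℕ =>
    ((2 : ENNReal)⁻¹ ^ n) • Measure.count.restrict (F.forwardPoints n ∪ F.backwardPoints n)

/-- Left copies of points. -/
noncomputable def l (x : ℝ) : ℝ := F.rho.real (Ico 0 x)

/-- Right copies of points. -/
noncomputable def r (x : ℝ) : ℝ := F.rho.real (Icc 0 x)

/-- The Cantor set `K`, obtained from the interval by splitting every point of the orbits of the
singularities into a left and a right copy. -/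
def K : Set ℝ := F.l '' Ioc 0 1 ∪ F.r '' Ico 0 1

/-- `K_i`: the copy of the `i`-th interval in `K`, with the right copy of its left endpoint and the
left copy of its right endpoint. -/
def piece (i : Fin d) : Set F.K :=
  {z | (z : ℝ) ∈ F.r '' F.interval i ∪ F.l '' F.intervalLeft i}

open Classical in
/-- The continuous extension `T : K → K` of the interval exchange: a right copy `r x` goes to
`r (F x)`, and a left copy `l x` to `l (F (x-))`, where `F (x-)` is the left limit of `F` at `x`.
(A point that is both a left and a right copy comes from a single `x`, at which both prescriptions
agree.) -/
noncomputable def T (hF : F.IsUnitExchange) (z : F.K) : F.K :=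
  if h : ∃ x ∈ Ico (0 : ℝ) 1, F.r x = z then
    ⟨F.r (F.map h.choose), Or.inr ⟨_, hF.map_mem h.choose_spec.1, rfl⟩⟩
  else
    have h' : ∃ x ∈ Ioc (0 : ℝ) 1, F.l x = z := z.2.resolve_right h
    ⟨F.l (F.mapLeft h'.choose), Or.inl ⟨_, hF.mapLeft_mem h'.choose_spec.1, rfl⟩⟩

end Compactification

/-! Rauzy-Veech induction. -/

section Rauzy

variable {d : ℕ} [NeZero d] (F : IntervalExchange d)

/-- Label of the last interval before the exchange. -/
def lastTop : Fin d := F.top.symm ⊤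

/-- Label of the last interval after the exchange. -/
def lastBot : Fin d := F.bot.symm ⊤

/-- One step of (unnormalised) Rauzy-Veech induction. Of the intervals that come last before and
after the exchange the shorter one (the loser) is cut off from the longer one (the winner), and in
the row where the loser is last it is moved to the position just behind the winner. (The two lengths
are never equal under Keane's condition.) The result is the first return map to the interval
`[0, total - length of the loser)`. -/
noncomputable def rauzy : IntervalExchange d :=
  if F.len F.lastBot < F.len F.lastTop then
    { top := F.top
      bot := F.bot.trans (Fin.cycleIcc (F.bot F.lastTop + 1) ⊤)
      len := Function.update F.len F.lastTop (F.len F.lastTop - F.len F.lastBot) }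
  else
    { top := F.top.trans (Fin.cycleIcc (F.top F.lastBot + 1) ⊤)
      bot := F.bot
      len := Function.update F.len F.lastBot (F.len F.lastBot - F.len F.lastTop) }

/-- `F^(n)`, the induced exchange on the nested interval `I^(n)`. -/
noncomputable def induced (n : ℕ) : IntervalExchange d := rauzy^[n] F

/-- `I^(n)`. -/
noncomputable def domain (n : ℕ) : Set ℝ := Ico 0 (F.induced n).total

/-- `q_j^(0,n)`: the first return time to `I^(n)` under `F` of the interval `I_j^(n)`. -/
noncomputable def returnTime (n : ℕ) (j : Fin d) : ℕ :=
  sInf {k : ℕ | 1 ≤ k ∧ F.map^[k] '' (F.induced n).interval j ⊆ F.domain n}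

/-- The Rauzy-Veech cocycle `A^(0,n)`: the number of floors of the tower over `I_j^(n)` which are
contained in `I_i`. -/
noncomputable def rauzyVeechCocycle (n : ℕ) : Matrix (Fin d) (Fin d) ℕ := fun i j =>
  Set.ncard {k : ℕ | k < F.returnTime n j ∧
    F.map^[k] '' (F.induced n).interval j ⊆ F.interval i}

/-- All entries of the Rauzy-Veech cocycle tend to infinity. -/
def InfinitelyComplete : Prop :=
  ∀ i j, Tendsto (fun n => F.rauzyVeechCocycle n i j) atTop atTop

end Rauzy

/-! Skew-products with values in `ℤ^m`, given by a vector `φ` of values on the `d` intervals. -/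

section Skew

variable {d m : ℕ} (F : IntervalExchange d) (φ : Fin d → (Fin m → ℤ))

/-- The cocycle on `[0, 1)`, equal to `φ i` on `I_i`. -/
noncomputable def cocycle (x : ℝ) : Fin m → ℤ :=
  ∑ i, (F.interval i).indicator (fun _ => φ i) x

/-- The cocycle on `K`, equal to `φ i` on `K_i`. -/
noncomputable def cocycleK (z : F.K) : Fin m → ℤ :=
  ∑ i, (F.piece i).indicator (fun _ => φ i) z

/-- The skew-product `F_φ (x, a) = (F x, a + φ x)`. -/
noncomputable def skew (p : ℝ × (Fin m → ℤ)) : ℝ × (Fin m → ℤ) :=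
  (F.map p.1, p.2 + F.cocycle φ p.1)

/-- The first return map of `f` to `S`. -/
noncomputable def firstReturn {X : Type*} (f : X → X) (S : Set X) (x : X) : X :=
  f^[sInf {k : ℕ | 1 ≤ k ∧ f^[k] x ∈ S}] x

/-- The `n`-th Rauzy-Veech renormalisation of the skew-product: the first return map to
`I^(n) × ℤ^m`, with the first coordinate rescaled so that `I^(n)` becomes `[0, 1)`. -/
noncomputable def renormSkew [NeZero d] (n : ℕ) (p : ℝ × (Fin m → ℤ)) : ℝ × (Fin m → ℤ) :=
  let c := (F.induced n).total
  let q := firstReturn (F.skew φ) (F.domain n ×ˢ univ) (c * p.1, p.2)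
  (q.1 / c, q.2)

/-- The skew-product is of periodic type: for some `N > 0` its `N`-th renormalisation is the
skew-product itself (with the same marked points, but possibly a different labelling of the
intervals). -/
def PeriodicType [NeZero d] : Prop :=
  ∃ N : ℕ, 0 < N ∧
    (fun x => x / (F.induced N).total) '' (F.induced N).markedPoints = F.markedPoints ∧
    EqOn (F.renormSkew φ N) (F.skew φ) (Ico (0 : ℝ) 1 ×ˢ univ)

end Skew

end IntervalExchange

/-- The measure `ν` satisfies `d(ν ∘ T)/dν = exp (-ψ ∘ φ)`. -/
def HasJacobian {X : Type*} [MeasurableSpace X] {m : ℕ} (T : X → X) (φ : X → (Fin m → ℤ))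
    (ψ : (Fin m → ℤ) →ₜ+ ℝ) (ν : Measure X) : Prop :=
  ∀ B : Set X, MeasurableSet B → ν (T '' B) = ∫⁻ x in B, ENNReal.ofReal (Real.exp (-ψ (φ x))) ∂ν

/-- The Maharam measure `dμ_ψ(x, a) = dν(x) exp (ψ a) da`, where `da` is counting measure, the Haar
measure of `ℤ^m`. -/
noncomputable def maharam {X : Type*} [MeasurableSpace X] {m : ℕ} (ψ : (Fin m → ℤ) →ₜ+ ℝ)
    (ν : Measure X) : Measure (X × (Fin m → ℤ)) :=
  (ν.prod Measure.count).withDensity fun p => ENNReal.ofReal (Real.exp (ψ p.2))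

/-!
The proof rests on Rokhlin towers. Under Keane's condition the exchange obtained after `n` steps of
Rauzy–Veech induction is the first return map to its domain, so that `[0, 1)` is partitioned into
towers over its intervals (`Tower`, `Keane.tower_induced`). For a skew product of periodic type the
induced exchange after one period is `F` scaled by some `c < 1`, and the cocycle sums up to its
original value `φ j` over the `j`-th tower (`PeriodicType.selfSimilar`); iterating, there are such
towers over `F` scaled by `c ^ n` for every `n`, and by infinite completeness `c` can be taken such
that every tower visits every interval (`SelfSimilar.exists_visits`).

On the Cantor set `K` the floors of towers over short exchanges become small clopen sets, because
the points which carry most of the mass of `ρ` lie in the interior of no floor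
(`Keane.exists_tower_dist_lt`). Hence `T` is a homeomorphism and `φ` is continuous on `K`. The
condition on the Jacobian is then equivalent to the change of variables formula
`∫ f dν = ∫ (f ∘ T) e ^ (-ψ ∘ φ) dν` for continuous `f`, which is preserved by weak limits
(`isConformalMeasure_iff`). The three parts of the claim follow.

* Existence. The left endpoint `0` is the left endpoint of one of the intervals, and its returns at
  the heights of the towers over that interval see the same sum of `φ` at all levels. The orbit
  segments up to these times, weighted by the products of the density, therefore give probability
  measures which violate the change of variables formula only by boundary terms that tend to `0`
  (`exists_isConformalMeasure`).
* Uniqueness. The masses of the copies of the scaled intervals `c ^ n * I_j` determine the masses of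
  all floors. They form a backward orbit, indexed by `n`, of one matrix, which depends neither on
  the measure nor, by self-similarity, on `n`, and which is positive as every tower visits every
  interval (`SelfSimilar.isBackwardOrbit`). A positive matrix has only one normalised backward orbit
  (`IsBackwardOrbit.unique`), and a measure is determined by the masses of the floors
  (`eq_of_forall_partition`).
* Continuity. By compactness of the space of probability measures, a family of conformal measures
  that are unique for their densities is weak-* continuous (`continuous_of_isConformalMeasure`). The
  integral of a compactly supported function against a Maharam measure is a finite sum of integrals
  against the conformal measure, weighted by `e ^ ψ a` (`exists_integral_maharam`).
-/

namespace IntervalExchange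

/-! ### Exchanges of arbitrary total length -/

section General

variable {d : ℕ} {F : IntervalExchange d}

/-- All exchanged intervals are nondegenerate; unlike `IsUnitExchange`, this does not fix the total
length, so that it applies to the induced exchanges. -/
def LenPos (F : IntervalExchange d) : Prop := ∀ i, 0 < F.len i

/-- The inverse exchange: the orders before and after the exchange are swapped. -/
def inv (F : IntervalExchange d) : IntervalExchange d := ⟨F.bot, F.top, F.len⟩

lemma LenPos.inv (hF : F.LenPos) : F.inv.LenPos := hF

lemma LenPos.topLeft_nonneg (hF : F.LenPos) (j : Fin d) : 0 ≤ F.topLeft j :=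
  Finset.sum_nonneg fun i _ => by
    split_ifs
    · exact (hF i).le
    · exact le_rfl

lemma LenPos.topLeft_add_le (hF : F.LenPos) {i j : Fin d} (h : F.top i < F.top j) :
    F.topLeft i + F.len i ≤ F.topLeft j := by
  have h1 : F.len i = ∑ k, if k = i then F.len k else 0 := by simp
  unfold topLeft
  rw [h1, ← Finset.sum_add_distrib]
  refine Finset.sum_le_sum fun k _ => ?_
  have := (hF k).le
  by_cases hk : k = i
  · subst hk; simp [h]
  · simp only [hk, if_false, add_zero]
    by_cases h3 : F.top k < F.top i
    · simp [h3, h3.trans h]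
    · simp only [h3, if_false]; split_ifs <;> linarith

lemma LenPos.topLeft_add_le_total (hF : F.LenPos) (j : Fin d) :
    F.topLeft j + F.len j ≤ F.total := by
  have h1 : F.len j = ∑ k, if k = j then F.len k else 0 := by simp
  unfold topLeft total
  rw [h1, ← Finset.sum_add_distrib]
  refine Finset.sum_le_sum fun k _ => ?_
  have := (hF k).le
  by_cases hk : k = j
  · subst hk; simp
  · simp only [hk, if_false, add_zero]
    split_ifs <;> linarith

lemma LenPos.botLeft_add_le_total (hF : F.LenPos) (j : Fin d) :
    F.botLeft j + F.len j ≤ F.total :=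
  hF.inv.topLeft_add_le_total j

lemma LenPos.interval_subset (hF : F.LenPos) (j : Fin d) : F.interval j ⊆ Ico 0 F.total :=
  fun _ hx => ⟨(hF.topLeft_nonneg j).trans hx.1, hx.2.trans_le (hF.topLeft_add_le_total j)⟩

lemma LenPos.topLeft_mem (hF : F.LenPos) (j : Fin d) : F.topLeft j ∈ F.interval j :=
  ⟨le_rfl, lt_add_of_pos_right _ (hF j)⟩

lemma LenPos.index_unique (hF : F.LenPos) {x : ℝ} {i j : Fin d} (hi : x ∈ F.interval i)
    (hj : x ∈ F.interval j) : i = j := by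
  by_contra hij
  rcases lt_or_gt_of_ne (fun h => hij (F.top.injective h)) with h | h
  · have := hF.topLeft_add_le h
    linarith [hi.2, hj.1]
  · have := hF.topLeft_add_le h
    linarith [hi.1, hj.2]

lemma LenPos.topLeft_injective (hF : F.LenPos) : Function.Injective F.topLeft := fun i j h =>
  hF.index_unique (hF.topLeft_mem i) (h ▸ hF.topLeft_mem j)

lemma LenPos.exists_mem_interval (_hF : F.LenPos) {x : ℝ} (hx : x ∈ Ico 0 F.total) :
    ∃ j, x ∈ F.interval j := by
  classical
  by_contra hcon
  push Not at hcon
  have hstep : ∀ (n : ℕ) (_ : n ≤ d), (∑ i, if (F.top i : ℕ) < n then F.len i else 0) ≤ x := by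
    intro n
    induction n with
    | zero => intro _; simpa using hx.1
    | succ n ih =>
      intro hn
      have hp := ih (by omega)
      set j := F.top.symm ⟨n, by omega⟩ with hj
      have hjn : (F.top j : ℕ) = n := by simp [hj]
      have e1 : F.topLeft j = ∑ i, if (F.top i : ℕ) < n then F.len i else 0 := by
        unfold topLeft
        refine Finset.sum_congr rfl fun i _ => ?_
        simp only [Fin.lt_def, hjn]
      have hq : F.topLeft j + F.len j ≤ x := by
        by_contra hlt
        exact hcon j ⟨e1 ▸ hp, not_le.1 hlt⟩
      refine (le_of_eq ?_).trans hq
      have h2 : F.len j = ∑ k, if k = j then F.len k else 0 := by simp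
      rw [e1, h2, ← Finset.sum_add_distrib]
      refine Finset.sum_congr rfl fun k _ => ?_
      by_cases hk : k = j
      · subst hk; simp [hjn]
      · have : (F.top k : ℕ) ≠ n := by
          intro h
          exact hk (F.top.injective (Fin.ext (h.trans hjn.symm)))
        simp only [hk, if_false, add_zero]
        by_cases h3 : (F.top k : ℕ) < n
        · simp [h3, h3.trans (Nat.lt_succ_self n)]
        · have h4 : ¬ (F.top k : ℕ) < n + 1 := by omega
          simp [h3, h4]
  refine absurd ((le_of_eq ?_).trans (hstep d le_rfl)) (not_le.2 hx.2)
  simp [total]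

lemma LenPos.map_eq (hF : F.LenPos) {x : ℝ} {j : Fin d} (hx : x ∈ F.interval j) :
    F.map x = x + (F.botLeft j - F.topLeft j) := by
  unfold map
  rw [Finset.sum_eq_single j, indicator_of_mem hx]
  · exact fun i _ hij => indicator_of_notMem (fun hi => hij (hF.index_unique hi hx)) _
  · simp

lemma LenPos.map_mem_inv_interval (hF : F.LenPos) {x : ℝ} {j : Fin d} (hx : x ∈ F.interval j) :
    F.map x ∈ F.inv.interval j := by
  rw [hF.map_eq hx]
  exact ⟨by change F.botLeft j ≤ _; linarith [hx.1],
    by change _ < F.botLeft j + F.len j; linarith [hx.2]⟩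

lemma LenPos.map_mem (hF : F.LenPos) {x : ℝ} (hx : x ∈ Ico 0 F.total) :
    F.map x ∈ Ico 0 F.total := by
  obtain ⟨j, hj⟩ := hF.exists_mem_interval hx
  exact hF.inv.interval_subset j (hF.map_mem_inv_interval hj)

lemma LenPos.inv_map_map (hF : F.LenPos) {x : ℝ} (hx : x ∈ Ico 0 F.total) :
    F.inv.map (F.map x) = x := by
  obtain ⟨j, hj⟩ := hF.exists_mem_interval hx
  rw [hF.inv.map_eq (hF.map_mem_inv_interval hj), hF.map_eq hj]
  change x + (F.botLeft j - F.topLeft j) + (F.topLeft j - F.botLeft j) = x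
  ring

lemma LenPos.iterate_mem (hF : F.LenPos) {x : ℝ} (hx : x ∈ Ico 0 F.total) (n : ℕ) :
    F.map^[n] x ∈ Ico 0 F.total := by
  induction n with
  | zero => exact hx
  | succ n ih => rw [Function.iterate_succ_apply']; exact hF.map_mem ih

lemma LenPos.map_inj (hF : F.LenPos) {x y : ℝ} (hx : x ∈ Ico 0 F.total)
    (hy : y ∈ Ico 0 F.total) (h : F.map x = F.map y) : x = y := by
  rw [← hF.inv_map_map hx, h, hF.inv_map_map hy]

lemma LenPos.iterate_inj (hF : F.LenPos) {x y : ℝ} (hx : x ∈ Ico 0 F.total)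
    (hy : y ∈ Ico 0 F.total) {n : ℕ} (h : F.map^[n] x = F.map^[n] y) : x = y := by
  induction n with
  | zero => exact h
  | succ n ih =>
    rw [Function.iterate_succ_apply', Function.iterate_succ_apply'] at h
    exact ih (hF.map_inj (hF.iterate_mem hx n) (hF.iterate_mem hy n) h)

lemma LenPos.exists_topLeft_eq_zero [NeZero d] (hF : F.LenPos) : ∃ i, F.topLeft i = 0 := by
  have h0 : (0 : ℝ) ∈ Ico 0 F.total :=
    ⟨le_rfl, Finset.sum_pos (fun i _ => hF i) Finset.univ_nonempty⟩
  obtain ⟨i, hi⟩ := hF.exists_mem_interval h0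
  exact ⟨i, le_antisymm hi.1 (hF.topLeft_nonneg i)⟩

lemma LenPos.total_pos [NeZero d] (hF : F.LenPos) : 0 < F.total :=
  Finset.sum_pos (fun i _ => hF i) Finset.univ_nonempty

lemma IsUnitExchange.lenPos (hF : F.IsUnitExchange) : F.LenPos := hF.len_pos

lemma mem_markedPoints {i : Fin d} (h : F.topLeft i ≠ 0) : F.topLeft i ∈ F.markedPoints :=
  ⟨⟨i, rfl⟩, h⟩

end General

/-! ### Rokhlin towers over a smaller exchange -/

section Towers

variable {d : ℕ} {F H G : IntervalExchange d} {h h' : Fin d → ℕ}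

/-- `[0, F.total)` is partitioned into Rokhlin towers over the intervals of `H`, the tower over the
`j`-th interval having `h j` floors, each of which is contained in one of the intervals of `F`;
moreover `H` is the first return map of `F` to `[0, H.total)`, and the orbit of each of its interior
left endpoints meets a marked point of `F` within the tower. The heights are data; they are not
defined as return times. -/
structure Tower (F H : IntervalExchange d) (h : Fin d → ℕ) : Prop where
  pos : ∀ j, 0 < h j
  total_le : H.total ≤ F.total
  mem : ∀ j, ∀ t < h j, ∃ i, ∀ x ∈ H.interval j, F.map^[t] x ∈ F.interval i
  ret : ∀ j, ∀ x ∈ H.interval j, F.map^[h j] x = H.map x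
  le_of_lt : ∀ j, ∀ t < h j, 0 < t → ∀ x ∈ H.interval j, H.total ≤ F.map^[t] x
  cover : ∀ y ∈ Ico 0 F.total, ∃ j, ∃ t < h j, ∃ x ∈ H.interval j, F.map^[t] x = y
  endpoint : ∀ j, H.topLeft j = 0 ∨ ∃ t < h j, F.map^[t] (H.topLeft j) ∈ F.markedPoints

lemma Tower.refl (hF : F.LenPos) : Tower F F fun _ => 1 where
  pos _ := one_pos
  total_le := le_rfl
  mem j t ht := ⟨j, fun x hx => by obtain rfl : t = 0 := by omega
                                   exact hx⟩
  ret _ _ _ := rfl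
  le_of_lt j t ht ht' := by omega
  cover y hy := by
    obtain ⟨j, hj⟩ := hF.exists_mem_interval hy
    exact ⟨j, 0, one_pos, y, hj, rfl⟩
  endpoint j := by
    by_cases h0 : F.topLeft j = 0
    · exact Or.inl h0
    · exact Or.inr ⟨0, one_pos, mem_markedPoints h0⟩

/-- A number below the sum of consecutive block lengths lies in one of the blocks. -/
lemma exists_block (g : ℕ → ℕ) (n s : ℕ) (hs : s < ∑ t ∈ Finset.range n, g t) :
    ∃ t < n, ∃ r < g t, s = (∑ t' ∈ Finset.range t, g t') + r := by
  induction n with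
  | zero => simp at hs
  | succ n ih =>
    by_cases hlt : s < ∑ t ∈ Finset.range n, g t
    · obtain ⟨t, ht, r, hr, e⟩ := ih hlt
      exact ⟨t, by omega, r, hr, e⟩
    · rw [Finset.sum_range_succ] at hs
      exact ⟨n, by omega, s - ∑ t ∈ Finset.range n, g t, by omega, by omega⟩

lemma block_lt (g : ℕ → ℕ) {n t r : ℕ} (ht : t < n) (hr : r < g t) :
    (∑ t' ∈ Finset.range t, g t') + r < ∑ t ∈ Finset.range n, g t := by
  have : ∑ t' ∈ Finset.range (t + 1), g t' ≤ ∑ t' ∈ Finset.range n, g t' :=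
    Finset.sum_le_sum_of_subset (Finset.range_mono (by omega))
  rw [Finset.sum_range_succ] at this
  omega

/-- The visits of a tower of `H` over `G` translate into blocks of iterates of `F`. -/
lemma Tower.iterate_block (hFH : Tower F H h) {w : ℕ → Fin d} {n : ℕ} {x : ℝ}
    (hw : ∀ t < n, H.map^[t] x ∈ H.interval (w t)) :
    ∀ t ≤ n, F.map^[∑ t' ∈ Finset.range t, h (w t')] x = H.map^[t] x := by
  intro t
  induction t with
  | zero => intro _; rfl
  | succ t ih =>
    intro ht
    rw [Finset.sum_range_succ, add_comm, Function.iterate_add_apply, ih (by omega),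
      hFH.ret _ _ (hw t (by omega)), Function.iterate_succ_apply']

lemma Tower.exists_iterate (hFH : Tower F H h) (hH : H.LenPos) {x : ℝ}
    (hx : x ∈ Ico 0 H.total) (n : ℕ) : ∃ k, n ≤ k ∧ F.map^[k] x = H.map^[n] x := by
  have : ∀ t, ∃ i, H.map^[t] x ∈ H.interval i :=
    fun t => hH.exists_mem_interval (hH.iterate_mem hx t)
  choose w hw using this
  refine ⟨_, ?_, hFH.iterate_block (fun t _ => hw t) n le_rfl⟩
  calc n = ∑ t ∈ Finset.range n, 1 := by simp
    _ ≤ _ := Finset.sum_le_sum fun t _ => hFH.pos _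

/-- Towers over towers are towers; a cocycle which sums up to `φ'` over the towers of `H`, with
`φ'` summing up to `φ''` over the towers of `G`, sums up to `φ''` over the combined towers. -/
lemma Tower.trans (hFH : Tower F H h) (hHG : Tower H G h') (hH : H.LenPos) (hG : G.LenPos) :
    ∃ h'' : Fin d → ℕ, Tower F G h'' ∧
      ∀ {m : ℕ} (φ φ' φ'' : Fin d → Fin m → ℤ),
        (∀ j, ∀ x ∈ H.interval j, birkhoffSum F.map (F.cocycle φ) (h j) x = φ' j) →
        (∀ j, ∀ x ∈ G.interval j, birkhoffSum H.map (H.cocycle φ') (h' j) x = φ'' j) →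
        ∀ j, ∀ x ∈ G.interval j, birkhoffSum F.map (F.cocycle φ) (h'' j) x = φ'' j := by
  classical
  have hw : ∀ j, ∀ t, ∃ i, t < h' j → ∀ x ∈ G.interval j, H.map^[t] x ∈ H.interval i := by
    intro j t
    by_cases ht : t < h' j
    · obtain ⟨i, hi⟩ := hHG.mem j t ht
      exact ⟨i, fun _ => hi⟩
    · exact ⟨j, fun h => absurd h ht⟩
  choose w hw using hw
  have hblock : ∀ j, ∀ x ∈ G.interval j, ∀ t ≤ h' j,
      F.map^[∑ t' ∈ Finset.range t, h (w j t')] x = H.map^[t] x := fun j x hx =>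
    hFH.iterate_block fun t ht => hw j t ht x hx
  refine ⟨fun j => ∑ t ∈ Finset.range (h' j), h (w j t), ⟨?_, hHG.total_le.trans hFH.total_le,
    ?_, ?_, ?_, ?_, ?_⟩, ?_⟩
  · exact fun j => Finset.sum_pos (fun t _ => hFH.pos _) ⟨0, Finset.mem_range.2 (hHG.pos j)⟩
  · intro j s hs
    obtain ⟨t, ht, r, hr, rfl⟩ := exists_block _ _ _ hs
    obtain ⟨i, hi⟩ := hFH.mem (w j t) r hr
    refine ⟨i, fun x hx => ?_⟩
    rw [add_comm, Function.iterate_add_apply, hblock j x hx t ht.le]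
    exact hi _ (hw j t ht x hx)
  · intro j x hx
    rw [hblock j x hx _ le_rfl, hHG.ret j x hx]
  · intro j s hs hs0 x hx
    obtain ⟨t, ht, r, hr, rfl⟩ := exists_block _ _ _ hs
    rw [add_comm, Function.iterate_add_apply, hblock j x hx t ht.le]
    rcases Nat.eq_zero_or_pos r with rfl | hr0
    · have ht0 : 0 < t := by
        rcases Nat.eq_zero_or_pos t with rfl | h0
        · simp at hs0
        · exact h0
      exact hHG.le_of_lt j t ht ht0 x hx
    · exact hHG.total_le.trans (hFH.le_of_lt _ r hr hr0 _ (hw j t ht x hx))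
  · intro y hy
    obtain ⟨i, r, hr, x, hx, rfl⟩ := hFH.cover y hy
    obtain ⟨j, t, ht, z, hz, rfl⟩ := hHG.cover x (hH.interval_subset i hx)
    obtain rfl := hH.index_unique hx (hw j t ht z hz)
    refine ⟨j, _, block_lt (fun t => h (w j t)) ht hr, z, hz, ?_⟩
    rw [add_comm, Function.iterate_add_apply, hblock j z hz t ht.le]
  · intro j
    rcases hHG.endpoint j with h0 | ⟨t, ht, ⟨i, hi⟩, hne⟩
    · exact Or.inl h0
    · have hmem := hw j t ht _ (hG.topLeft_mem j)
      obtain rfl := hH.index_unique (hi ▸ hH.topLeft_mem i) hmem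
      rcases hFH.endpoint (w j t) with h0 | ⟨r, hr, hm⟩
      · exact absurd (hi.symm.trans h0) hne
      · refine Or.inr ⟨_, block_lt (fun t => h (w j t)) ht hr, ?_⟩
        rw [add_comm, Function.iterate_add_apply, hblock j _ (hG.topLeft_mem j) t ht.le, ← hi]
        exact hm
  · intro m φ φ' φ'' h1 h2 j x hx
    have hsum : ∀ t ≤ h' j,
        birkhoffSum F.map (F.cocycle φ) (∑ t' ∈ Finset.range t, h (w j t')) x
          = birkhoffSum H.map (H.cocycle φ') t x := by
      intro t
      induction t with
      | zero => intro _; simp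
      | succ t ih =>
        intro ht
        have hm := hw j t (by omega) x hx
        rw [Finset.sum_range_succ, birkhoffSum_add, ih (by omega), hblock j x hx t (by omega),
          birkhoffSum_succ, h1 _ _ hm]
        congr 1
        unfold cocycle
        rw [Finset.sum_eq_single (w j t), indicator_of_mem hm]
        · exact fun i _ hij => indicator_of_notMem (fun hi => hij (hH.index_unique hi hm)) _
        · simp
    rw [hsum _ le_rfl, h2 j x hx]

lemma LenPos.cocycle_eq (hF : F.LenPos) {m : ℕ} (φ : Fin d → Fin m → ℤ) {x : ℝ} {j : Fin d}
    (hx : x ∈ F.interval j) : F.cocycle φ x = φ j := by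
  unfold cocycle
  rw [Finset.sum_eq_single j, indicator_of_mem hx]
  · exact fun i _ hij => indicator_of_notMem (fun hi => hij (hF.index_unique hi hx)) _
  · simp

/-- The floors of a tower are pairwise disjoint. -/
lemma Tower.floor_unique (hFH : Tower F H h) (hF : F.LenPos) (hH : H.LenPos) {i j : Fin d}
    {s t : ℕ} (hs : s < h i) (ht : t < h j) {x y : ℝ} (hx : x ∈ H.interval i)
    (hy : y ∈ H.interval j) (e : F.map^[s] x = F.map^[t] y) : s = t ∧ i = j ∧ x = y := by
  wlog hst : s ≤ t generalizing i j s t x y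
  · obtain ⟨h1, h2, h3⟩ := this ht hs hy hx e.symm (by omega)
    exact ⟨h1.symm, h2.symm, h3.symm⟩
  have hx' := hH.interval_subset i hx
  have hy' := hH.interval_subset j hy
  have hsub : Ico 0 H.total ⊆ Ico 0 F.total := Ico_subset_Ico_right hFH.total_le
  obtain ⟨k, rfl⟩ := Nat.exists_eq_add_of_le hst
  rw [Function.iterate_add_apply] at e
  have e' := hF.iterate_inj (hsub hx') (hF.iterate_mem (hsub hy') k) e
  rcases Nat.eq_zero_or_pos k with rfl | hk
  · have : x = y := e'
    subst this
    exact ⟨rfl, hH.index_unique hx hy, rfl⟩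
  · have := hFH.le_of_lt j k (by omega) hk y hy
    rw [← e'] at this
    exact absurd hx'.2 (not_lt.2 this)

/-- Keane's condition passes to induced exchanges. -/
lemma Tower.keane [NeZero d] (hFH : Tower F H h) (hF : F.LenPos) (hH : H.LenPos) (hK : F.Keane) :
    H.Keane := by
  intro i n hn ⟨⟨k, hk⟩, hne⟩
  have hi := hH.interval_subset i (hH.topLeft_mem i)
  -- An iterate of `H` is an iterate of `F` after the whole first tower, so that the singularity in
  -- that tower is passed strictly before the marked point in the last one is reached.
  obtain ⟨N, hN, hNe⟩ : ∃ N, h i ≤ N ∧ F.map^[N] (H.topLeft i) = H.map^[n] (H.topLeft i) := by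
    obtain ⟨n, rfl⟩ := Nat.exists_eq_add_of_le hn
    obtain ⟨k, -, hk⟩ := hFH.exists_iterate hH (hH.map_mem hi) n
    refine ⟨k + h i, by omega, ?_⟩
    rw [Function.iterate_add_apply, hFH.ret _ _ (hH.topLeft_mem i), hk, add_comm 1 n,
      Function.iterate_succ_apply]
  rcases hFH.endpoint k with h0 | ⟨t, -, ht⟩
  · exact hne (by rw [← hk, h0]; rfl)
  rw [hk, ← hNe, ← Function.iterate_add_apply] at ht
  rcases hFH.endpoint i with h0 | ⟨s, hs, ⟨l, hl⟩, -⟩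
  · obtain ⟨i0, hi0⟩ := hF.exists_topLeft_eq_zero
    rw [h0, ← hi0] at ht
    exact hK i0 _ (by have := hFH.pos i; omega) ht
  · obtain ⟨e, he⟩ := Nat.exists_eq_add_of_le (show s + 1 ≤ t + N by omega)
    rw [show t + N = (e + 1) + s by omega, Function.iterate_add_apply, ← hl] at ht
    exact hK l _ (by omega) ht

end Towers

end IntervalExchange

namespace IntervalExchange

/-! ### Rauzy–Veech induction as a first return map -/

section RauzyStep

variable {d : ℕ}

lemma total_update (len : Fin d → ℝ) (α : Fin d) (c : ℝ) :
    ∑ i, Function.update len α (len α - c) i = (∑ i, len i) - c := by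
  have : ∀ i, Function.update len α (len α - c) i = len i - if i = α then c else 0 := by
    intro i
    by_cases hi : i = α
    · subst hi; simp
    · simp [hi]
  simp [this, Finset.sum_sub_distrib]

variable [NeZero d]

lemma val_trans_cycleIcc (p : Equiv.Perm (Fin d)) {α : Fin d} (hα : p α ≠ ⊤) (i : Fin d) :
    ((p.trans (Fin.cycleIcc (p α + 1) ⊤)) i : ℕ) =
      if (p i : ℕ) ≤ p α then (p i : ℕ) else if p i = ⊤ then (p α : ℕ) + 1 else (p i : ℕ) + 1 := by
  have hlast : ((⊤ : Fin d) : ℕ) = d - 1 := by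
    have h1 := (⊤ : Fin d).isLt
    have h2 : (⟨d - 1, by omega⟩ : Fin d) ≤ ⊤ := le_top
    rw [Fin.le_def] at h2
    simp only at h2
    omega
  have hlt : ∀ k : Fin d, k ≠ ⊤ → (k : ℕ) + 1 < d := by
    intro k hk
    have h1 : (k : ℕ) ≠ d - 1 := fun h => hk (Fin.ext (h.trans hlast.symm))
    have := k.isLt
    omega
  have hadd : ∀ k : Fin d, k ≠ ⊤ → ((k + 1 : Fin d) : ℕ) = k + 1 := fun k hk =>
    Fin.val_add_one_of_lt' (hlt k hk)
  rw [Equiv.trans_apply]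
  split_ifs with h1 h2
  · rw [Fin.cycleIcc_of_lt]
    rw [Fin.lt_def, hadd _ hα]
    omega
  · rw [h2, Fin.cycleIcc_of_last le_top, hadd _ hα]
  · rw [Fin.cycleIcc_of_ge_of_lt, hadd _ h2]
    · rw [Fin.le_def, hadd _ hα]
      omega
    · exact lt_top_iff_ne_top.2 h2

/-- How left endpoints change when the loser `p.symm ⊤` is moved just behind the winner `α`, whose
length decreases by that of the loser: only that of the loser does. -/
lemma left_after_move (p : Equiv.Perm (Fin d)) (len : Fin d → ℝ) {α : Fin d} (hα : p α ≠ ⊤)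
    (j : Fin d) :
    (∑ i, if (p.trans (Fin.cycleIcc (p α + 1) ⊤)) i < (p.trans (Fin.cycleIcc (p α + 1) ⊤)) j
      then Function.update len α (len α - len (p.symm ⊤)) i else 0) =
    if j = p.symm ⊤ then (∑ i, if p i < p α then len i else 0) + (len α - len (p.symm ⊤))
      else ∑ i, if p i < p j then len i else 0 := by
  set β := p.symm ⊤ with hβ
  have hpβ : p β = ⊤ := by simp [hβ]
  have htop : ∀ i, p i = ⊤ ↔ i = β := fun i => by rw [← hpβ, p.injective.eq_iff]
  have hαβ : α ≠ β := fun e => hα ((htop α).2 e)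
  have hle : ∀ i, (p i : ℕ) ≤ p β := fun i => by
    rw [hpβ]
    exact Fin.le_def.1 le_top
  have hval : ∀ i, (p i : ℕ) = p α ↔ i = α := fun i => by
    rw [← Fin.ext_iff, p.injective.eq_iff]
  have hvalβ : ∀ i, (p i : ℕ) = p β ↔ i = β := fun i => by
    rw [← Fin.ext_iff, p.injective.eq_iff]
  have hαlt : (p α : ℕ) < p β := lt_of_le_of_ne (hle α) (fun e => hαβ ((hvalβ α).1 e))
  simp only [Fin.lt_def, val_trans_cycleIcc p hα, htop]
  by_cases hj : j = β
  · subst hj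
    rw [if_pos rfl, if_neg hαlt.not_ge, if_pos rfl]
    have e : (len α - len β) = ∑ i, if i = α then len α - len β else 0 := by simp
    rw [e, ← Finset.sum_add_distrib]
    refine Finset.sum_congr rfl fun i _ => ?_
    have h1 := hle i
    have h2 := hval i
    have h3 := hvalβ i
    by_cases hi : i = α
    · subst hi
      simp
    · rw [Function.update_of_ne hi]
      have h4 : (p i : ℕ) ≠ p α := fun e => hi (h2.1 e)
      by_cases hiβ : i = β
      · subst hiβ
        simp [hαlt.not_ge, hαlt.not_gt, hi]
      · simp only [hi, hiβ, if_false, add_zero]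
        congr 1
        simp only [eq_iff_iff]
        split_ifs <;> omega
  rw [if_neg hj, if_neg hj]
  split_ifs with h2
  · refine Finset.sum_congr rfl fun i _ => ?_
    have h1 := hle i
    by_cases hi : i = α
    · subst hi
      rw [if_neg (by simp; omega), if_neg (by omega)]
    · rw [Function.update_of_ne hi]
      congr 1
      simp only [eq_iff_iff]
      split_ifs <;> omega
  · have e : (∑ i, if (p i : ℕ) < p j then len i else 0) =
        ∑ i, ((if (p i : ℕ) < p j then len i else 0) + (if i = α then - len β else 0)
          + (if i = β then len β else 0)) := by
      rw [Finset.sum_add_distrib, Finset.sum_add_distrib]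
      simp
    rw [e]
    refine Finset.sum_congr rfl fun i _ => ?_
    have h3 := hle j
    have h4 : (p j : ℕ) ≠ p β := fun e => hj ((hvalβ j).1 e)
    have h5 := hle i
    have h6 := hvalβ i
    by_cases hi : i = α
    · subst hi
      simp [hαβ]
      rw [if_pos (by omega), if_pos (by omega)]
      ring
    · rw [Function.update_of_ne hi]
      by_cases hiβ : i = β
      · subst hiβ
        simp only [hαlt.not_ge, hi, if_false, if_true]
        rw [if_pos (by omega), if_neg (by omega)]
        ring
      · simp only [hi, hiβ, if_false, add_zero]
        congr 1
        simp only [eq_iff_iff]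
        split_ifs <;> omega

variable {F : IntervalExchange d}

lemma le_lastTop (i : Fin d) : F.top i ≤ F.top F.lastTop := by simp [lastTop]

lemma topLeft_lastTop : F.topLeft F.lastTop = F.total - F.len F.lastTop := by
  unfold topLeft total
  have e : F.len F.lastTop = ∑ i, if i = F.lastTop then F.len i else 0 := by simp
  rw [e, ← Finset.sum_sub_distrib]
  refine Finset.sum_congr rfl fun i _ => ?_
  by_cases hi : i = F.lastTop
  · simp [hi]
  · have : F.top i < F.top F.lastTop :=
      lt_of_le_of_ne (le_lastTop i) fun e => hi (F.top.injective e)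
    simp [hi, this]

lemma botLeft_lastBot : F.botLeft F.lastBot = F.total - F.len F.lastBot :=
  topLeft_lastTop (F := F.inv)

/-- Under Keane's condition the last intervals before and after the exchange are different and have
different lengths, as otherwise the image of a left endpoint would be the last marked point. -/
lemma Keane.last_ne (hd : 2 ≤ d) (hF : F.LenPos) (hK : F.Keane) :
    F.lastTop ≠ F.lastBot ∧ F.len F.lastTop ≠ F.len F.lastBot := by
  have key : F.len F.lastTop ≠ F.len F.lastBot := by
    intro e
    have h1 : F.map (F.topLeft F.lastBot) = F.topLeft F.lastTop := by
      rw [hF.map_eq (hF.topLeft_mem _), botLeft_lastBot, topLeft_lastTop, e]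
      ring
    refine hK F.lastBot 1 le_rfl ?_
    rw [Function.iterate_one, h1]
    refine mem_markedPoints (ne_of_gt ?_)
    -- some other interval lies to the left of the last one
    have : Nontrivial (Fin d) := Fin.nontrivial_iff_two_le.2 hd
    obtain ⟨i, hi⟩ := exists_ne F.lastTop
    have h2 := hF.topLeft_add_le
      (lt_of_le_of_ne (le_lastTop i) fun e => hi (F.top.injective e))
    linarith [hF i, hF.topLeft_nonneg i]
  exact ⟨fun e => key (by rw [e]), key⟩

lemma Tower.of_len_lastBot_lt (hF : F.LenPos) (hne : F.lastTop ≠ F.lastBot)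
    (hlt : F.len F.lastBot < F.len F.lastTop) :
    F.rauzy.LenPos ∧ F.rauzy.total < F.total ∧
      Tower F F.rauzy (fun j => if j = F.lastBot then 2 else 1) := by
  set α := F.lastTop with hα
  set β := F.lastBot with hβ
  set H := F.rauzy with hH
  have hHdef : H = { top := F.top
                     bot := F.bot.trans (Fin.cycleIcc (F.bot α + 1) ⊤)
                     len := Function.update F.len α (F.len α - F.len β) } := by
    rw [hH, rauzy, if_pos hlt]
  have hbα : F.bot α ≠ ⊤ := by
    intro e
    exact hne (by rw [hβ, lastBot, ← e, Equiv.symm_apply_apply])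
  have lenα : H.len α = F.len α - F.len β := by simp [hHdef]
  have len_ne : ∀ j, j ≠ α → H.len j = F.len j := fun j hj => by simp [hHdef, hj]
  have htot : H.total = F.total - F.len β := by
    rw [hHdef]
    exact total_update F.len α (F.len β)
  have htl : ∀ j, H.topLeft j = F.topLeft j := by
    intro j
    rw [hHdef]
    unfold topLeft
    refine Finset.sum_congr rfl fun i _ => ?_
    by_cases hi : i = α
    · have : ¬ F.top i < F.top j := not_lt.2 (hi ▸ le_lastTop j)
      simp [this]
    · simp [hi]
  have hbl : ∀ j, H.botLeft j =
      if j = β then F.botLeft α + (F.len α - F.len β) else F.botLeft j := by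
    intro j
    rw [hHdef]
    exact left_after_move F.bot F.len hbα j
  have hpos : H.LenPos := by
    intro j
    by_cases hj : j = α
    · rw [hj, lenα]; linarith
    · rw [len_ne j hj]; exact hF j
  have hsub : ∀ j, H.interval j ⊆ F.interval j := by
    intro j
    refine Ico_subset_Ico (htl j).ge ?_
    rw [htl]
    by_cases hj : j = α
    · rw [hj, lenα]; linarith [hF β]
    · rw [len_ne j hj]
  -- the interval `β` is mapped to the end of the winner, which is not in the new domain
  have hβmap : ∀ x ∈ F.interval β, F.map x = x + (F.total - F.len β - F.topLeft β) := by
    intro x hx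
    rw [hF.map_eq hx, botLeft_lastBot]
  have hβα : ∀ x ∈ F.interval β, F.map x ∈ F.interval α := by
    intro x hx
    rw [hβmap x hx]
    have h1 := topLeft_lastTop (F := F)
    rw [← hα] at h1
    exact ⟨by linarith [hx.1], by linarith [hx.2]⟩
  refine ⟨hpos, by rw [htot]; linarith [hF β], ?_, ?_, ?_, ?_, ?_, ?_, ?_⟩
  · intro j; split_ifs <;> norm_num
  · rw [htot]; linarith [hF β]
  · intro j t ht
    rcases Nat.eq_zero_or_pos t with rfl | ht0
    · exact ⟨j, fun x hx => hsub j hx⟩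
    · split_ifs at ht with hj
      · obtain rfl : t = 1 := by omega
        exact ⟨α, fun x hx => hβα x (hj ▸ hsub j hx)⟩
      · omega
  · intro j x hx
    rw [hpos.map_eq hx, hbl, htl]
    split_ifs with hj
    · have hx' : x ∈ F.interval β := hj ▸ hsub j hx
      rw [Function.iterate_succ_apply, Function.iterate_one, hF.map_eq (hβα x hx'), hβmap x hx',
        hα, topLeft_lastTop, hj]
      ring
    · exact hF.map_eq (hsub j hx)
  · intro j t ht ht0 x hx
    split_ifs at ht with hj
    · obtain rfl : t = 1 := by omega
      have hx' : x ∈ F.interval β := hj ▸ hsub j hx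
      rw [Function.iterate_one, hβmap x hx', htot]
      linarith [hx'.1]
    · omega
  · intro y hy
    obtain ⟨j, hj⟩ := hF.exists_mem_interval hy
    have hp : 0 < (if j = β then 2 else 1) := by split_ifs <;> norm_num
    by_cases hjα : j = α
    · by_cases hyt : y < F.total - F.len β
      · refine ⟨j, 0, hp, y, ⟨(htl j).le.trans hj.1, ?_⟩, rfl⟩
        rw [htl, hjα, lenα, hα, topLeft_lastTop, ← hα]
        linarith
      · have hx : y - (F.total - F.len β - F.topLeft β) ∈ F.interval β :=
          ⟨by linarith, by linarith [hy.2]⟩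
        refine ⟨β, 1, by simp, _, ⟨(htl β).le.trans hx.1, ?_⟩, ?_⟩
        · rw [htl, len_ne β (Ne.symm hne)]
          exact hx.2
        · rw [Function.iterate_one, hβmap _ hx]
          ring
    · refine ⟨j, 0, hp, y, ⟨(htl j).le.trans hj.1, ?_⟩, rfl⟩
      rw [htl, len_ne j hjα]
      exact hj.2
  · intro j
    rw [htl]
    by_cases h0 : F.topLeft j = 0
    · exact Or.inl h0
    · exact Or.inr ⟨0, by split_ifs <;> norm_num, mem_markedPoints h0⟩

lemma Tower.of_len_lastTop_lt (hd : 2 ≤ d) (hF : F.LenPos) (hne : F.lastTop ≠ F.lastBot)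
    (hlt : F.len F.lastTop < F.len F.lastBot) :
    F.rauzy.LenPos ∧ F.rauzy.total < F.total ∧
      Tower F F.rauzy (fun j => if j = F.lastTop then 2 else 1) := by
  set α := F.lastTop with hα
  set β := F.lastBot with hβ
  set H := F.rauzy with hH
  have hHdef : H = { top := F.top.trans (Fin.cycleIcc (F.top β + 1) ⊤)
                     bot := F.bot
                     len := Function.update F.len β (F.len β - F.len α) } := by
    rw [hH, rauzy, if_neg hlt.not_gt]
  have htβ : F.top β ≠ ⊤ := by
    intro e
    exact hne (by rw [hα, lastTop, ← e, Equiv.symm_apply_apply])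
  have lenβ : H.len β = F.len β - F.len α := by simp [hHdef]
  have len_ne : ∀ j, j ≠ β → H.len j = F.len j := fun j hj => by simp [hHdef, hj]
  have htot : H.total = F.total - F.len α := by
    rw [hHdef]
    exact total_update F.len β (F.len α)
  have hbl : ∀ j, H.botLeft j = F.botLeft j := by
    intro j
    rw [hHdef]
    unfold botLeft
    refine Finset.sum_congr rfl fun i _ => ?_
    by_cases hi : i = β
    · have : ¬ F.bot i < F.bot j := not_lt.2 (hi ▸ le_lastTop (F := F.inv) j)
      simp [this]
    · simp [hi]
  have htl : ∀ j, H.topLeft j =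
      if j = α then F.topLeft β + (F.len β - F.len α) else F.topLeft j := by
    intro j
    rw [hHdef]
    exact left_after_move F.top F.len htβ j
  have htlα : H.topLeft α = F.topLeft β + (F.len β - F.len α) := by rw [htl, if_pos rfl]
  have htl_ne : ∀ j, j ≠ α → H.topLeft j = F.topLeft j := fun j hj => by rw [htl, if_neg hj]
  have hpos : H.LenPos := by
    intro j
    by_cases hj : j = β
    · rw [hj, lenβ]; linarith
    · rw [len_ne j hj]; exact hF j
  have hsub : ∀ j, j ≠ α → H.interval j ⊆ F.interval j := by
    intro j hj
    refine Ico_subset_Ico (htl_ne j hj).ge ?_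
    rw [htl_ne j hj]
    by_cases hj : j = β
    · rw [hj, lenβ]; linarith [hF α]
    · rw [len_ne j hj]
  have hsubα : H.interval α ⊆ F.interval β := by
    refine Ico_subset_Ico ?_ ?_
    · rw [htlα]; linarith
    · rw [htlα, len_ne α hne]; linarith
  have hαmap : ∀ x ∈ F.interval β, F.map x = x + (F.total - F.len β - F.topLeft β) := by
    intro x hx
    rw [hF.map_eq hx, botLeft_lastBot]
  -- the end of the winner is mapped onto the loser, which is not in the new domain
  have hαα : ∀ x ∈ H.interval α, F.map x ∈ F.interval α := by
    intro x hx
    rw [hαmap x (hsubα hx)]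
    have h1 := topLeft_lastTop (F := F)
    rw [← hα] at h1
    have hx1 := hx.1
    have hx2 := hx.2
    rw [htlα] at hx1 hx2
    rw [len_ne α hne] at hx2
    exact ⟨by linarith, by linarith⟩
  refine ⟨hpos, by rw [htot]; linarith [hF α], ?_, ?_, ?_, ?_, ?_, ?_, ?_⟩
  · intro j; split_ifs <;> norm_num
  · rw [htot]; linarith [hF α]
  · intro j t ht
    by_cases hj : j = α
    · subst hj
      rcases Nat.eq_zero_or_pos t with rfl | ht0
      · exact ⟨β, fun x hx => hsubα hx⟩
      · obtain rfl : t = 1 := by simp at ht; omega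
        exact ⟨_, fun x hx => hαα x hx⟩
    · obtain rfl : t = 0 := by simp [hj] at ht; omega
      exact ⟨j, fun x hx => hsub j hj hx⟩
  · intro j x hx
    rw [hpos.map_eq hx, hbl]
    by_cases hj : j = α
    · subst hj
      simp only [if_true]
      rw [Function.iterate_succ_apply, Function.iterate_one, hF.map_eq (hαα x hx),
        hαmap x (hsubα hx), topLeft_lastTop, htlα]
      ring
    · simp only [hj, if_false]
      rw [htl_ne j hj]
      exact hF.map_eq (hsub j hj hx)
  · intro j t ht ht0 x hx
    by_cases hj : j = α
    · subst hj
      obtain rfl : t = 1 := by simp at ht; omega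
      rw [Function.iterate_one, htot, ← topLeft_lastTop]
      exact (hαα x hx).1
    · simp [hj] at ht; omega
  · intro y hy
    obtain ⟨j, hj⟩ := hF.exists_mem_interval hy
    by_cases hjα : j = α
    · subst hjα
      have h1 := topLeft_lastTop (F := F)
      have hx : y - (F.total - F.len β - F.topLeft β) ∈ H.interval F.lastTop := by
        refine ⟨?_, ?_⟩
        · rw [htlα]
          have := hj.1
          linarith
        · rw [htlα, len_ne _ hne]
          linarith [hy.2]
      refine ⟨F.lastTop, 1, by rw [if_pos hα.symm]; norm_num, _, hx, ?_⟩
      rw [Function.iterate_one, hαmap _ (hsubα hx)]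
      ring
    · by_cases hjβ : j = β
      · subst hjβ
        by_cases hyt : y < F.topLeft F.lastBot + (F.len F.lastBot - F.len α)
        · refine ⟨_, 0, by simp [hjα], y, ⟨(htl_ne _ hjα).le.trans hj.1, ?_⟩, rfl⟩
          rw [htl_ne _ hjα, lenβ]
          exact hyt
        · refine ⟨α, 0, by simp, y, ⟨?_, ?_⟩, rfl⟩
          · rw [htlα]; exact not_lt.1 hyt
          · rw [htlα, len_ne α hne]
            linarith [hj.2]
      · refine ⟨j, 0, by simp [hjα], y, ⟨(htl_ne j hjα).le.trans hj.1, ?_⟩, rfl⟩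
        rw [htl_ne j hjα, len_ne j hjβ]
        exact hj.2
  · intro j
    by_cases hj : j = α
    · subst hj
      refine Or.inr ⟨1, by simp, ?_⟩
      have hm := hpos.topLeft_mem F.lastTop
      have e : F.map (H.topLeft F.lastTop) = F.topLeft F.lastTop := by
        rw [hαmap _ (hsubα hm), htlα, topLeft_lastTop]
        ring
      rw [Function.iterate_one, e]
      refine mem_markedPoints (ne_of_gt ?_)
      have : Nontrivial (Fin d) := Fin.nontrivial_iff_two_le.2 hd
      obtain ⟨i, hi⟩ := exists_ne F.lastTop
      have h2 := hF.topLeft_add_le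
        (lt_of_le_of_ne (le_lastTop i) fun e => hi (F.top.injective e))
      linarith [hF i, hF.topLeft_nonneg i]
    · rw [htl_ne j hj]
      by_cases h0 : F.topLeft j = 0
      · exact Or.inl h0
      · exact Or.inr ⟨0, by simp [hj], mem_markedPoints h0⟩

/-- The induced exchange of Rauzy–Veech induction is the first return map. -/
lemma Keane.tower_induced (hd : 2 ≤ d) (hF : F.LenPos) (hK : F.Keane) (n : ℕ) :
    (F.induced n).LenPos ∧ (0 < n → (F.induced n).total < F.total) ∧
      ∃ h, Tower F (F.induced n) h := by
  induction n with
  | zero => exact ⟨hF, by simp, _, Tower.refl hF⟩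
  | succ n ih =>
    obtain ⟨hpos, -, h, hT⟩ := ih
    have e : F.induced (n + 1) = (F.induced n).rauzy := Function.iterate_succ_apply' _ _ _
    obtain ⟨hne, hlen⟩ := (hT.keane hF hpos hK).last_ne hd hpos
    obtain ⟨hpos', hlt, h', hT'⟩ : (F.induced n).rauzy.LenPos ∧
        (F.induced n).rauzy.total < (F.induced n).total ∧
          ∃ h', Tower (F.induced n) (F.induced n).rauzy h' := by
      rcases lt_or_gt_of_ne hlen with hlt | hlt
      · obtain ⟨a, b, c⟩ := Tower.of_len_lastTop_lt hd hpos hne hlt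
        exact ⟨a, b, _, c⟩
      · obtain ⟨a, b, c⟩ := Tower.of_len_lastBot_lt hpos hne hlt
        exact ⟨a, b, _, c⟩
    obtain ⟨h'', hT'', -⟩ := hT.trans hT' hpos hpos'
    rw [e]
    exact ⟨hpos', fun _ => hlt.trans_le hT.total_le, h'', hT''⟩

end RauzyStep

end IntervalExchange

namespace IntervalExchange

/-! ### Self-similar exchanges -/

section Scale

variable {d : ℕ} {F H : IntervalExchange d}

/-- The exchange with all lengths multiplied by `c`. -/
def scale (c : ℝ) (F : IntervalExchange d) : IntervalExchange d :=
  ⟨F.top, F.bot, fun i => c * F.len i⟩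

lemma LenPos.scale (hF : F.LenPos) {c : ℝ} (hc : 0 < c) : (F.scale c).LenPos :=
  fun i => mul_pos hc (hF i)

lemma total_scale (c : ℝ) : (F.scale c).total = c * F.total := by
  simp [total, scale, Finset.mul_sum]

lemma topLeft_scale (c : ℝ) (j : Fin d) : (F.scale c).topLeft j = c * F.topLeft j := by
  unfold topLeft
  rw [Finset.mul_sum]
  exact Finset.sum_congr rfl fun i _ => by rw [mul_ite, mul_zero]; rfl

lemma botLeft_scale (c : ℝ) (j : Fin d) : (F.scale c).botLeft j = c * F.botLeft j := by
  unfold botLeft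
  rw [Finset.mul_sum]
  exact Finset.sum_congr rfl fun i _ => by rw [mul_ite, mul_zero]; rfl

lemma scale_scale (c c' : ℝ) : (F.scale c').scale c = F.scale (c * c') := by
  simp [scale, mul_assoc]

lemma scale_one : F.scale 1 = F := by
  simp [scale]

lemma mul_mem_interval_scale {c : ℝ} (hc : 0 < c) {x : ℝ} {j : Fin d} :
    c * x ∈ (F.scale c).interval j ↔ x ∈ F.interval j := by
  unfold interval
  rw [topLeft_scale]
  change _ ∧ c * x < c * F.topLeft j + c * F.len j ↔ _
  rw [← mul_add, mul_le_mul_iff_right₀ hc, mul_lt_mul_iff_right₀ hc]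
  rfl

lemma mem_interval_scale {c : ℝ} (hc : 0 < c) {y : ℝ} {j : Fin d} :
    y ∈ (F.scale c).interval j ↔ ∃ x ∈ F.interval j, c * x = y := by
  constructor
  · intro hy
    refine ⟨y / c, ?_, mul_div_cancel₀ _ hc.ne'⟩
    rw [← mul_mem_interval_scale hc, mul_div_cancel₀ _ hc.ne']
    exact hy
  · rintro ⟨x, hx, rfl⟩
    exact (mul_mem_interval_scale hc).2 hx

lemma map_scale {c : ℝ} (hc : 0 < c) (x : ℝ) : (F.scale c).map (c * x) = c * F.map x := by
  unfold map
  rw [mul_add, Finset.mul_sum]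
  congr 1
  refine Finset.sum_congr rfl fun j _ => ?_
  rw [topLeft_scale, botLeft_scale]
  by_cases hx : x ∈ F.interval j
  · rw [indicator_of_mem hx, indicator_of_mem ((mul_mem_interval_scale hc).2 hx), mul_sub]
  · rw [indicator_of_notMem hx, indicator_of_notMem (mt (mul_mem_interval_scale hc).1 hx),
      mul_zero]

lemma iterate_map_scale {c : ℝ} (hc : 0 < c) (x : ℝ) (n : ℕ) :
    (F.scale c).map^[n] (c * x) = c * F.map^[n] x := by
  induction n with
  | zero => rfl
  | succ n ih =>
    rw [Function.iterate_succ_apply', Function.iterate_succ_apply', ih, map_scale hc]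

lemma cocycle_scale {m : ℕ} (φ : Fin d → Fin m → ℤ) {c : ℝ} (hc : 0 < c) (x : ℝ) :
    (F.scale c).cocycle φ (c * x) = F.cocycle φ x := by
  unfold cocycle
  refine Finset.sum_congr rfl fun j _ => ?_
  by_cases hx : x ∈ F.interval j
  · rw [indicator_of_mem hx, indicator_of_mem ((mul_mem_interval_scale hc).2 hx)]
  · rw [indicator_of_notMem hx, indicator_of_notMem (mt (mul_mem_interval_scale hc).1 hx)]

lemma birkhoffSum_scale {m : ℕ} (φ : Fin d → Fin m → ℤ) {c : ℝ} (hc : 0 < c) (x : ℝ) (n : ℕ) :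
    birkhoffSum (F.scale c).map ((F.scale c).cocycle φ) n (c * x) =
      birkhoffSum F.map (F.cocycle φ) n x :=
  Finset.sum_congr rfl fun k _ => by rw [iterate_map_scale hc, cocycle_scale φ hc]

lemma markedPoints_scale {c : ℝ} (hc : 0 < c) {x : ℝ} (hx : x ∈ F.markedPoints) :
    c * x ∈ (F.scale c).markedPoints := by
  obtain ⟨⟨i, rfl⟩, h0⟩ := hx
  rw [← topLeft_scale]
  refine mem_markedPoints ?_
  rw [topLeft_scale]
  exact mul_ne_zero hc.ne' h0

lemma Tower.scale {h : Fin d → ℕ} (hT : Tower F H h) {c : ℝ} (hc : 0 < c) :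
    Tower (F.scale c) (H.scale c) h where
  pos := hT.pos
  total_le := by
    rw [total_scale, total_scale]
    exact mul_le_mul_of_nonneg_left hT.total_le hc.le
  mem j t ht := by
    obtain ⟨i, hi⟩ := hT.mem j t ht
    refine ⟨i, fun y hy => ?_⟩
    obtain ⟨x, hx, rfl⟩ := (mem_interval_scale hc).1 hy
    rw [iterate_map_scale hc]
    exact (mul_mem_interval_scale hc).2 (hi x hx)
  ret j y hy := by
    obtain ⟨x, hx, rfl⟩ := (mem_interval_scale hc).1 hy
    rw [iterate_map_scale hc, map_scale hc, hT.ret j x hx]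
  le_of_lt j t ht ht0 y hy := by
    obtain ⟨x, hx, rfl⟩ := (mem_interval_scale hc).1 hy
    rw [iterate_map_scale hc, total_scale]
    exact mul_le_mul_of_nonneg_left (hT.le_of_lt j t ht ht0 x hx) hc.le
  cover y hy := by
    rw [total_scale] at hy
    obtain ⟨j, t, ht, x, hx, e⟩ := hT.cover (y / c)
      ⟨div_nonneg hy.1 hc.le, (div_lt_iff₀' hc).2 hy.2⟩
    refine ⟨j, t, ht, c * x, (mul_mem_interval_scale hc).2 hx, ?_⟩
    rw [iterate_map_scale hc, e, mul_div_cancel₀ _ hc.ne']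
  endpoint j := by
    rw [topLeft_scale]
    rcases hT.endpoint j with h0 | ⟨t, ht, hm⟩
    · exact Or.inl (by rw [h0, mul_zero])
    · refine Or.inr ⟨t, ht, ?_⟩
      rw [iterate_map_scale hc]
      exact markedPoints_scale hc hm

lemma LenPos.interval_eq_iff (hF : F.LenPos) {i j : Fin d} :
    F.interval i = H.interval j ↔ F.topLeft i = H.topLeft j ∧ F.len i = H.len j := by
  unfold interval
  rw [Ico_eq_Ico_iff (Or.inl (lt_add_of_pos_right _ (hF i)))]
  constructor
  · rintro ⟨h1, h2⟩
    exact ⟨h1, by linarith⟩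
  · rintro ⟨h1, h2⟩
    exact ⟨h1, by linarith⟩

/-- Towers depend on the base exchange only through its intervals, up to a relabelling, and the
map. -/
lemma Tower.relabel {h : Fin d → ℕ} {H' : IntervalExchange d} (hT : Tower F H h)
    (hH : H.LenPos) (hH' : H'.LenPos) (π : Equiv.Perm (Fin d)) (htot : H'.total = H.total)
    (hint : ∀ j, H.interval j = H'.interval (π j)) (hmap : EqOn H.map H'.map (Ico 0 H.total)) :
    Tower F H' (h ∘ π.symm) := by
  have hint' : ∀ j, H'.interval j = H.interval (π.symm j) := fun j => by
    rw [hint, Equiv.apply_symm_apply]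
  refine ⟨fun j => hT.pos _, htot.trans_le hT.total_le, ?_, ?_, ?_, ?_, ?_⟩
  · intro j t ht
    rw [hint']
    exact hT.mem _ t ht
  · intro j x hx
    rw [hint'] at hx
    exact (hT.ret _ x hx).trans (hmap (hH.interval_subset _ hx))
  · intro j t ht ht0 x hx
    rw [htot]
    rw [hint'] at hx
    exact hT.le_of_lt _ t ht ht0 x hx
  · intro y hy
    obtain ⟨j, t, ht, x, hx, e⟩ := hT.cover y hy
    refine ⟨π j, t, ?_, x, hint j ▸ hx, e⟩
    rwa [Function.comp_apply, Equiv.symm_apply_apply]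
  · intro j
    rw [(hH'.interval_eq_iff.1 (hint' j)).1]
    exact hT.endpoint _

lemma LenPos.mem_interval_iff (hF : F.LenPos) {y : ℝ} (hy : y ∈ Ico 0 F.total) {j : Fin d} :
    y ∈ F.interval j ↔ F.topLeft j ≤ y ∧ ∀ k, F.topLeft j < F.topLeft k → y < F.topLeft k := by
  constructor
  · intro hj
    refine ⟨hj.1, fun k hk => ?_⟩
    by_contra hky
    have : F.topLeft k ∈ F.interval j := ⟨hk.le, (not_lt.1 hky).trans_lt hj.2⟩
    have e := hF.index_unique this (hF.topLeft_mem k)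
    rw [e] at hk
    exact lt_irrefl _ hk
  · rintro ⟨h1, h2⟩
    obtain ⟨k, hk⟩ := hF.exists_mem_interval hy
    have hjk : F.topLeft k ≤ F.topLeft j := by
      by_contra hlt
      exact absurd hk.1 (not_le.2 (h2 k (not_le.1 hlt)))
    rwa [hF.index_unique (hF.topLeft_mem j) ⟨hjk, h1.trans_lt hk.2⟩]

end Scale

section SelfSimilar

variable {d m : ℕ} {F : IntervalExchange d} {φ : Fin d → Fin m → ℤ} {c : ℝ} {h : Fin d → ℕ}

/-- The skew product with values `φ` is self-similar with ratio `c`: towers of heights `h` over the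
exchange scaled by `c` fill the domain of `F`, and the cocycle sums up to `φ j` over the `j`-th
tower. -/
structure SelfSimilar (F : IntervalExchange d) (φ : Fin d → Fin m → ℤ) (c : ℝ) (h : Fin d → ℕ) :
    Prop where
  pos : 0 < c
  tower : Tower F (F.scale c) h
  sum : ∀ j, ∀ x ∈ (F.scale c).interval j, birkhoffSum F.map (F.cocycle φ) (h j) x = φ j

lemma SelfSimilar.mul {c' : ℝ} {h' : Fin d → ℕ} (hF : F.LenPos) (hs : SelfSimilar F φ c h)
    (hs' : SelfSimilar F φ c' h') : ∃ h'', SelfSimilar F φ (c * c') h'' := by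
  have hT' := hs'.tower.scale hs.pos
  rw [scale_scale] at hT'
  have hc := mul_pos hs.pos hs'.pos
  obtain ⟨h'', hT, hsum⟩ := hs.tower.trans hT' (hF.scale hs.pos) (hF.scale hc)
  refine ⟨h'', hc, hT, hsum φ φ φ hs.sum fun j y hy => ?_⟩
  rw [← scale_scale, mem_interval_scale hs.pos] at hy
  obtain ⟨x, hx, rfl⟩ := hy
  rw [birkhoffSum_scale φ hs.pos]
  exact hs'.sum j x hx

lemma SelfSimilar.pow (hF : F.LenPos) (hs : SelfSimilar F φ c h) (n : ℕ) :
    ∃ h', SelfSimilar F φ (c ^ n) h' := by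
  induction n with
  | zero =>
    refine ⟨fun _ => 1, by simp, ?_, ?_⟩
    · rw [pow_zero, scale_one]
      exact Tower.refl hF
    · intro j x hx
      rw [pow_zero, scale_one] at hx
      rw [birkhoffSum_one, hF.cocycle_eq φ hx]
  | succ n ih =>
    obtain ⟨h', hs'⟩ := ih
    rw [pow_succ]
    exact hs'.mul hF hs

lemma iterate_skew (x : ℝ) (a : Fin m → ℤ) (n : ℕ) :
    (F.skew φ)^[n] (x, a) = (F.map^[n] x, a + birkhoffSum F.map (F.cocycle φ) n x) := by
  induction n with
  | zero => simp
  | succ n ih =>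
    rw [Function.iterate_succ_apply', ih, birkhoffSum_succ, Function.iterate_succ_apply', skew,
      add_assoc]

/-- A skew product of periodic type is self-similar in the above sense: the equality of the marked
points identifies the intervals of the induced exchange with those of the scaled one, and the first
return map of the skew product determines the map and the sums of the cocycle. -/
lemma PeriodicType.selfSimilar [NeZero d] (hd : 2 ≤ d) (hF : F.IsUnitExchange) (hK : F.Keane)
    (hp : F.PeriodicType φ) : ∃ c h, c < 1 ∧ SelfSimilar F φ c h := by
  obtain ⟨N, hN, hmark, hskew⟩ := hp
  obtain ⟨hH, hlt, h, hT⟩ := hK.tower_induced hd hF.lenPos N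
  set H := F.induced N with hHdef
  set c := H.total with hc
  have hc0 : 0 < c := hH.total_pos
  have hc1 : c < 1 := by
    have := hlt hN
    rwa [hF.total_eq_one] at this
  have hFp := hF.lenPos
  have hS := hFp.scale hc0
  have hStot : (F.scale c).total = c := by rw [total_scale, hF.total_eq_one, mul_one]
  -- the left endpoints agree after rescaling
  have hex : ∀ j, ∃ k, H.topLeft j = c * F.topLeft k := by
    intro j
    by_cases h0 : H.topLeft j = 0
    · obtain ⟨k, hk⟩ := hFp.exists_topLeft_eq_zero
      exact ⟨k, by rw [h0, hk, mul_zero]⟩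
    · have : H.topLeft j / c ∈ F.markedPoints := by
        rw [← hmark]
        exact ⟨_, mem_markedPoints h0, rfl⟩
      obtain ⟨⟨k, hk⟩, -⟩ := this
      exact ⟨k, by rw [hk, mul_div_cancel₀ _ hc0.ne']⟩
  choose π hπ using hex
  have hπi : Function.Injective π := fun i j e => hH.topLeft_injective (by rw [hπ, hπ, e])
  let σ : Equiv.Perm (Fin d) := Equiv.ofBijective π (Finite.injective_iff_bijective.1 hπi)
  have hσ : ∀ j, H.topLeft j = (F.scale c).topLeft (σ j) := fun j => by
    rw [topLeft_scale]
    exact hπ j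
  have hint : ∀ j, H.interval j = (F.scale c).interval (σ j) := by
    intro j
    ext y
    by_cases hy : y ∈ Ico 0 c
    · rw [hH.mem_interval_iff hy, hS.mem_interval_iff (hStot.symm ▸ hy), hσ j]
      simp only [hσ]
      exact and_congr_right' (σ.forall_congr_right
        (q := fun k => (F.scale c).topLeft (σ j) < (F.scale c).topLeft k →
          y < (F.scale c).topLeft k))
    · exact ⟨fun h => absurd (hH.interval_subset j h) hy,
        fun h => absurd (hStot ▸ hS.interval_subset _ h) hy⟩
  -- the first return of the skew product
  have hret : ∀ j, ∀ x, c * x ∈ H.interval j → H.map (c * x) = c * F.map x ∧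
      birkhoffSum F.map (F.cocycle φ) (h j) (c * x) = F.cocycle φ x := by
    intro j x hx
    have hx' := hH.interval_subset j hx
    have hinf : sInf {k : ℕ | 1 ≤ k ∧ (F.skew φ)^[k] (c * x, 0) ∈ F.domain N ×ˢ univ} = h j := by
      refine le_antisymm (Nat.sInf_le ⟨hT.pos j, ?_⟩) (le_csInf ⟨h j, hT.pos j, ?_⟩ ?_)
      · rw [iterate_skew, hT.ret j _ hx]
        exact ⟨hH.map_mem hx', mem_univ _⟩
      · rw [iterate_skew, hT.ret j _ hx]
        exact ⟨hH.map_mem hx', mem_univ _⟩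
      · rintro k ⟨hk1, hk2⟩
        by_contra hlt
        rw [iterate_skew] at hk2
        exact absurd hk2.1.2 (not_lt.2 (hT.le_of_lt j k (not_le.1 hlt) hk1 _ hx))
    have hx01 : x ∈ Ico (0 : ℝ) 1 :=
      ⟨nonneg_of_mul_nonneg_right hx'.1 hc0, by
        have := hx'.2
        rw [← hc] at this
        nlinarith⟩
    have e := hskew (x := (x, 0)) ⟨hx01, mem_univ _⟩
    unfold renormSkew firstReturn at e
    simp only [← hHdef, ← hc] at e
    rw [hinf, iterate_skew, hT.ret j _ hx] at e
    simp only [skew, Prod.mk.injEq, zero_add] at e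
    exact ⟨by rw [← e.1, mul_div_cancel₀ _ hc0.ne'], e.2⟩
  have hmap : EqOn H.map (F.scale c).map (Ico 0 H.total) := by
    intro y hy
    obtain ⟨j, hj⟩ := hH.exists_mem_interval hy
    have hyc : c * (y / c) = y := mul_div_cancel₀ _ hc0.ne'
    rw [← hyc] at hj ⊢
    rw [(hret j _ hj).1, map_scale hc0]
  refine ⟨c, h ∘ σ.symm, hc1, hc0, hT.relabel hH hS σ hStot hint hmap, fun j y hy => ?_⟩
  obtain ⟨x, hx, rfl⟩ := (mem_interval_scale hc0).1 hy
  rw [Function.comp_apply, (hret (σ.symm j) x (by rwa [hint, Equiv.apply_symm_apply])).2,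
    hFp.cocycle_eq φ hx]

/-- Replacing the period by a multiple, every tower visits every interval: a power of `c` is so
small that the scaled exchange lives in the first interval of an induced exchange with positive
Rauzy–Veech cocycle, and its towers begin with the tower over that interval. -/
lemma SelfSimilar.exists_visits [NeZero d] (hd : 2 ≤ d) (hF : F.IsUnitExchange) (hK : F.Keane)
    (hcomplete : F.InfinitelyComplete) (hs : SelfSimilar F φ c h) (hc : c < 1) :
    ∃ c' h', c' < 1 ∧ SelfSimilar F φ c' h' ∧
      ∀ i j, ∃ t < h' j, ∀ x ∈ (F.scale c').interval j, F.map^[t] x ∈ F.interval i := by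
  have hFp := hF.lenPos
  obtain ⟨n, hn⟩ : ∃ n, ∀ i j, 0 < F.rauzyVeechCocycle n i j :=
    (eventually_all.2 fun i => eventually_all.2 fun j =>
      (hcomplete i j).eventually_gt_atTop 0).exists
  obtain ⟨hH, -, g, hT⟩ := hK.tower_induced hd hFp n
  obtain ⟨j0, hj0⟩ := hH.exists_topLeft_eq_zero
  obtain ⟨k, hk⟩ := exists_pow_lt_of_lt_one (hH j0) hc
  have hk' : c ^ (k + 1) < (F.induced n).len j0 :=
    (pow_le_pow_of_le_one hs.pos.le hc.le (by omega)).trans_lt hk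
  obtain ⟨h', hs'⟩ := hs.pow hFp (k + 1)
  refine ⟨c ^ (k + 1), h', pow_lt_one₀ hs.pos.le hc (by omega), hs', fun i j => ?_⟩
  have hS := hFp.scale hs'.pos
  have hStot : (F.scale (c ^ (k + 1))).total = c ^ (k + 1) := by
    rw [total_scale, hF.total_eq_one, mul_one]
  have hsub : ∀ x ∈ Ico 0 (F.scale (c ^ (k + 1))).total, x ∈ (F.induced n).interval j0 := by
    intro x hx
    rw [hStot] at hx
    refine ⟨hj0.trans_le hx.1, ?_⟩
    rw [hj0, zero_add]
    exact hx.2.trans hk'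
  obtain ⟨t, ht, hti⟩ : {t : ℕ | t < F.returnTime n j0 ∧
      F.map^[t] '' (F.induced n).interval j0 ⊆ F.interval i}.Nonempty := by
    by_contra hne
    have := hn i j0
    unfold rauzyVeechCocycle at this
    rw [not_nonempty_iff_eq_empty.1 hne] at this
    simp at this
  have ht' : t < g j0 := by
    refine ht.trans_le (Nat.sInf_le ⟨hT.pos j0, ?_⟩)
    rintro _ ⟨x, hx, rfl⟩
    rw [hT.ret j0 x hx]
    exact hH.map_mem (hH.interval_subset j0 hx)
  have hg : g j0 ≤ h' j := by
    by_contra hlt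
    have hm := hS.topLeft_mem j
    have hx := hS.interval_subset j hm
    have h1 := hT.le_of_lt j0 (h' j) (not_le.1 hlt) (hs'.tower.pos j) _ (hsub _ hx)
    rw [hs'.tower.ret j _ hm] at h1
    have h2 := hsub _ (hS.map_mem hx)
    exact absurd (hH.interval_subset j0 h2).2 (not_lt.2 h1)
  exact ⟨t, ht'.trans_le hg, fun x hx =>
    hti (mem_image_of_mem _ (hsub x (hS.interval_subset j hx)))⟩

end SelfSimilar

end IntervalExchange

namespace IntervalExchange

/-! ### The orbits of the singularities -/

section SplitPoints

variable {d : ℕ} {F H : IntervalExchange d} {h : Fin d → ℕ}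

/-- The set `D` of the points that are split in `K`. -/
def splitPoints (F : IntervalExchange d) : Set ℝ := ⋃ n, F.forwardPoints n ∪ F.backwardPoints n

/-- There are towers over arbitrarily short exchanges. -/
def HasSmallTowers (F : IntervalExchange d) : Prop :=
  ∀ δ > 0, ∃ (H : IntervalExchange d) (h : Fin d → ℕ), H.LenPos ∧ H.total < δ ∧ Tower F H h

lemma LenPos.exists_topLeft_eq_len (hF : F.LenPos) {i : Fin d} (hi : F.topLeft i = 0)
    (hlt : F.len i < F.total) : ∃ k, F.topLeft k = F.len i := by
  obtain ⟨k, hk⟩ := hF.exists_mem_interval ⟨(hF i).le, hlt⟩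
  refine ⟨k, le_antisymm hk.1 ?_⟩
  rcases lt_trichotomy (F.top k) (F.top i) with hlt | heq | hlt
  · have := hF.topLeft_add_le hlt
    linarith [hF k, hF.topLeft_nonneg k]
  · rw [F.top.injective heq] at hk
    have := hk.2
    rw [hi, zero_add] at this
    exact absurd this (lt_irrefl _)
  · have := hF.topLeft_add_le hlt
    rwa [hi, zero_add] at this

lemma LenPos.map_topLeft (hF : F.LenPos) (i : Fin d) : F.map (F.topLeft i) = F.botLeft i := by
  rw [hF.map_eq (hF.topLeft_mem i)]
  ring

lemma Keane.map_zero_ne (hd : 2 ≤ d) (hF : F.LenPos) (hK : F.Keane) : F.map 0 ≠ 0 := by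
  have : NeZero d := ⟨by omega⟩
  intro h0
  obtain ⟨i, hi⟩ := hF.exists_topLeft_eq_zero
  have hb : F.botLeft i = 0 := by rw [← hF.map_topLeft, hi, h0]
  have hlt : F.len i < F.total := by
    have : Nontrivial (Fin d) := Fin.nontrivial_iff_two_le.2 hd
    obtain ⟨k, hk⟩ := exists_ne i
    exact Finset.single_lt_sum hk (Finset.mem_univ _) (Finset.mem_univ _) (hF k)
      fun j _ _ => (hF j).le
  obtain ⟨k, hk⟩ := hF.exists_topLeft_eq_len hi hlt
  obtain ⟨k', hk'⟩ := hF.inv.exists_topLeft_eq_len hb hlt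
  refine hK k' 1 le_rfl ?_
  rw [Function.iterate_one, hF.map_topLeft]
  change F.inv.topLeft k' ∈ _
  rw [hk']
  change F.len i ∈ _
  rw [← hk]
  exact mem_markedPoints (by rw [hk]; exact (hF i).ne')

lemma Keane.iterate_ne_zero (hd : 2 ≤ d) (hF : F.LenPos) (hK : F.Keane) {i : Fin d} {n : ℕ}
    (hn : F.map^[n + 1] (F.topLeft i) = 0) : n = 0 ∧ F.topLeft i ≠ 0 := by
  have : NeZero d := ⟨by omega⟩
  obtain ⟨k, hk⟩ := hF.inv.exists_topLeft_eq_zero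
  have hk0 : F.map (F.topLeft k) = 0 := (hF.map_topLeft k).trans hk
  have hne : F.topLeft k ≠ 0 := fun e => hK.map_zero_ne hd hF (by rw [← e, hk0, e])
  have hmem : ∀ i, F.topLeft i ∈ Ico 0 F.total :=
    fun i => hF.interval_subset i (hF.topLeft_mem i)
  rw [Function.iterate_succ_apply'] at hn
  have e := hF.map_inj (hF.iterate_mem (hmem i) n) (hmem k) (hn.trans hk0.symm)
  rcases Nat.eq_zero_or_pos n with rfl | hpos
  · exact ⟨rfl, by rw [show F.topLeft i = F.topLeft k from e]; exact hne⟩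
  · exact absurd (e ▸ mem_markedPoints hne) (hK i n hpos)

lemma IsUnitExchange.total_eq (hF : F.IsUnitExchange) : F.total = 1 := hF.total_eq_one

lemma LenPos.forwardPoints_subset (hF : F.LenPos) (n : ℕ) :
    F.forwardPoints n ⊆ Ico 0 F.total := by
  rintro _ ⟨_, ⟨⟨_, ⟨i, rfl⟩, rfl⟩, -⟩, rfl⟩
  exact hF.iterate_mem (hF.map_mem (hF.interval_subset i (hF.topLeft_mem i))) n

lemma markedPoints_subset (hF : F.IsUnitExchange) : F.markedPoints ⊆ F.splitPoints := by
  rintro x ⟨⟨i, rfl⟩, h0⟩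
  refine mem_iUnion.2 ⟨0, Or.inr ⟨?_, ⟨⟨i, rfl⟩, h0⟩⟩⟩
  rw [← hF.total_eq]
  exact hF.lenPos.interval_subset i (hF.lenPos.topLeft_mem i)

lemma Keane.splitPoints_subset (hd : 2 ≤ d) (hF : F.IsUnitExchange) (hK : F.Keane) :
    F.splitPoints ⊆ Ioo 0 1 := by
  have hFp := hF.lenPos
  have : NeZero d := ⟨by omega⟩
  intro x hx
  obtain ⟨n, hx | hx⟩ := mem_iUnion.1 hx
  · have hx' := hF.total_eq ▸ hFp.forwardPoints_subset n hx
    refine ⟨lt_of_le_of_ne hx'.1 fun h0 => ?_, hx'.2⟩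
    obtain ⟨_, ⟨⟨_, ⟨i, rfl⟩, rfl⟩, hne⟩, rfl⟩ := hx
    rw [← Function.iterate_succ_apply] at h0
    obtain ⟨rfl, -⟩ := hK.iterate_ne_zero hd hFp h0.symm
    exact hne h0.symm
  · refine ⟨lt_of_le_of_ne hx.1.1 fun h0 => ?_, hx.1.2⟩
    have hm := hx.2
    rw [← h0] at hm
    rcases Nat.eq_zero_or_pos n with rfl | hpos
    · exact hm.2 rfl
    · obtain ⟨i, hi⟩ := hFp.exists_topLeft_eq_zero
      exact hK i n hpos (hi ▸ hm)

/-- `D ∪ {0}` is forward invariant. -/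
lemma map_mem_splitPoints (hF : F.IsUnitExchange) [NeZero d] {x : ℝ}
    (hx : x = 0 ∨ x ∈ F.splitPoints) : F.map x = 0 ∨ F.map x ∈ F.splitPoints := by
  have hFp := hF.lenPos
  have htop : ∀ i, F.map (F.topLeft i) = 0 ∨ F.map (F.topLeft i) ∈ F.splitPoints := by
    intro i
    by_cases h0 : F.map (F.topLeft i) = 0
    · exact Or.inl h0
    · exact Or.inr (mem_iUnion.2 ⟨0, Or.inl ⟨_, ⟨⟨_, ⟨i, rfl⟩, rfl⟩, h0⟩, rfl⟩⟩)
  rcases hx with rfl | hx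
  · obtain ⟨i, hi⟩ := hFp.exists_topLeft_eq_zero
    exact hi ▸ htop i
  · obtain ⟨n, hx | hx⟩ := mem_iUnion.1 hx
    · obtain ⟨y, hy, rfl⟩ := hx
      refine Or.inr (mem_iUnion.2 ⟨n + 1, Or.inl ⟨y, hy, ?_⟩⟩)
      rw [Function.iterate_succ_apply']
    · obtain ⟨hx, hm⟩ := hx
      rcases Nat.eq_zero_or_pos n with rfl | hpos
      · obtain ⟨⟨i, hi⟩, -⟩ := hm
        rw [Function.iterate_zero_apply] at hi
        exact hi ▸ htop i
      · obtain ⟨n, rfl⟩ := Nat.exists_eq_add_of_le' hpos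
        refine Or.inr (mem_iUnion.2 ⟨n, Or.inr ⟨?_, by rwa [Function.iterate_succ_apply] at hm⟩⟩)
        rw [← hF.total_eq] at hx ⊢
        exact hFp.map_mem hx

lemma iterate_mem_splitPoints (hF : F.IsUnitExchange) [NeZero d] {x : ℝ}
    (hx : x = 0 ∨ x ∈ F.splitPoints) (n : ℕ) :
    F.map^[n] x = 0 ∨ F.map^[n] x ∈ F.splitPoints := by
  induction n with
  | zero => exact hx
  | succ n ih =>
    rw [Function.iterate_succ_apply']
    exact map_mem_splitPoints hF ih

/-- Points of `(0, 1)` outside `D` are not mapped into `D`. -/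
lemma map_notMem_splitPoints (hF : F.IsUnitExchange) {x : ℝ} (hx : x ∈ Ioo (0 : ℝ) 1)
    (hxD : x ∉ F.splitPoints) : F.map x ∉ F.splitPoints := by
  have hFp := hF.lenPos
  have hx' : x ∈ Ico 0 F.total := by rw [hF.total_eq]; exact ⟨hx.1.le, hx.2⟩
  have hmem : ∀ i, F.topLeft i ∈ Ico 0 F.total :=
    fun i => hFp.interval_subset i (hFp.topLeft_mem i)
  intro hm
  obtain ⟨n, hm | hm⟩ := mem_iUnion.1 hm
  · obtain ⟨y, hy, e⟩ := hm
    obtain ⟨⟨_, ⟨i, rfl⟩, rfl⟩, h0⟩ := id hy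
    rcases Nat.eq_zero_or_pos n with rfl | hpos
    · have := hFp.map_inj (hmem i) hx' e
      exact hxD (markedPoints_subset hF ⟨⟨i, this⟩, hx.1.ne'⟩)
    · obtain ⟨n, rfl⟩ := Nat.exists_eq_add_of_le' hpos
      rw [Function.iterate_succ_apply'] at e
      have := hFp.map_inj (hFp.iterate_mem (hFp.map_mem (hmem i)) n) hx' e
      exact hxD (mem_iUnion.2 ⟨n, Or.inl ⟨_, hy, this⟩⟩)
  · refine hxD (mem_iUnion.2 ⟨n + 1, Or.inr ⟨⟨hx.1.le, hx.2⟩, ?_⟩⟩)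
    rw [Function.iterate_succ_apply]
    exact hm.2

/-- The floors of the towers begin at points of `D ∪ {0}`. -/
lemma Tower.floor_left_mem (hT : Tower F H h) (hF : F.IsUnitExchange) [NeZero d] (hH : H.LenPos)
    (j : Fin d) (s : ℕ) :
    F.map^[s] (H.topLeft j) = 0 ∨ F.map^[s] (H.topLeft j) ∈ F.splitPoints := by
  refine iterate_mem_splitPoints hF ?_ s
  rcases hT.endpoint j with h0 | ⟨t, -, ht⟩
  · exact Or.inl h0
  · refine Or.inr (mem_iUnion.2 ⟨t, Or.inr ⟨?_, ht⟩⟩)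
    have := hH.interval_subset j (hH.topLeft_mem j)
    rw [← hF.total_eq]
    exact ⟨this.1, this.2.trans_le hT.total_le⟩

/-- Iterates act on the base of a tower by translations, up to the return to the base. -/
lemma Tower.iterate_eq (hT : Tower F H h) (hF : F.LenPos) (hH : H.LenPos) {j : Fin d} {s : ℕ}
    (hs : s ≤ h j) {x : ℝ} (hx : x ∈ H.interval j) :
    F.map^[s] x = F.map^[s] (H.topLeft j) + (x - H.topLeft j) := by
  induction s with
  | zero => simp
  | succ s ih =>
    obtain ⟨i, hi⟩ := hT.mem j s (by omega)
    rw [Function.iterate_succ_apply', Function.iterate_succ_apply', hF.map_eq (hi x hx),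
      hF.map_eq (hi _ (hH.topLeft_mem j)), ih (by omega)]
    ring

lemma Tower.image_floor (hT : Tower F H h) (hF : F.LenPos) (hH : H.LenPos) {j : Fin d} {s : ℕ}
    (hs : s ≤ h j) {y : ℝ} :
    y ∈ Ico (F.map^[s] (H.topLeft j)) (F.map^[s] (H.topLeft j) + H.len j) ↔
      ∃ x ∈ H.interval j, F.map^[s] x = y := by
  constructor
  · intro hy
    have hx : y - F.map^[s] (H.topLeft j) + H.topLeft j ∈ H.interval j :=
      ⟨by linarith [hy.1], by linarith [hy.2]⟩
    refine ⟨_, hx, ?_⟩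
    rw [hT.iterate_eq hF hH hs hx]
    ring
  · rintro ⟨x, hx, rfl⟩
    rw [hT.iterate_eq hF hH hs hx]
    exact ⟨by linarith [hx.1], by linarith [hx.2]⟩

/-- A floor inside an interval of `F` is inside it with its right endpoint, although floors are
half-open. -/
lemma Tower.floor_subset (hT : Tower F H h) (hF : F.LenPos) (hH : H.LenPos) {j i : Fin d} {s : ℕ}
    (hs : s < h j) (hi : ∀ x ∈ H.interval j, F.map^[s] x ∈ F.interval i) :
    F.topLeft i ≤ F.map^[s] (H.topLeft j) ∧
      F.map^[s] (H.topLeft j) + H.len j ≤ F.topLeft i + F.len i := by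
  refine ⟨(hi _ (hH.topLeft_mem j)).1, ?_⟩
  by_contra hlt
  have hlt := not_le.1 hlt
  set y := max (F.topLeft i + F.len i) (F.map^[s] (H.topLeft j)) with hy
  obtain ⟨x, hx, e⟩ := (hT.image_floor hF hH hs.le).1
    (show y ∈ Ico (F.map^[s] (H.topLeft j)) (F.map^[s] (H.topLeft j) + H.len j) from
      ⟨le_max_right _ _, max_lt hlt (lt_add_of_pos_right _ (hH j))⟩)
  have := (hi x hx).2
  rw [e] at this
  exact absurd this (not_lt.2 (le_max_left _ _))

/-- A point of `D` is not in the interior of a floor of a tower over a short enough exchange: its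
orbit reaches, or comes from, a discontinuity without passing near `0`. -/
lemma Keane.exists_forall_notMem_floor (hd : 2 ≤ d) (hF : F.IsUnitExchange) (hK : F.Keane) {z : ℝ}
    (hz : z ∈ F.splitPoints) : ∃ δ > 0, ∀ (H : IntervalExchange d) (h : Fin d → ℕ), H.LenPos →
      H.total < δ → Tower F H h → ∀ j, ∀ s ≤ h j,
      z ∉ Ioo (F.map^[s] (H.topLeft j)) (F.map^[s] (H.topLeft j) + H.len j) := by
  have : NeZero d := ⟨by omega⟩
  have hFp := hF.lenPos
  have hD := hK.splitPoints_subset hd hF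
  -- no marked point lies in the interior of a floor
  have hmarked : ∀ (H : IntervalExchange d) (h : Fin d → ℕ), H.LenPos → Tower F H h → ∀ j,
      ∀ s < h j, ∀ x ∈ Ioo (H.topLeft j) (H.topLeft j + H.len j),
        F.map^[s] x ∉ range F.topLeft := by
    rintro H h hH hT j s hs x hx ⟨k, hk⟩
    obtain ⟨i, hi⟩ := hT.mem j s hs
    have hxi := hi x ⟨hx.1.le, hx.2⟩
    rw [← hk] at hxi
    obtain rfl := hFp.index_unique hxi (hFp.topLeft_mem k)
    have h1 := (hi _ (hH.topLeft_mem j)).1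
    rw [hk, hT.iterate_eq hFp hH hs.le ⟨hx.1.le, hx.2⟩] at h1
    linarith [hx.1]
  have hfloor : ∀ (H : IntervalExchange d) (h : Fin d → ℕ), H.LenPos → Tower F H h → ∀ j,
      ∀ s ≤ h j, ∀ z ∈ Ioo (F.map^[s] (H.topLeft j)) (F.map^[s] (H.topLeft j) + H.len j),
        ∃ x ∈ Ioo (H.topLeft j) (H.topLeft j + H.len j), F.map^[s] x = z := by
    intro H h hH hT j s hs z hz
    obtain ⟨x, hx, rfl⟩ := (hT.image_floor hFp hH hs).1 ⟨hz.1.le, hz.2⟩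
    refine ⟨x, ⟨?_, hx.2⟩, rfl⟩
    have := hz.1
    rw [hT.iterate_eq hFp hH hs hx] at this
    linarith
  -- a positive lower bound for finitely many positive numbers
  have hmin : ∀ (g : ℕ → ℝ) (n : ℕ), (∀ k ≤ n, 0 < g k) → ∃ δ > 0, ∀ k ≤ n, δ ≤ g k := by
    intro g n
    induction n with
    | zero => exact fun hg => ⟨g 0, hg 0 le_rfl, fun k hk => by rw [Nat.le_zero.1 hk]⟩
    | succ n ih =>
      intro hg
      obtain ⟨δ, hδ, hle⟩ := ih fun k hk => hg k (by omega)
      refine ⟨min δ (g (n + 1)), lt_min hδ (hg _ le_rfl), fun k hk => ?_⟩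
      rcases Nat.lt_or_ge n k with h1 | h1
      · obtain rfl : k = n + 1 := by omega
        exact min_le_right _ _
      · exact (min_le_left _ _).trans (hle k h1)
  obtain ⟨n, hz | hz⟩ := mem_iUnion.1 hz
  · obtain ⟨y, hy, rfl⟩ := hz
    obtain ⟨⟨_, ⟨i, rfl⟩, rfl⟩, hy0⟩ := id hy
    have hyU : F.map (F.topLeft i) ∈ Ico 0 F.total :=
      hFp.map_mem (hFp.interval_subset i (hFp.topLeft_mem i))
    obtain ⟨δ, hδ, hle⟩ := hmin (fun k => F.map^[k] (F.map (F.topLeft i))) n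
      fun k _ => (hD (mem_iUnion.2 ⟨k, Or.inl ⟨_, hy, rfl⟩⟩)).1
    refine ⟨δ, hδ, fun H h hH hlt hT j s hs hm => ?_⟩
    obtain ⟨x, hx, e⟩ := hfloor H h hH hT j s hs _ hm
    have hxH := hH.interval_subset j (show x ∈ H.interval j from ⟨hx.1.le, hx.2⟩)
    have hxU : x ∈ Ico 0 F.total := ⟨hxH.1, hxH.2.trans_le hT.total_le⟩
    rcases Nat.lt_or_ge n s with hsn | hsn
    · obtain ⟨k, rfl⟩ := Nat.exists_eq_add_of_le hsn
      rw [show n + 1 + k = n + (k + 1) by ring, Function.iterate_add_apply] at e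
      have e1 := hFp.iterate_inj (hFp.iterate_mem hxU _) hyU e
      rw [Function.iterate_succ_apply'] at e1
      have e2 := hFp.map_inj (hFp.iterate_mem hxU _)
        (hFp.interval_subset i (hFp.topLeft_mem i)) e1
      exact hmarked H h hH hT j k (by omega) x hx ⟨i, e2.symm⟩
    · obtain ⟨k, rfl⟩ := Nat.exists_eq_add_of_le hsn
      rw [Function.iterate_add_apply] at e
      have e1 := hFp.iterate_inj hxU (hFp.iterate_mem hyU _) e
      have := hle k (by omega)
      rw [← e1] at this
      linarith [hxH.2]
  · obtain ⟨hz01, hm⟩ := hz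
    obtain ⟨δ, hδ, hle⟩ := hmin (fun k => F.map^[k] z) n fun k hk => by
      refine (hD (mem_iUnion.2 ⟨n - k, Or.inr ⟨?_, ?_⟩⟩)).1
      · rw [← hF.total_eq] at hz01 ⊢
        exact hFp.iterate_mem hz01 k
      · rwa [← Function.iterate_add_apply, Nat.sub_add_cancel hk]
    refine ⟨δ, hδ, fun H h hH hlt hT j s hs hzm => ?_⟩
    obtain ⟨x, hx, rfl⟩ := hfloor H h hH hT j s hs _ hzm
    have hxj : x ∈ H.interval j := ⟨hx.1.le, hx.2⟩
    have hkey : ∀ k ≤ n, k + s < h j := by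
      intro k hk
      by_contra hcon
      obtain ⟨e, he⟩ := Nat.exists_eq_add_of_le hs
      have h1 := hle e (by omega)
      rw [← Function.iterate_add_apply, add_comm e s, ← he, hT.ret j x hxj] at h1
      have h2 := hH.map_mem (hH.interval_subset j hxj)
      linarith [h2.2]
    rw [← Function.iterate_add_apply] at hm
    exact hmarked H h hH hT j _ (hkey n le_rfl) x hx hm.1

/-- `D` is dense. -/
lemma HasSmallTowers.exists_splitPoint (hF : F.IsUnitExchange) [NeZero d] (hT : F.HasSmallTowers)
    {x y : ℝ} (hx : 0 ≤ x) (hxy : x < y) (hy : y ≤ 1) : ∃ z ∈ F.splitPoints, x < z ∧ z < y := by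
  obtain ⟨H, h, hH, hlt, hT⟩ := hT ((y - x) / 2) (by linarith)
  have hFp := hF.lenPos
  obtain ⟨j, t, ht, u, hu, e⟩ := hT.cover ((x + y) / 2)
    (by rw [hF.total_eq]; exact ⟨by linarith, by linarith⟩)
  have hm := (hT.image_floor hFp hH ht.le).2 ⟨u, hu, e⟩
  have hlen : H.len j ≤ H.total := by
    linarith [hH.topLeft_add_le_total j, hH.topLeft_nonneg j]
  refine ⟨F.map^[t] (H.topLeft j), ?_, by linarith [hm.2], by linarith [hm.1]⟩
  rcases hT.floor_left_mem hF hH j t with h0 | h0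
  · rw [h0] at hm
    linarith [hm.2]
  · exact h0

end SplitPoints

end IntervalExchange

namespace IntervalExchange

/-! ### The Cantor set -/

section Rho

variable {d : ℕ} {F : IntervalExchange d}

lemma rho_apply {S : Set ℝ} (hS : MeasurableSet S) : F.rho S =
    ∑' n, (2 : ENNReal)⁻¹ ^ n * Measure.count (S ∩ (F.forwardPoints n ∪ F.backwardPoints n)) := by
  rw [rho, Measure.sum_apply _ hS]
  refine tsum_congr fun n => ?_
  rw [Measure.smul_apply, Measure.restrict_apply hS, smul_eq_mul]

lemma encard_points_le (hF : F.IsUnitExchange) (n : ℕ) :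
    (F.forwardPoints n ∪ F.backwardPoints n).encard ≤ 2 * d := by
  have hr : (range F.topLeft).encard ≤ d := by
    rw [← image_univ]
    exact (encard_image_le _ _).trans (by simp)
  refine (encard_union_le _ _).trans ?_
  rw [two_mul]
  refine add_le_add ?_ ?_
  · exact (encard_image_le _ _).trans ((encard_le_encard sdiff_subset).trans
      ((encard_image_le _ _).trans hr))
  · have hinj : InjOn F.map^[n] (F.backwardPoints n) := fun x hx y hy e =>
      hF.lenPos.iterate_inj (by rw [hF.total_eq]; exact hx.1) (by rw [hF.total_eq]; exact hy.1) e
    rw [← hinj.encard_image]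
    refine (encard_le_encard ?_).trans hr
    rintro _ ⟨x, hx, rfl⟩
    exact hx.2.1

lemma finite_points (hF : F.IsUnitExchange) (n : ℕ) :
    (F.forwardPoints n ∪ F.backwardPoints n).Finite := by
  rw [← encard_lt_top_iff]
  refine (encard_points_le hF n).trans_lt ?_
  exact_mod_cast ENat.natCast_lt_top (2 * d)

lemma isFiniteMeasure_rho (hF : F.IsUnitExchange) : IsFiniteMeasure F.rho := by
  refine ⟨?_⟩
  rw [rho_apply MeasurableSet.univ]
  have hle : ∀ n, (2 : ENNReal)⁻¹ ^ n *
      Measure.count (univ ∩ (F.forwardPoints n ∪ F.backwardPoints n)) ≤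
      (2 : ENNReal)⁻¹ ^ n * (2 * d : ℕ) := by
    intro n
    refine mul_le_mul_right ?_ _
    rw [univ_inter, Measure.count_apply (finite_points hF n).measurableSet]
    have := encard_points_le hF n
    exact_mod_cast (ENat.toENNReal_le.2 this)
  refine (ENNReal.tsum_le_tsum hle).trans_lt ?_
  rw [ENNReal.tsum_mul_right, ENNReal.tsum_geometric]
  refine ENNReal.mul_lt_top ?_ (ENNReal.natCast_lt_top _)
  simp

lemma measurableSet_splitPoints (hF : F.IsUnitExchange) : MeasurableSet F.splitPoints :=
  MeasurableSet.iUnion fun n => (finite_points hF n).measurableSet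

lemma rho_compl_splitPoints (hF : F.IsUnitExchange) : F.rho F.splitPointsᶜ = 0 := by
  rw [rho_apply (measurableSet_splitPoints hF).compl, ENNReal.tsum_eq_zero]
  intro n
  have : F.splitPointsᶜ ∩ (F.forwardPoints n ∪ F.backwardPoints n) = ∅ := by
    rw [← disjoint_iff_inter_eq_empty]
    exact disjoint_compl_left.mono_right (subset_iUnion (fun n => F.forwardPoints n ∪
      F.backwardPoints n) n)
  rw [this, measure_empty, mul_zero]

lemma rho_pos_of_mem (hF : F.IsUnitExchange) {S : Set ℝ} {z : ℝ} (hz : z ∈ F.splitPoints)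
    (hzS : z ∈ S) : 0 < F.rho.real S := by
  have := isFiniteMeasure_rho hF
  obtain ⟨n, hn⟩ := mem_iUnion.1 hz
  refine ENNReal.toReal_pos (fun h0 => ?_) (measure_ne_top _ _)
  have h1 : F.rho {z} = 0 := measure_mono_null (singleton_subset_iff.2 hzS) h0
  rw [rho_apply (measurableSet_singleton z), ENNReal.tsum_eq_zero] at h1
  have h2 := h1 n
  rw [inter_eq_left.2 (singleton_subset_iff.2 hn), Measure.count_singleton, mul_one] at h2
  simp at h2

lemma exists_rho_compl_lt (hF : F.IsUnitExchange) {ε : ℝ} (hε : 0 < ε) :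
    ∃ E : Set ℝ, E.Finite ∧ E ⊆ F.splitPoints ∧ F.rho.real Eᶜ < ε := by
  have := isFiniteMeasure_rho hF
  set s : ℕ → Set ℝ := fun M => ⋃ n ∈ Finset.range M, F.forwardPoints n ∪ F.backwardPoints n
    with hs
  have hfin : ∀ M, (s M).Finite := fun M =>
    (Finset.range M).finite_toSet.biUnion fun n _ => finite_points hF n
  have hmono : Monotone s := fun a b hab =>
    biUnion_subset_biUnion_left (Finset.range_mono hab)
  have hinter : ⋂ M, (s M)ᶜ = F.splitPointsᶜ := by
    rw [← compl_iUnion]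
    congr 1
    ext x
    simp only [hs, splitPoints, mem_iUnion, Finset.mem_range, exists_prop]
    exact ⟨fun ⟨_, n, _, h⟩ => ⟨n, h⟩, fun ⟨n, h⟩ => ⟨n + 1, n, by omega, h⟩⟩
  have hlim := tendsto_measure_iInter_atTop (μ := F.rho) (s := fun M => (s M)ᶜ)
    (fun M => (hfin M).measurableSet.compl.nullMeasurableSet)
    (fun a b hab => compl_subset_compl.2 (hmono hab)) ⟨0, measure_ne_top _ _⟩
  rw [hinter, rho_compl_splitPoints hF] at hlim
  obtain ⟨M, hM⟩ := (hlim.eventually (gt_mem_nhds (ENNReal.ofReal_pos.2 hε))).exists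
  refine ⟨s M, hfin M, ?_, ?_⟩
  · simp only [hs]
    exact iUnion₂_subset fun n _ => subset_iUnion (fun n => F.forwardPoints n ∪
      F.backwardPoints n) n
  · exact (ENNReal.lt_ofReal_iff_toReal_lt (measure_ne_top _ _)).1 hM

/-- The floors of towers over short exchanges, and the returns to the base, are short in `K`. -/
lemma Keane.exists_rho_floor_lt (hd : 2 ≤ d) (hF : F.IsUnitExchange) (hK : F.Keane) {ε : ℝ}
    (hε : 0 < ε) : ∃ δ > 0, ∀ (H : IntervalExchange d) (h : Fin d → ℕ), H.LenPos →
      H.total < δ → Tower F H h → ∀ j, ∀ s ≤ h j,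
      F.rho.real (Ioo (F.map^[s] (H.topLeft j)) (F.map^[s] (H.topLeft j) + H.len j)) < ε := by
  have := isFiniteMeasure_rho hF
  obtain ⟨E, hE, hED, hlt⟩ := exists_rho_compl_lt hF hε
  have hev : ∀ᶠ δ in 𝓝[>] (0 : ℝ), ∀ z ∈ E, ∀ (H : IntervalExchange d) (h : Fin d → ℕ),
      H.LenPos → H.total < δ → Tower F H h → ∀ j, ∀ s ≤ h j,
      z ∉ Ioo (F.map^[s] (H.topLeft j)) (F.map^[s] (H.topLeft j) + H.len j) := by
    rw [eventually_all_finite hE]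
    intro z hz
    obtain ⟨δ, hδ, hz'⟩ := hK.exists_forall_notMem_floor hd hF (hED hz)
    filter_upwards [Ioo_mem_nhdsGT hδ] with δ' hδ' H h hH hlt
    exact hz' H h hH (hlt.trans hδ'.2)
  obtain ⟨δ, hδ, hδ0⟩ := (hev.and self_mem_nhdsWithin).exists
  refine ⟨δ, hδ0, fun H h hH hlt' hT j s hs => lt_of_le_of_lt (measureReal_mono ?_) hlt⟩
  exact fun x hx hxE => hδ x hxE H h hH hlt' hT j s hs hx

lemma exists_rho_Ioo_lt (hF : F.IsUnitExchange) (x : ℝ) {ε : ℝ} (hε : 0 < ε) :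
    ∃ δ > 0, ∀ y, y < x + δ → F.rho.real (Ioo x y) < ε := by
  have := isFiniteMeasure_rho hF
  have hlim := tendsto_measure_biInter_gt (μ := F.rho) (s := fun t => Ioo x t) (a := x)
    (fun _ _ => measurableSet_Ioo.nullMeasurableSet)
    (fun i j _ hij => Ioo_subset_Ioo_right hij) ⟨x + 1, by simp, measure_ne_top _ _⟩
  have hempty : ⋂ t > x, Ioo x t = ∅ := by
    refine eq_empty_of_forall_notMem fun z hz => ?_
    have h1 := (mem_iInter₂.1 hz (x + 1) (by simp)).1
    exact lt_irrefl _ (mem_iInter₂.1 hz z h1).2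
  rw [hempty, measure_empty] at hlim
  have hev := hlim.eventually (gt_mem_nhds (ENNReal.ofReal_pos.2 hε))
  obtain ⟨y, hy, hxy⟩ := (hev.and self_mem_nhdsWithin).exists
  refine ⟨y - x, sub_pos.2 hxy, fun z hz => ?_⟩
  refine (ENNReal.lt_ofReal_iff_toReal_lt (measure_ne_top _ _)).1
    (lt_of_le_of_lt (measure_mono ?_) hy)
  exact Ioo_subset_Ioo_right (by linarith)

lemma exists_rho_Ico_lt (hF : F.IsUnitExchange) (x : ℝ) {ε : ℝ} (hε : 0 < ε) :
    ∃ δ > 0, ∀ y, x - δ < y → F.rho.real (Ico y x) < ε := by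
  have := isFiniteMeasure_rho hF
  have hlim := tendsto_measure_biInter_gt (μ := F.rho) (s := fun t => Ico (x - t) x) (a := 0)
    (fun _ _ => measurableSet_Ico.nullMeasurableSet)
    (fun i j _ hij => Ico_subset_Ico_left (by linarith)) ⟨1, by simp, measure_ne_top _ _⟩
  have hempty : ⋂ t > (0 : ℝ), Ico (x - t) x = ∅ := by
    refine eq_empty_of_forall_notMem fun z hz => ?_
    have h1 := (mem_iInter₂.1 hz 1 (by simp)).2
    have h2 := (mem_iInter₂.1 hz ((x - z) / 2) (by simpa using h1)).1
    linarith
  rw [hempty, measure_empty] at hlim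
  have hev := hlim.eventually (gt_mem_nhds (ENNReal.ofReal_pos.2 hε))
  obtain ⟨t, ht, ht0⟩ := (hev.and self_mem_nhdsWithin).exists
  refine ⟨t, ht0, fun z hz => ?_⟩
  refine (ENNReal.lt_ofReal_iff_toReal_lt (measure_ne_top _ _)).1
    (lt_of_le_of_lt (measure_mono ?_) ht)
  exact Ico_subset_Ico_left hz.le

lemma l_le_r (hF : F.IsUnitExchange) (x : ℝ) : F.l x ≤ F.r x :=
  have := isFiniteMeasure_rho hF
  measureReal_mono Ico_subset_Icc_self

lemma r_le_l (hF : F.IsUnitExchange) {x y : ℝ} (hxy : x < y) : F.r x ≤ F.l y :=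
  have := isFiniteMeasure_rho hF
  measureReal_mono (Icc_subset_Ico_right hxy)

lemma l_mono (hF : F.IsUnitExchange) : Monotone F.l := fun _ _ hxy =>
  have := isFiniteMeasure_rho hF
  measureReal_mono (Ico_subset_Ico_right hxy)

lemma r_mono (hF : F.IsUnitExchange) : Monotone F.r := fun _ _ hxy =>
  have := isFiniteMeasure_rho hF
  measureReal_mono (Icc_subset_Icc_right hxy)

lemma l_eq_r_add (hF : F.IsUnitExchange) {x y : ℝ} (hx : 0 ≤ x) (hxy : x < y) :
    F.l y = F.r x + F.rho.real (Ioo x y) := by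
  have := isFiniteMeasure_rho hF
  unfold l r
  rw [← measureReal_union _ measurableSet_Ioo, Icc_union_Ioo_eq_Ico hx hxy]
  exact disjoint_left.2 fun z hz hz' => absurd hz'.1 (not_lt.2 hz.2)

lemma l_eq_l_add (hF : F.IsUnitExchange) {x y : ℝ} (hx : 0 ≤ x) (hxy : x ≤ y) :
    F.l y = F.l x + F.rho.real (Ico x y) := by
  have := isFiniteMeasure_rho hF
  unfold l
  rw [← measureReal_union _ measurableSet_Ico, Ico_union_Ico_eq_Ico hx hxy]
  exact disjoint_left.2 fun z hz hz' => absurd hz'.1 (not_le.2 hz.2)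

lemma r_eq_l_add (hF : F.IsUnitExchange) {x : ℝ} (hx : 0 ≤ x) :
    F.r x = F.l x + F.rho.real {x} := by
  have := isFiniteMeasure_rho hF
  unfold l r
  rw [← measureReal_union _ (measurableSet_singleton x), Ico_union_right hx]
  simp

lemma l_lt_r (hF : F.IsUnitExchange) {x : ℝ} (hx : 0 ≤ x) (hxD : x ∈ F.splitPoints) :
    F.l x < F.r x := by
  rw [r_eq_l_add hF hx]
  linarith [rho_pos_of_mem hF hxD (mem_singleton x)]

lemma l_eq_r (hF : F.IsUnitExchange) {x : ℝ} (hx : 0 ≤ x) (hxD : x ∉ F.splitPoints) :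
    F.l x = F.r x := by
  have h0 : F.rho {x} = 0 :=
    measure_mono_null (singleton_subset_iff.2 hxD) (rho_compl_splitPoints hF)
  rw [r_eq_l_add hF hx, measureReal_def, h0]
  simp

lemma r_lt_l (hF : F.IsUnitExchange) [NeZero d] (hT : F.HasSmallTowers) {x y : ℝ} (hx : 0 ≤ x)
    (hxy : x < y) (hy : y ≤ 1) : F.r x < F.l y := by
  obtain ⟨z, hz, hz1, hz2⟩ := hT.exists_splitPoint hF hx hxy hy
  rw [l_eq_r_add hF hx hxy]
  linarith [rho_pos_of_mem hF hz (show z ∈ Ioo x y from ⟨hz1, hz2⟩)]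

lemma r_le_r_iff (hF : F.IsUnitExchange) [NeZero d] (hT : F.HasSmallTowers) {x y : ℝ}
    (hx : x ≤ 1) (hy : 0 ≤ y) : F.r x ≤ F.r y ↔ x ≤ y := by
  refine ⟨fun h => ?_, fun h => r_mono hF h⟩
  by_contra hlt
  linarith [r_lt_l hF hT hy (not_le.1 hlt) hx, l_le_r hF x]

lemma l_le_l_iff (hF : F.IsUnitExchange) [NeZero d] (hT : F.HasSmallTowers) {x y : ℝ}
    (hx : x ≤ 1) (hy : 0 ≤ y) : F.l x ≤ F.l y ↔ x ≤ y := by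
  refine ⟨fun h => ?_, fun h => l_mono hF h⟩
  by_contra hlt
  linarith [r_lt_l hF hT hy (not_le.1 hlt) hx, l_le_r hF y]

lemma r_le_l_iff_lt_or (hF : F.IsUnitExchange) [NeZero d] (hT : F.HasSmallTowers) {x y : ℝ}
    (hx : x ≤ 1) (hy : 0 ≤ y) : F.r x ≤ F.l y ↔ x < y ∨ (x = y ∧ y ∉ F.splitPoints) := by
  constructor
  · intro h
    rcases lt_trichotomy x y with hlt | rfl | hlt
    · exact Or.inl hlt
    · refine Or.inr ⟨rfl, fun hD => ?_⟩
      linarith [l_lt_r hF hy hD]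
    · linarith [r_lt_l hF hT hy hlt hx, l_le_r hF y, l_le_r hF x]
  · rintro (h | ⟨rfl, h⟩)
    · exact r_le_l hF h
    · exact (l_eq_r hF hy h).ge

lemma l_le_r_iff (hF : F.IsUnitExchange) [NeZero d] (hT : F.HasSmallTowers) {x y : ℝ}
    (hx : x ≤ 1) (hy : 0 ≤ y) : F.l x ≤ F.r y ↔ x ≤ y := by
  refine ⟨fun h => ?_, fun h => (l_mono hF h).trans (l_le_r hF y)⟩
  by_contra hlt
  linarith [r_lt_l hF hT hy (not_le.1 hlt) hx]

lemma isCompact_K (hd : 2 ≤ d) (hF : F.IsUnitExchange) (hK : F.Keane) : IsCompact F.K := by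
  have := isFiniteMeasure_rho hF
  have hsub : F.K ⊆ Icc 0 (F.l 1) := by
    rintro _ (⟨x, hx, rfl⟩ | ⟨x, hx, rfl⟩)
    · exact ⟨measureReal_nonneg, l_mono hF hx.2⟩
    · exact ⟨measureReal_nonneg, r_le_l hF hx.2⟩
  refine isCompact_Icc.of_isClosed_subset (isClosed_of_closure_subset fun t ht => ?_) hsub
  have htI : t ∈ Icc 0 (F.l 1) := closure_minimal hsub isClosed_Icc ht
  -- the point of the interval over which `t` has to lie
  set S : Set ℝ := {y | y ∈ Icc (0 : ℝ) 1 ∧ F.l y ≤ t} with hS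
  have h0S : (0 : ℝ) ∈ S := ⟨⟨le_rfl, zero_le_one⟩, by simpa [l] using htI.1⟩
  have hbdd : BddAbove S := ⟨1, fun y hy => hy.1.2⟩
  set x := sSup S with hx
  have hx0 : 0 ≤ x := le_csSup hbdd h0S
  have hx1 : x ≤ 1 := csSup_le ⟨0, h0S⟩ fun y hy => hy.1.2
  have hlx : F.l x ≤ t := by
    refine le_of_forall_pos_le_add fun ε hε => ?_
    obtain ⟨δ, hδ, hlt⟩ := exists_rho_Ico_lt hF x hε
    obtain ⟨y, hy, hxy⟩ := exists_lt_of_lt_csSup ⟨0, h0S⟩ (show x - δ < sSup S by linarith)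
    rw [l_eq_l_add hF hy.1.1 (le_csSup hbdd hy)]
    linarith [hlt y hxy, hy.2]
  rcases hx1.eq_or_lt with h1 | h1
  · rw [h1] at hlx
    exact Or.inl ⟨1, ⟨one_pos, le_rfl⟩, le_antisymm hlx htI.2⟩
  have hrx : t ≤ F.r x := by
    refine le_of_forall_pos_le_add fun ε hε => ?_
    obtain ⟨δ, hδ, hlt⟩ := exists_rho_Ioo_lt hF x hε
    set y := min 1 (x + δ / 2) with hy
    have hxy : x < y := lt_min h1 (by linarith)
    have hyS : y ∉ S := fun h => absurd (le_csSup hbdd h) (not_le.2 hxy)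
    have hyt : t < F.l y := by
      by_contra hcon
      exact hyS ⟨⟨hx0.trans hxy.le, min_le_left _ _⟩, not_lt.1 hcon⟩
    rw [l_eq_r_add hF hx0 hxy] at hyt
    linarith [hlt y ((min_le_right _ _).trans_lt (by linarith))]
  by_contra htK
  have htr : t ≠ F.r x := fun e => htK (Or.inr ⟨x, ⟨hx0, h1⟩, e.symm⟩)
  rcases hx0.eq_or_lt with h0 | h0
  · have : (0 : ℝ) ∉ F.splitPoints := fun h => lt_irrefl _ (hK.splitPoints_subset hd hF h).1
    rw [← h0] at hrx hlx htr
    exact htr (le_antisymm hrx ((l_eq_r hF le_rfl this).ge.trans hlx))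
  · have htl : t ≠ F.l x := fun e => htK (Or.inl ⟨x, ⟨h0, hx1⟩, e.symm⟩)
    have hnhds : Ioo (F.l x) (F.r x) ∈ 𝓝 t :=
      Ioo_mem_nhds (lt_of_le_of_ne hlx htl.symm) (lt_of_le_of_ne hrx htr)
    obtain ⟨w, hw, hwK⟩ := mem_closure_iff_nhds.1 ht _ hnhds
    rcases hwK with ⟨y, hy, rfl⟩ | ⟨y, hy, rfl⟩
    · rcases le_or_gt y x with hyx | hyx
      · exact absurd hw.1 (not_lt.2 (l_mono hF hyx))
      · exact absurd hw.2 (not_lt.2 (r_le_l hF hyx))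
    · rcases lt_or_ge y x with hyx | hyx
      · exact absurd hw.1 (not_lt.2 (r_le_l hF hyx))
      · exact absurd hw.2 (not_lt.2 (r_mono hF hyx))

end Rho

end IntervalExchange

namespace IntervalExchange

/-! ### Segments of the Cantor set and the extended map -/

section Segments

variable {d : ℕ} {F : IntervalExchange d}

/-- The copy of `[a, b)` in `K`, from the right copy of `a` to the left copy of `b`. -/
def seg (F : IntervalExchange d) (a b : ℝ) : Set F.K :=
  {z | (z : ℝ) ∈ F.r '' Ico a b ∪ F.l '' Ioc a b}

lemma mem_seg_iff (hF : F.IsUnitExchange) [NeZero d] (hT : F.HasSmallTowers) {a b : ℝ}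
    (ha : 0 ≤ a) (hab : a < b) (hb : b ≤ 1) {z : F.K} :
    z ∈ F.seg a b ↔ F.r a ≤ z ∧ (z : ℝ) ≤ F.l b := by
  obtain ⟨z, hz⟩ := z
  change z ∈ F.r '' Ico a b ∪ F.l '' Ioc a b ↔ F.r a ≤ z ∧ z ≤ F.l b
  constructor
  · rintro (⟨x, hx, rfl⟩ | ⟨x, hx, rfl⟩)
    · exact ⟨r_mono hF hx.1, r_le_l hF hx.2⟩
    · exact ⟨r_le_l hF hx.1, l_mono hF hx.2⟩
  · rintro ⟨h1, h2⟩
    rcases hz with ⟨x, hx, rfl⟩ | ⟨x, hx, rfl⟩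
    · rw [l_le_l_iff hF hT hx.2 (ha.trans hab.le)] at h2
      rcases (r_le_l_iff_lt_or hF hT (hab.le.trans hb) hx.1.le).1 h1 with h | ⟨rfl, h⟩
      · exact Or.inr ⟨x, ⟨h, h2⟩, rfl⟩
      · exact Or.inl ⟨a, ⟨le_rfl, hab⟩, (l_eq_r hF ha h).symm⟩
    · rw [r_le_r_iff hF hT (hab.le.trans hb) hx.1] at h1
      rcases (r_le_l_iff_lt_or hF hT hx.2.le (ha.trans hab.le)).1 h2 with h | ⟨rfl, h⟩
      · exact Or.inl ⟨x, ⟨h1, h⟩, rfl⟩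
      · exact Or.inr ⟨x, ⟨hab, le_rfl⟩, l_eq_r hF (ha.trans hab.le) h⟩

lemma isClosed_seg (hF : F.IsUnitExchange) [NeZero d] (hT : F.HasSmallTowers) {a b : ℝ}
    (ha : 0 ≤ a) (hab : a < b) (hb : b ≤ 1) : IsClosed (F.seg a b) := by
  have : F.seg a b = Subtype.val ⁻¹' Icc (F.r a) (F.l b) := by
    ext z
    exact mem_seg_iff hF hT ha hab hb
  rw [this]
  exact isClosed_Icc.preimage continuous_subtype_val

lemma dist_le_of_mem_seg (hF : F.IsUnitExchange) [NeZero d] (hT : F.HasSmallTowers) {a b : ℝ}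
    (ha : 0 ≤ a) (hab : a < b) (hb : b ≤ 1) {z w : F.K} (hz : z ∈ F.seg a b)
    (hw : w ∈ F.seg a b) : dist z w ≤ F.rho.real (Ioo a b) := by
  rw [mem_seg_iff hF hT ha hab hb] at hz hw
  have := l_eq_r_add hF ha hab
  rw [Subtype.dist_eq, Real.dist_eq, abs_sub_le_iff]
  constructor <;> linarith [hz.1, hz.2, hw.1, hw.2]

lemma seg_mono {a b a' b' : ℝ} (ha : a' ≤ a) (hb : b ≤ b') : F.seg a b ⊆ F.seg a' b' :=
  fun _ hz => union_subset_union (image_mono (Ico_subset_Ico ha hb))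
    (image_mono (Ioc_subset_Ioc ha hb)) hz

lemma mem_seg_zero_one (z : F.K) : z ∈ F.seg 0 1 := z.2.symm

/-- A finite cover by intervals that are closed on the left also covers after exchanging the roles
of the endpoints. -/
lemma exists_mem_Ioc {ι : Type*} [Finite ι] {a b : ι → ℝ} {u x : ℝ} (hux : u < x)
    (hcov : ∀ y ∈ Ioo u x, ∃ i, y ∈ Ico (a i) (b i)) : ∃ i, x ∈ Ioc (a i) (b i) := by
  by_contra hcon
  push Not at hcon
  have hev : ∀ᶠ y in 𝓝[<] x, ∀ i, y ∉ Ico (a i) (b i) := by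
    refine eventually_all.2 fun i => ?_
    by_cases h1 : a i < x
    · have h2 : b i < x := by
        by_contra h2
        exact hcon i ⟨h1, not_lt.1 h2⟩
      filter_upwards [Ioo_mem_nhdsLT h2] with y hy hy'
      exact absurd hy'.2 (not_lt.2 hy.1.le)
    · filter_upwards [self_mem_nhdsWithin] with y hy hy'
      exact h1 (hy'.1.trans_lt hy)
  obtain ⟨y, hy, hy'⟩ := (hev.and (Ioo_mem_nhdsLT hux)).exists
  obtain ⟨i, hi⟩ := hcov y hy'
  exact hy i hi

lemma seg_eq_iUnion {ι : Type*} [Finite ι] {a b : ι → ℝ} {u v : ℝ} (hab : ∀ i, a i < b i)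
    (hU : ∀ y, y ∈ Ico u v ↔ ∃ i, y ∈ Ico (a i) (b i)) :
    F.seg u v = ⋃ i, F.seg (a i) (b i) := by
  refine Subset.antisymm (fun z hz => mem_iUnion.2 ?_) (iUnion_subset fun i => ?_)
  · rcases hz with ⟨x, hx, hxz⟩ | ⟨x, hx, hxz⟩
    · obtain ⟨i, hi⟩ := (hU x).1 hx
      exact ⟨i, Or.inl ⟨x, hi, hxz⟩⟩
    · obtain ⟨i, hi⟩ := exists_mem_Ioc hx.1 fun y hy => (hU y).1 ⟨hy.1.le, hy.2.trans_le hx.2⟩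
      exact ⟨i, Or.inr ⟨x, hi, hxz⟩⟩
  · have hsub : Ico (a i) (b i) ⊆ Ico u v := fun y hy => (hU y).2 ⟨i, hy⟩
    obtain ⟨h1, h2⟩ := (Ico_subset_Ico_iff (hab i)).1 hsub
    exact seg_mono h1 h2

lemma disjoint_seg (hF : F.IsUnitExchange) [NeZero d] (hT : F.HasSmallTowers) {a b a' b' : ℝ}
    (ha : 0 ≤ a) (hab : a < b) (hb : b ≤ 1) (ha' : 0 ≤ a') (hab' : a' < b') (hb' : b' ≤ 1)
    (haD : a = 0 ∨ a ∈ F.splitPoints) (haD' : a' = 0 ∨ a' ∈ F.splitPoints)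
    (hdisj : Disjoint (Ico a b) (Ico a' b')) : Disjoint (F.seg a b) (F.seg a' b') := by
  wlog hlt : b ≤ a' generalizing a b a' b'
  · refine (this ha' hab' hb' ha hab hb haD' haD hdisj.symm ?_).symm
    rw [Ico_disjoint_Ico] at hdisj
    rcases min_le_iff.1 hdisj with h | h <;> rcases le_max_iff.1 h with h | h <;> linarith
  have hD : a' ∈ F.splitPoints := haD'.resolve_left (by linarith)
  refine disjoint_left.2 fun z hz hz' => ?_
  rw [mem_seg_iff hF hT ha hab hb] at hz
  rw [mem_seg_iff hF hT ha' hab' hb'] at hz'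
  linarith [l_mono hF hlt, l_lt_r hF ha' hD, hz.2, hz'.1]

end Segments

section ExtendedMap

variable {d : ℕ} {F H : IntervalExchange d} {h : Fin d → ℕ}

/-- The copy in `K` of the floor at height `s` of the tower over the `j`-th interval of `H`. -/
noncomputable def floor (F H : IntervalExchange d) (j : Fin d) (s : ℕ) : Set F.K :=
  F.seg (F.map^[s] (H.topLeft j)) (F.map^[s] (H.topLeft j) + H.len j)

lemma Tower.floor_bounds (hF : F.IsUnitExchange) (hH : H.LenPos) (hHT : Tower F H h) {j : Fin d}
    {s : ℕ} (hs : s ≤ h j) : 0 ≤ F.map^[s] (H.topLeft j) ∧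
      F.map^[s] (H.topLeft j) < F.map^[s] (H.topLeft j) + H.len j ∧
      F.map^[s] (H.topLeft j) + H.len j ≤ 1 := by
  have hFp := hF.lenPos
  have hm := hH.topLeft_mem j
  have h0 := hH.interval_subset j hm
  refine ⟨(hFp.iterate_mem ⟨h0.1, h0.2.trans_le hHT.total_le⟩ s).1,
    lt_add_of_pos_right _ (hH j), ?_⟩
  rcases hs.lt_or_eq with hs | rfl
  · obtain ⟨i, hi⟩ := hHT.mem j s hs
    refine (hHT.floor_subset hFp hH hs hi).2.trans ?_
    rw [← hF.total_eq]
    exact hFp.topLeft_add_le_total i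
  · rw [hHT.ret j _ hm, hH.map_topLeft]
    refine (hH.botLeft_add_le_total j).trans ?_
    rw [← hF.total_eq]
    exact hHT.total_le

lemma Tower.exists_mem_floor (hF : F.IsUnitExchange) (hH : H.LenPos) (hHT : Tower F H h)
    (z : F.K) : ∃ j, ∃ s < h j, z ∈ F.floor H j s := by
  have hcov : ∀ y ∈ Ico (0 : ℝ) 1, ∃ i : Σ j, Fin (h j),
      y ∈ Ico (F.map^[i.2] (H.topLeft i.1)) (F.map^[i.2] (H.topLeft i.1) + H.len i.1) := by
    intro y hy
    obtain ⟨j, s, hs, x, hx, e⟩ := hHT.cover y (hF.total_eq.symm ▸ hy)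
    exact ⟨⟨j, ⟨s, hs⟩⟩, (hHT.image_floor hF.lenPos hH hs.le).2 ⟨x, hx, e⟩⟩
  rcases mem_seg_zero_one z with ⟨x, hx, hz⟩ | ⟨x, hx, hz⟩
  · obtain ⟨⟨j, s⟩, hi⟩ := hcov x hx
    exact ⟨j, s, s.2, Or.inl ⟨x, hi, hz⟩⟩
  · obtain ⟨⟨j, s⟩, hi⟩ := exists_mem_Ioc hx.1 fun y hy => hcov y ⟨hy.1.le, hy.2.trans_le hx.2⟩
    exact ⟨j, s, s.2, Or.inr ⟨x, hi, hz⟩⟩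

lemma exists_mem_piece (hF : F.IsUnitExchange) (z : F.K) : ∃ i, z ∈ F.piece i := by
  obtain ⟨j, s, hs, hz⟩ := (Tower.refl hF.lenPos).exists_mem_floor hF hF.lenPos z
  obtain rfl : s = 0 := by omega
  exact ⟨j, hz⟩

variable [NeZero d]

lemma T_of_eq_r (hF : F.IsUnitExchange) (hT : F.HasSmallTowers) {z : F.K} {x : ℝ}
    (hx : x ∈ Ico (0 : ℝ) 1) (hz : F.r x = z) : (F.T hF z : ℝ) = F.r (F.map x) := by
  have h : ∃ x ∈ Ico (0 : ℝ) 1, F.r x = z := ⟨x, hx, hz⟩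
  have e : h.choose = x := by
    have h1 := h.choose_spec.1
    have h2 := h.choose_spec.2.trans hz.symm
    exact le_antisymm ((r_le_r_iff hF hT h1.2.le hx.1).1 h2.le)
      ((r_le_r_iff hF hT hx.2.le h1.1).1 h2.ge)
  unfold T
  rw [dif_pos h]
  simp only [e]

lemma T_of_eq_l (hF : F.IsUnitExchange) (hT : F.HasSmallTowers)
    {z : F.K} {x : ℝ} (hx : x ∈ Ioc (0 : ℝ) 1) (hz : F.l x = z) :
    (F.T hF z : ℝ) = F.l (F.mapLeft x) := by
  by_cases h : ∃ x' ∈ Ico (0 : ℝ) 1, F.r x' = z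
  · -- a point that is both a left and a right copy lies over a point outside `D`
    obtain ⟨x', hx', hz'⟩ := h
    have h1 := (l_le_r_iff hF hT hx.2 hx'.1).1 (hz.trans hz'.symm).le
    have h2 := (r_le_l_iff_lt_or hF hT hx'.2.le hx.1.le).1 (hz'.trans hz.symm).le
    obtain ⟨rfl, hD⟩ : x' = x ∧ x ∉ F.splitPoints := h2.resolve_left (not_lt.2 h1)
    rw [T_of_eq_r hF hT hx' hz']
    have hx0 : x' ∈ Ioo (0 : ℝ) 1 := ⟨hx.1, hx'.2⟩
    obtain ⟨j, hj⟩ := hF.lenPos.exists_mem_interval (hF.total_eq.symm ▸ hx')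
    have hne : F.topLeft j ≠ x' := fun e => hD (markedPoints_subset hF ⟨⟨j, e⟩, hx0.1.ne'⟩)
    have e : F.mapLeft x' = F.map x' := by
      rw [hF.mapLeft_eq ⟨lt_of_le_of_ne hj.1 hne, hj.2.le⟩, hF.map_eq hj]
    rw [e, l_eq_r hF (hF.map_mem hx').1 (map_notMem_splitPoints hF hx0 hD)]
  · have h' : ∃ x ∈ Ioc (0 : ℝ) 1, F.l x = z := z.2.resolve_right h
    have e : h'.choose = x := by
      have h1 := h'.choose_spec.1
      have h2 := h'.choose_spec.2.trans hz.symm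
      exact le_antisymm ((l_le_l_iff hF hT h1.2 hx.1.le).1 h2.le)
        ((l_le_l_iff hF hT hx.2 h1.1.le).1 h2.ge)
    unfold T
    rw [dif_neg h]
    simp only [e]

lemma T_image_seg (hF : F.IsUnitExchange) (hT : F.HasSmallTowers)
    {a b : ℝ} {i : Fin d} (ha : F.topLeft i ≤ a) (hb : b ≤ F.topLeft i + F.len i) :
    F.T hF '' F.seg a b =
      F.seg (a + (F.botLeft i - F.topLeft i)) (b + (F.botLeft i - F.topLeft i)) := by
  have h0 := hF.lenPos.topLeft_nonneg i
  have h1 := hF.total_eq ▸ hF.lenPos.topLeft_add_le_total i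
  have hr : ∀ x ∈ Ico a b, ∀ z : F.K, F.r x = z →
      (F.T hF z : ℝ) = F.r (x + (F.botLeft i - F.topLeft i)) := by
    intro x hx z hz
    rw [T_of_eq_r hF hT ⟨by linarith [hx.1], by linarith [hx.2]⟩ hz,
      hF.map_eq ⟨ha.trans hx.1, hx.2.trans_le hb⟩]
  have hl : ∀ x ∈ Ioc a b, ∀ z : F.K, F.l x = z →
      (F.T hF z : ℝ) = F.l (x + (F.botLeft i - F.topLeft i)) := by
    intro x hx z hz
    rw [T_of_eq_l hF hT ⟨by linarith [hx.1], by linarith [hx.2]⟩ hz,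
      hF.mapLeft_eq ⟨ha.trans_lt hx.1, hx.2.trans hb⟩]
  ext w
  constructor
  · rintro ⟨z, ⟨x, hx, hz⟩ | ⟨x, hx, hz⟩, rfl⟩
    · exact Or.inl ⟨_, ⟨by linarith [hx.1], by linarith [hx.2]⟩, (hr x hx z hz).symm⟩
    · exact Or.inr ⟨_, ⟨by linarith [hx.1], by linarith [hx.2]⟩, (hl x hx z hz).symm⟩
  · rintro (⟨y, hy, hw⟩ | ⟨y, hy, hw⟩)
    · set x := y - (F.botLeft i - F.topLeft i) with hx
      have hx' : x ∈ Ico a b := ⟨by linarith [hy.1], by linarith [hy.2]⟩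
      have hxK : F.r x ∈ F.K := Or.inr ⟨x, ⟨by linarith [hx'.1], by linarith [hx'.2]⟩, rfl⟩
      refine ⟨⟨F.r x, hxK⟩, Or.inl ⟨x, hx', rfl⟩, Subtype.ext ?_⟩
      rw [hr x hx' _ rfl, ← hw, hx, sub_add_cancel]
    · set x := y - (F.botLeft i - F.topLeft i) with hx
      have hx' : x ∈ Ioc a b := ⟨by linarith [hy.1], by linarith [hy.2]⟩
      have hxK : F.l x ∈ F.K := Or.inl ⟨x, ⟨by linarith [hx'.1], by linarith [hx'.2]⟩, rfl⟩
      refine ⟨⟨F.l x, hxK⟩, Or.inr ⟨x, hx', rfl⟩, Subtype.ext ?_⟩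
      rw [hl x hx' _ rfl, ← hw, hx, sub_add_cancel]

lemma Tower.T_image_floor (hF : F.IsUnitExchange) (hT : F.HasSmallTowers) (hH : H.LenPos)
    (hHT : Tower F H h) {j : Fin d} {s : ℕ}
    (hs : s < h j) : F.T hF '' F.floor H j s = F.floor H j (s + 1) := by
  obtain ⟨i, hi⟩ := hHT.mem j s hs
  obtain ⟨h1, h2⟩ := hHT.floor_subset hF.lenPos hH hs hi
  unfold floor
  rw [T_image_seg hF hT h1 h2, Function.iterate_succ_apply',
    hF.map_eq (hi _ (hH.topLeft_mem j))]
  congr 1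
  ring

/-- Different floors, and also their images under `e` applications of the map for `e ≤ 1`, are
disjoint. -/
lemma Tower.disjoint_floor (hF : F.IsUnitExchange) (hT : F.HasSmallTowers) (hH : H.LenPos)
    (hHT : Tower F H h) {e : ℕ} (he : e ≤ 1) {j j' : Fin d} {s s' : ℕ} (hs : s < h j)
    (hs' : s' < h j') (hne : ¬ (j = j' ∧ s = s')) :
    Disjoint (F.floor H j (s + e)) (F.floor H j' (s' + e)) := by
  have hFp := hF.lenPos
  have h1 := hHT.floor_bounds hF hH (show s + e ≤ h j by omega)
  have h2 := hHT.floor_bounds hF hH (show s' + e ≤ h j' by omega)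
  refine disjoint_seg hF hT h1.1 h1.2.1 h1.2.2 h2.1 h2.2.1 h2.2.2
    (hHT.floor_left_mem hF hH j _) (hHT.floor_left_mem hF hH j' _) ?_
  refine disjoint_left.2 fun y hy hy' => hne ?_
  obtain ⟨x, hx, rfl⟩ := (hHT.image_floor hFp hH (by omega)).1 hy
  obtain ⟨x', hx', e'⟩ := (hHT.image_floor hFp hH (by omega)).1 hy'
  have hmem : ∀ k, ∀ x ∈ H.interval k, x ∈ Ico 0 F.total := fun k x hx =>
    Ico_subset_Ico_right hHT.total_le (hH.interval_subset k hx)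
  rw [add_comm s, add_comm s', Function.iterate_add_apply, Function.iterate_add_apply] at e'
  have e'' := hFp.iterate_inj (hFp.iterate_mem (hmem _ _ hx') _)
    (hFp.iterate_mem (hmem _ _ hx) _) e'
  obtain ⟨h3, h4, -⟩ := hHT.floor_unique hFp hH hs' hs hx' hx e''
  exact ⟨h4.symm, h3.symm⟩

lemma Tower.isClosed_floor (hF : F.IsUnitExchange) (hT : F.HasSmallTowers) (hH : H.LenPos)
    (hHT : Tower F H h) {j : Fin d} {s : ℕ} (hs : s ≤ h j) : IsClosed (F.floor H j s) := by
  have h1 := hHT.floor_bounds hF hH hs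
  exact isClosed_seg hF hT h1.1 h1.2.1 h1.2.2

lemma Tower.isOpen_floor (hF : F.IsUnitExchange) (hT : F.HasSmallTowers) (hH : H.LenPos)
    (hHT : Tower F H h) {j : Fin d} {s : ℕ} (hs : s < h j) : IsOpen (F.floor H j s) := by
  have hcompl : (F.floor H j s)ᶜ =
      ⋃ i : {i : Σ j, Fin (h j) // ¬ (j = i.1 ∧ s = i.2)}, F.floor H i.1.1 i.1.2 := by
    ext z
    simp only [mem_compl_iff, mem_iUnion]
    constructor
    · intro hz
      obtain ⟨j', s', hs', hz'⟩ := hHT.exists_mem_floor hF hH z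
      refine ⟨⟨⟨j', ⟨s', hs'⟩⟩, ?_⟩, hz'⟩
      rintro ⟨rfl, rfl⟩
      exact hz hz'
    · rintro ⟨⟨⟨j', s'⟩, hne⟩, hz'⟩ hz
      exact disjoint_left.1 (hHT.disjoint_floor hF hT hH (e := 0) (by omega) hs s'.2 hne) hz hz'
  rw [← isClosed_compl_iff, hcompl]
  exact isClosed_iUnion_of_finite fun i => hHT.isClosed_floor hF hT hH i.1.2.2.le

/-- Towers all of whose floors, and images of floors, are short. -/
lemma Keane.exists_tower_dist_lt (hd : 2 ≤ d) (hF : F.IsUnitExchange) (hK : F.Keane)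
    (hT : F.HasSmallTowers) {ε : ℝ} (hε : 0 < ε) :
    ∃ δ > 0, ∀ (H : IntervalExchange d) (h : Fin d → ℕ), H.LenPos → H.total < δ → Tower F H h →
      ∀ j, ∀ s ≤ h j, ∀ z ∈ F.floor H j s, ∀ w ∈ F.floor H j s, dist z w < ε := by
  obtain ⟨δ, hδ, hlt⟩ := hK.exists_rho_floor_lt hd hF hε
  refine ⟨δ, hδ, fun H h hH hHδ hHT j s hs z hz w hw => ?_⟩
  have h1 := hHT.floor_bounds hF hH hs
  exact (dist_le_of_mem_seg hF hT h1.1 h1.2.1 h1.2.2 hz hw).trans_lt (hlt H h hH hHδ hHT j s hs)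

lemma continuous_T (hd : 2 ≤ d) (hF : F.IsUnitExchange) (hK : F.Keane) (hT : F.HasSmallTowers) :
    Continuous (F.T hF) := by
  rw [Metric.continuous_iff']
  intro z ε hε
  obtain ⟨δ, hδ, hlt⟩ := hK.exists_tower_dist_lt hd hF hT hε
  obtain ⟨H, h, hH, hHδ, hHT⟩ := hT δ hδ
  obtain ⟨j, s, hs, hz⟩ := hHT.exists_mem_floor hF hH z
  filter_upwards [(hHT.isOpen_floor hF hT hH hs).mem_nhds hz] with w hw
  have himg := hHT.T_image_floor hF hT hH hs
  exact hlt H h hH hHδ hHT j (s + 1) hs _ (himg ▸ mem_image_of_mem _ hw) _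
    (himg ▸ mem_image_of_mem _ hz)

lemma injective_T (hd : 2 ≤ d) (hF : F.IsUnitExchange) (hK : F.Keane) (hT : F.HasSmallTowers) :
    Function.Injective (F.T hF) := by
  intro z w e
  by_contra hne
  obtain ⟨δ, hδ, hlt⟩ := hK.exists_tower_dist_lt hd hF hT (dist_pos.2 hne)
  obtain ⟨H, h, hH, hHδ, hHT⟩ := hT δ hδ
  obtain ⟨j, s, hs, hz⟩ := hHT.exists_mem_floor hF hH z
  obtain ⟨j', s', hs', hw⟩ := hHT.exists_mem_floor hF hH w
  have hne' : ¬ (j = j' ∧ s = s') := by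
    rintro ⟨rfl, rfl⟩
    exact lt_irrefl _ (hlt H h hH hHδ hHT j s hs.le z hz w hw)
  have hdisj := hHT.disjoint_floor hF hT hH (e := 1) le_rfl hs hs' hne'
  have h1 : F.T hF z ∈ F.floor H j (s + 1) := by
    rw [← hHT.T_image_floor hF hT hH hs]
    exact mem_image_of_mem _ hz
  have h2 : F.T hF z ∈ F.floor H j' (s' + 1) := by
    rw [← hHT.T_image_floor hF hT hH hs', e]
    exact mem_image_of_mem _ hw
  exact disjoint_left.1 hdisj h1 h2

end ExtendedMap

section CocycleK

variable {d m : ℕ} [NeZero d] {F : IntervalExchange d}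

lemma isClopen_piece (hF : F.IsUnitExchange) (hT : F.HasSmallTowers) (i : Fin d) :
    IsClopen (F.piece i) :=
  ⟨(Tower.refl hF.lenPos).isClosed_floor hF hT hF.lenPos (j := i) (s := 0) (by simp),
    (Tower.refl hF.lenPos).isOpen_floor hF hT hF.lenPos (j := i) (s := 0) (by simp)⟩

lemma disjoint_piece (hF : F.IsUnitExchange) (hT : F.HasSmallTowers) {i j : Fin d} (hij : i ≠ j) :
    Disjoint (F.piece i) (F.piece j) :=
  (Tower.refl hF.lenPos).disjoint_floor hF hT hF.lenPos (e := 0) (s := 0) (s' := 0) (by simp)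
    (by simp) (by simp) (by simp [hij])

lemma cocycleK_eq (hF : F.IsUnitExchange) (hT : F.HasSmallTowers) (φ : Fin d → Fin m → ℤ)
    {z : F.K} {i : Fin d} (hz : z ∈ F.piece i) : F.cocycleK φ z = φ i := by
  unfold cocycleK
  rw [Finset.sum_eq_single i, indicator_of_mem hz]
  · exact fun j _ hij => indicator_of_notMem
      (fun hj => disjoint_left.1 (disjoint_piece hF hT hij) hj hz) _
  · simp

lemma continuous_cocycleK (hF : F.IsUnitExchange) (hT : F.HasSmallTowers)
    (φ : Fin d → Fin m → ℤ) : Continuous (F.cocycleK φ) := by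
  refine continuous_finsetSum _ fun i _ => ?_
  exact continuous_const.indicator fun z hz => by
    rw [(isClopen_piece hF hT i).frontier_eq] at hz
    exact absurd hz (notMem_empty z)

end CocycleK

end IntervalExchange

/-! ### Conformal measures on compact spaces -/

section Conformal

variable {X : Type*} [MetricSpace X] [MeasurableSpace X] [BorelSpace X]
  {T : X → X}

/-- The measure `ν` is multiplied by `g` under `T`, in the form of a change of variables `y = T x`
for continuous functions. -/
def IsConformalMeasure (T : X → X) (g : C(X, ℝ)) (ν : Measure X) : Prop :=
  ∀ f : C(X, ℝ), ∫ x, f x ∂ν = ∫ x, f (T x) * g x ∂ν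

lemma integral_map_withDensity (hT : Continuous T) (g : C(X, ℝ)) (hg : ∀ x, 0 ≤ g x)
    (ν : Measure X) (f : C(X, ℝ)) :
    ∫ x, f x ∂(ν.withDensity fun x => ENNReal.ofReal (g x)).map T =
      ∫ x, f (T x) * g x ∂ν := by
  have hm : Measurable fun x => ENNReal.ofReal (g x) :=
    ENNReal.measurable_ofReal.comp g.continuous.measurable
  rw [integral_map hT.aemeasurable f.continuous.aestronglyMeasurable,
    integral_withDensity_eq_integral_toReal_smul hm (by simp)]
  refine integral_congr_ae (ae_of_all _ fun x => ?_)
  simp only [ENNReal.toReal_ofReal (hg x), smul_eq_mul, mul_comm]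

variable [CompactSpace X]

lemma integrable_of_continuous (ν : Measure X) [IsFiniteMeasure ν] {f : X → ℝ}
    (hf : Continuous f) : Integrable f ν :=
  hf.integrable_of_hasCompactSupport (HasCompactSupport.of_compactSpace f)

lemma isFiniteMeasure_withDensity_continuous (g : C(X, ℝ)) (ν : Measure X) [IsFiniteMeasure ν] :
    IsFiniteMeasure (ν.withDensity fun x => ENNReal.ofReal (g x)) :=
  isFiniteMeasure_withDensity_ofReal (integrable_of_continuous ν g.continuous).2

/-- The measure of images is given by integrals of `g` if and only if the change of variables
formula holds. -/
lemma isConformalMeasure_iff (hT : Continuous T) (hbij : Function.Bijective T) (g : C(X, ℝ))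
    (hg : ∀ x, 0 ≤ g x) (ν : Measure X) [IsFiniteMeasure ν] :
    IsConformalMeasure T g ν ↔
      ∀ B, MeasurableSet B → ν (T '' B) = ∫⁻ x in B, ENNReal.ofReal (g x) ∂ν := by
  have hfin := isFiniteMeasure_withDensity_continuous g ν
  have hemb := (hT.isClosedEmbedding hbij.1).measurableEmbedding
  constructor
  · intro h B hB
    have hmap : ν = (ν.withDensity fun x => ENNReal.ofReal (g x)).map T := by
      refine ext_of_forall_integral_eq_of_IsFiniteMeasure fun f => ?_
      have := integral_map_withDensity hT g hg ν f.toContinuousMap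
      rw [← h] at this
      exact this.symm
    conv_lhs => rw [hmap]
    rw [hemb.map_apply, preimage_image_eq _ hbij.1, withDensity_apply _ hB]
  · intro h f
    have hmap : ν = (ν.withDensity fun x => ENNReal.ofReal (g x)).map T := by
      ext A hA
      rw [hemb.map_apply, withDensity_apply _ (hT.measurable hA), ← h _ (hT.measurable hA),
        image_preimage_eq _ hbij.2]
    rw [← integral_map_withDensity hT g hg, ← hmap]

/-- If the products of `g` along the orbit of `p` do not tend to `0` because they return to a value
`C` infinitely often, then the weighted averages over the orbit segments of these lengths accumulate
at a conformal measure. -/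
lemma exists_isConformalMeasure (hT : Continuous T) (g : C(X, ℝ)) (hg : ∀ x, 0 < g x) (p : X)
    (C : ℝ) (hinf : {n : ℕ | ∏ t ∈ Finset.range n, g (T^[t] p) = C}.Infinite) :
    ∃ ν : Measure X, IsProbabilityMeasure ν ∧ IsConformalMeasure T g ν := by
  set W : ℕ → ℝ := fun n => ∏ t ∈ Finset.range n, g (T^[t] p) with hW
  have hWpos : ∀ n, 0 < W n := fun n => Finset.prod_pos fun _ _ => hg _
  have hWsucc : ∀ n, W (n + 1) = W n * g (T^[n] p) := fun n => Finset.prod_range_succ _ _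
  set Z : ℕ → ℝ := fun n => ∑ s ∈ Finset.range n, W s with hZ
  obtain ⟨n0, hn0⟩ := hinf.nonempty
  have hC : 0 < C := by
    have : W n0 = C := hn0
    rw [← this]
    exact hWpos n0
  have hfreq : ∃ᶠ n in atTop, W n = C := Nat.frequently_atTop_iff_infinite.2 hinf
  have hZlim : Tendsto Z atTop atTop := by
    rw [← not_summable_iff_tendsto_nat_atTop_of_nonneg fun n => (hWpos n).le]
    intro hsum
    have h1 := hsum.tendsto_atTop_zero.eventually (gt_mem_nhds hC)
    obtain ⟨n, hn, hn'⟩ := (hfreq.and_eventually h1).exists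
    exact absurd hn hn'.ne
  -- weighted averages along orbit segments
  let κ : ℕ → Measure X := fun n =>
    ENNReal.ofReal (Z n)⁻¹ • ∑ s ∈ Finset.range n, ENNReal.ofReal (W s) • Measure.dirac (T^[s] p)
  have hint : ∀ n, ∀ f : X → ℝ, Continuous f →
      ∫ x, f x ∂(κ n) = (Z n)⁻¹ * ∑ s ∈ Finset.range n, W s * f (T^[s] p) := by
    intro n f hf
    have hZn : 0 ≤ (Z n)⁻¹ := inv_nonneg.2 (Finset.sum_nonneg fun s _ => (hWpos s).le)
    rw [integral_smul_measure, ENNReal.toReal_ofReal hZn, smul_eq_mul,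
      integral_finsetSum_measure]
    · congr 1
      refine Finset.sum_congr rfl fun s _ => ?_
      rw [integral_smul_measure, ENNReal.toReal_ofReal (hWpos s).le, integral_dirac, smul_eq_mul]
    · intro s _
      exact (integrable_of_continuous _ hf).smul_measure ENNReal.ofReal_ne_top
  have hκ : ∀ n, 0 < n → IsProbabilityMeasure (κ n) := by
    intro n hn
    have hZn : 0 < Z n :=
      Finset.sum_pos (fun s _ => hWpos s) ⟨0, Finset.mem_range.2 hn⟩
    refine ⟨?_⟩
    simp only [κ, Measure.smul_apply, Measure.finsetSum_apply, smul_eq_mul, measure_univ, mul_one]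
    rw [← ENNReal.ofReal_sum_of_nonneg fun s _ => (hWpos s).le,
      ← ENNReal.ofReal_mul (inv_nonneg.2 hZn.le), inv_mul_cancel₀ hZn.ne', ENNReal.ofReal_one]
  let P : ℕ → ProbabilityMeasure X := fun n => ⟨κ (n + 1), hκ _ n.succ_pos⟩
  have hfreq' : ∃ᶠ n in atTop, W (n + 1) = C := by
    rw [frequently_atTop] at hfreq ⊢
    intro a
    obtain ⟨b, hb, hWb⟩ := hfreq (a + 1)
    exact ⟨b - 1, by omega, by rwa [Nat.sub_add_cancel (by omega)]⟩
  have hne : (atTop ⊓ 𝓟 {n | W (n + 1) = C}).NeBot := by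
    rw [inf_principal_neBot_iff]
    intro U hU
    obtain ⟨n, h1, h2⟩ := (hfreq'.and_eventually hU).exists
    exact ⟨n, h2, h1⟩
  set 𝒰 := Ultrafilter.of (atTop ⊓ 𝓟 {n | W (n + 1) = C}) with h𝒰
  have h𝒰1 : (𝒰 : Filter ℕ) ≤ atTop := (Ultrafilter.of_le _).trans inf_le_left
  have h𝒰2 : ∀ᶠ n in (𝒰 : Filter ℕ), W (n + 1) = C :=
    ((Ultrafilter.of_le _).trans inf_le_right) (mem_principal_self _)
  obtain ⟨ν, -, hν⟩ := (isCompact_univ (X := ProbabilityMeasure X)).ultrafilter_le_nhds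
    (𝒰.map P) (by simp)
  have hlim : ∀ f : X → ℝ, Continuous f →
      Tendsto (fun n => ∫ x, f x ∂(κ (n + 1))) 𝒰 (𝓝 (∫ x, f x ∂(ν : Measure X))) := by
    intro f hf
    have := (ProbabilityMeasure.continuous_integral_continuousMap (X := X)
      (⟨f, hf⟩ : C(X, ℝ))).tendsto ν
    exact this.comp (show Tendsto P 𝒰 (𝓝 ν) from hν)
  refine ⟨ν, inferInstance, fun f => ?_⟩
  have hfT : Continuous fun x => f (T x) * g x :=
    (f.continuous.comp hT).mul g.continuous
  -- the two sides differ by the boundary terms of a telescoping sum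
  have hdiff : ∀ n, ∫ x, f x ∂(κ (n + 1)) - ∫ x, f (T x) * g x ∂(κ (n + 1)) =
      (Z (n + 1))⁻¹ * (f p - W (n + 1) * f (T^[n + 1] p)) := by
    intro n
    rw [hint _ _ f.continuous, hint _ _ hfT, ← mul_sub, ← Finset.sum_sub_distrib]
    congr 1
    have := Finset.sum_range_sub' (fun s => W s * f (T^[s] p)) (n + 1)
    have hW0 : W 0 = 1 := by simp [hW]
    rw [hW0, one_mul, Function.iterate_zero_apply] at this
    rw [← this]
    refine Finset.sum_congr rfl fun s _ => ?_
    rw [hWsucc, Function.iterate_succ_apply']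
    ring
  obtain ⟨M, hM⟩ := isCompact_univ.exists_bound_of_continuousOn f.continuous.continuousOn
  have hzero : Tendsto
      (fun n => ∫ x, f x ∂(κ (n + 1)) - ∫ x, f (T x) * g x ∂(κ (n + 1))) 𝒰 (𝓝 0) := by
    have hb : Tendsto (fun n => (Z (n + 1))⁻¹ * (M + C * M)) 𝒰 (𝓝 0) := by
      have h1 : Tendsto (fun n => (Z (n + 1))⁻¹) atTop (𝓝 0) :=
        (hZlim.comp (tendsto_add_atTop_nat 1)).inv_tendsto_atTop
      simpa using (h1.mono_left h𝒰1).mul_const (M + C * M)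
    refine squeeze_zero_norm' ?_ hb
    filter_upwards [h𝒰2] with n hn
    have hZn : 0 ≤ (Z (n + 1))⁻¹ := inv_nonneg.2 (Finset.sum_nonneg fun s _ => (hWpos s).le)
    rw [hdiff, hn, norm_mul, Real.norm_of_nonneg hZn]
    refine mul_le_mul_of_nonneg_left ((norm_sub_le _ _).trans ?_) hZn
    rw [norm_mul, Real.norm_of_nonneg hC.le]
    exact add_le_add (hM p (mem_univ _)) (mul_le_mul_of_nonneg_left (hM _ (mem_univ _)) hC.le)
  exact sub_eq_zero.1 (tendsto_nhds_unique ((hlim f f.continuous).sub (hlim _ hfT)) hzero)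

/-- A family of conformal probability measures which are the only ones for their densities depends
continuously on the parameter, as the graph of the family is closed. -/
lemma continuous_of_isConformalMeasure {Ψ : Type*} [TopologicalSpace Ψ] (hT : Continuous T)
    (g : Ψ → C(X, ℝ)) (hg : Continuous g) (ν : Ψ → ProbabilityMeasure X)
    (hν : ∀ ψ, IsConformalMeasure T (g ψ) (ν ψ : Measure X))
    (huniq : ∀ ψ, ∀ κ : ProbabilityMeasure X, IsConformalMeasure T (g ψ) (κ : Measure X) →
      κ = ν ψ) : Continuous ν := by
  rw [continuous_iff_ultrafilter]
  intro ψ 𝒰 h𝒰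
  obtain ⟨κ, -, hκ⟩ := (isCompact_univ (X := ProbabilityMeasure X)).ultrafilter_le_nhds
    (𝒰.map ν) (by simp)
  have hκ' : Tendsto ν 𝒰 (𝓝 κ) := hκ
  have hlim : ∀ f : C(X, ℝ), Tendsto (fun ψ' => ∫ x, f x ∂(ν ψ' : Measure X)) 𝒰
      (𝓝 (∫ x, f x ∂(κ : Measure X))) := fun f =>
    ((ProbabilityMeasure.continuous_integral_continuousMap f).tendsto κ).comp hκ'
  have hgκ : Tendsto g 𝒰 (𝓝 (g ψ)) := (hg.tendsto ψ).mono_left h𝒰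
  suffices IsConformalMeasure T (g ψ) (κ : Measure X) by
    rw [← huniq ψ κ this]
    exact hκ'
  intro f
  let f' : C(X, ℝ) := f.comp ⟨T, hT⟩
  refine tendsto_nhds_unique (hlim f) ?_
  have h1 : Tendsto (fun ψ' => ∫ x, (f' * (g ψ' - g ψ)) x ∂(ν ψ' : Measure X)) 𝒰 (𝓝 0) := by
    have hb : Tendsto (fun ψ' => ‖f' * (g ψ' - g ψ)‖) 𝒰 (𝓝 0) := by
      have : Tendsto (fun ψ' => f' * (g ψ' - g ψ)) 𝒰 (𝓝 (f' * (g ψ - g ψ))) :=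
        tendsto_const_nhds.mul (hgκ.sub tendsto_const_nhds)
      simpa using this.norm
    refine squeeze_zero_norm (fun ψ' => ?_) hb
    refine (norm_integral_le_of_norm_le_const (ae_of_all _
      fun x => (f' * (g ψ' - g ψ)).norm_coe_le_norm x)).trans ?_
    simp
  have h2 := (hlim (f' * g ψ)).add h1
  rw [add_zero] at h2
  refine h2.congr fun ψ' => ?_
  rw [hν ψ' f, ← integral_add (integrable_of_continuous _ (f' * g ψ).continuous)
    (integrable_of_continuous _ (f' * (g ψ' - g ψ)).continuous)]
  refine integral_congr_ae (ae_of_all _ fun x => ?_)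
  simp [f']
  ring

/-- Probability measures which agree on the sets of arbitrarily fine finite partitions are equal. -/
lemma eq_of_forall_partition {μ ν : Measure X} [IsProbabilityMeasure μ] [IsProbabilityMeasure ν]
    (hpart : ∀ ε > 0, ∃ (ι : Type) (_ : Fintype ι) (S : ι → Set X), (∀ i, MeasurableSet (S i)) ∧
      (∀ i j, i ≠ j → Disjoint (S i) (S j)) ∧ (⋃ i, S i = univ) ∧
      (∀ i, ∀ x ∈ S i, ∀ y ∈ S i, dist x y < ε) ∧ ∀ i, μ (S i) = ν (S i)) : μ = ν := by
  refine ext_of_forall_integral_eq_of_IsFiniteMeasure fun f => ?_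
  refine eq_of_forall_dist_le fun ε hε => ?_
  have huc := CompactSpace.uniformContinuous_of_continuous f.continuous
  obtain ⟨δ, hδ, hfδ⟩ := Metric.uniformContinuous_iff.1 huc (ε / 2) (by positivity)
  obtain ⟨ι, _, S, hmeas, hdisj, hcov, hdiam, heq⟩ := hpart δ hδ
  have key : ∀ i, ∃ c : ℝ, ∀ κ : Measure X, IsProbabilityMeasure κ →
      |∫ x in S i, f x ∂κ - c * κ.real (S i)| ≤ ε / 2 * κ.real (S i) := by
    intro i
    rcases (S i).eq_empty_or_nonempty with he | ⟨y, hy⟩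
    · exact ⟨0, fun κ _ => by simp [he]⟩
    · refine ⟨f y, fun κ _ => ?_⟩
      have hfi := (integrable_of_continuous κ f.continuous).integrableOn (s := S i)
      have e : ∫ x in S i, f x ∂κ - f y * κ.real (S i) = ∫ x in S i, (f x - f y) ∂κ := by
        rw [integral_sub hfi (integrable_const _)]
        simp [mul_comm]
      rw [e, ← Real.norm_eq_abs]
      refine (norm_setIntegral_le_of_norm_le_const (measure_lt_top _ _) fun x hx => ?_)
      rw [← dist_eq_norm]
      exact (hfδ (hdiam i x hx y hy)).le
  choose c hc using key
  have hsum : ∀ κ : Measure X, IsProbabilityMeasure κ →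
      ∫ x, f x ∂κ = ∑ i, ∫ x in S i, f x ∂κ := by
    intro κ _
    rw [← setIntegral_univ, ← hcov, integral_iUnion_fintype hmeas (fun i j hij => hdisj i j hij)
      fun i => (integrable_of_continuous κ f.continuous).integrableOn]
  have hone : ∀ κ : Measure X, IsProbabilityMeasure κ → ∑ i, κ.real (S i) = 1 := by
    intro κ _
    rw [← measureReal_iUnion_fintype (fun i j hij => hdisj i j hij) hmeas, hcov]
    simp
  have hest : ∀ κ : Measure X, IsProbabilityMeasure κ →
      |∫ x, f x ∂κ - ∑ i, c i * κ.real (S i)| ≤ ε / 2 := by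
    intro κ hκ
    rw [hsum κ hκ, ← Finset.sum_sub_distrib]
    refine (Finset.abs_sum_le_sum_abs _ _).trans ((Finset.sum_le_sum fun i _ => hc i κ hκ).trans ?_)
    rw [← Finset.mul_sum, hone κ hκ, mul_one]
  have h1 := hest μ inferInstance
  have h2 := hest ν inferInstance
  have e : ∀ i, ν.real (S i) = μ.real (S i) := fun i => by
    rw [measureReal_def, measureReal_def, heq]
  simp only [e] at h2
  rw [Real.dist_eq]
  rw [abs_le] at h1 h2 ⊢
  constructor <;> linarith [h1.1, h1.2, h2.1, h2.2]

/-- Integrals of compactly supported functions with respect to Maharam measures are finite sums. -/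
lemma exists_integral_maharam {m : ℕ} (f : X × (Fin m → ℤ) → ℝ) (hf : Continuous f)
    (hfc : HasCompactSupport f) : ∃ A : Finset (Fin m → ℤ),
      ∀ (ψ : (Fin m → ℤ) →ₜ+ ℝ) (ν : Measure X), IsProbabilityMeasure ν →
        ∫ p, f p ∂(maharam ψ ν) = ∑ a ∈ A, Real.exp (ψ a) * ∫ x, f (x, a) ∂ν := by
  have hfin : (Prod.snd '' tsupport f).Finite :=
    (hfc.isCompact.image continuous_snd).finite_of_discrete
  refine ⟨hfin.toFinset, fun ψ ν _ => ?_⟩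
  set A := hfin.toFinset with hA
  have hzero : ∀ p ∉ (univ : Set X) ×ˢ (A : Set (Fin m → ℤ)), f p = 0 := by
    intro p hp
    by_contra h0
    exact hp ⟨mem_univ _, by
      rw [hA, Finite.coe_toFinset]
      exact ⟨p, subset_tsupport f h0, rfl⟩⟩
  have hψ : Measurable fun p : X × (Fin m → ℤ) => ENNReal.ofReal (Real.exp (ψ p.2)) :=
    ENNReal.measurable_ofReal.comp (Real.measurable_exp.comp
      (ψ.continuous_toFun.measurable.comp measurable_snd))
  unfold maharam
  rw [integral_withDensity_eq_integral_toReal_smul hψ (by simp)]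
  simp only [ENNReal.toReal_ofReal (Real.exp_pos _).le, smul_eq_mul]
  rw [← setIntegral_eq_integral_of_forall_compl_eq_zero
    (s := (univ : Set X) ×ˢ (A : Set (Fin m → ℤ))) (fun p hp => by rw [hzero p hp, mul_zero]),
    ← Measure.prod_restrict, Measure.restrict_univ]
  have hAfin : IsFiniteMeasure ((Measure.count : Measure (Fin m → ℤ)).restrict A) :=
    ⟨by simp⟩
  have hcont : Continuous fun p : X × (Fin m → ℤ) => Real.exp (ψ p.2) * f p :=
    (Real.continuous_exp.comp (ψ.continuous_toFun.comp continuous_snd)).mul hf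
  obtain ⟨M, hM⟩ := (HasCompactSupport.mul_left hfc
    (f := fun p : X × (Fin m → ℤ) => Real.exp (ψ p.2))).exists_bound_of_continuous hcont
  have hint : Integrable (fun p : X × (Fin m → ℤ) => Real.exp (ψ p.2) * f p)
      (ν.prod ((Measure.count : Measure (Fin m → ℤ)).restrict A)) :=
    Integrable.of_bound hcont.aestronglyMeasurable M (ae_of_all _ hM)
  rw [integral_prod_symm _ hint, setIntegral_finset _ (by
    exact hint.integral_prod_right)]
  refine Finset.sum_congr rfl fun a _ => ?_
  simp [integral_const_mul]

end Conformal

/-! ### Uniqueness for positive matrices -/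

section PerronFrobenius

variable {ι : Type*} [Fintype ι]

/-- A sequence of nonnegative vectors, normalised at time `0`, each of which is the image under `M`
of the next one. -/
structure IsBackwardOrbit (M : Matrix ι ι ℝ) (x : ℕ → ι → ℝ) : Prop where
  nonneg : ∀ n i, 0 ≤ x n i
  eq_mulVec : ∀ n i, x n i = ∑ j, M i j * x (n + 1) j
  sum_eq_one : ∑ i, x 0 i = 1

/-- Two backward orbits of a positive matrix are comparable, with a constant depending only on the
matrix: all coordinates of a vector in the image of `M` are comparable to each other, and the
vectors at time `n` are normalised by the same row of column sums of `M ^ n`. -/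
lemma IsBackwardOrbit.exists_le (M : Matrix ι ι ℝ) (hM : ∀ i j, 0 < M i j) :
    ∃ ε > 0, ε < 1 ∧ ∀ x y, IsBackwardOrbit M x → IsBackwardOrbit M y →
      ∀ n i, ε * y n i ≤ x n i := by
  classical
  obtain ⟨δ, hδ, hδM⟩ : ∃ δ > 0, ∀ i j, δ ≤ M i j := by
    have hev : ∀ᶠ δ in 𝓝[>] (0 : ℝ), ∀ i j, δ ≤ M i j :=
      eventually_all.2 fun i => eventually_all.2 fun j => by
        filter_upwards [Ioo_mem_nhdsGT (hM i j)] with δ hδ using hδ.2.le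
    obtain ⟨δ, h1, h2⟩ := (hev.and self_mem_nhdsWithin).exists
    exact ⟨δ, h2, h1⟩
  obtain ⟨Δ, hΔM⟩ : ∃ Δ, ∀ i j, M i j ≤ Δ := by
    have hev : ∀ᶠ Δ in (atTop : Filter ℝ), ∀ i j, M i j ≤ Δ :=
      eventually_all.2 fun i => eventually_all.2 fun j => eventually_ge_atTop _
    exact hev.exists
  set C := max 2 (Δ / δ) with hC
  have hC2 : 2 ≤ C := le_max_left _ _
  have hΔ : Δ ≤ C * δ := (div_le_iff₀ hδ).1 (le_max_right _ _)
  have hdist : ∀ x, IsBackwardOrbit M x → ∀ n i j, x n i ≤ C * x n j := by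
    intro x hx n i j
    rw [hx.eq_mulVec n i, hx.eq_mulVec n j, Finset.mul_sum]
    refine Finset.sum_le_sum fun k _ => ?_
    rw [← mul_assoc]
    refine mul_le_mul_of_nonneg_right ?_ (hx.nonneg _ _)
    exact (hΔM i k).trans (hΔ.trans (mul_le_mul_of_nonneg_left (hδM j k) (by linarith)))
  have hZ : ∀ n, ∃ Z : ι → ℝ, (∀ j, 0 ≤ Z j) ∧ ∀ x, IsBackwardOrbit M x →
      ∑ j, Z j * x n j = 1 := by
    intro n
    induction n with
    | zero => exact ⟨fun _ => 1, fun _ => zero_le_one, fun x hx => by simpa using hx.sum_eq_one⟩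
    | succ n ih =>
      obtain ⟨Z, hZ0, hZ1⟩ := ih
      refine ⟨fun j => ∑ i, Z i * M i j, fun j => Finset.sum_nonneg fun i _ =>
        mul_nonneg (hZ0 i) (hM i j).le, fun x hx => ?_⟩
      rw [← hZ1 x hx]
      simp only [Finset.sum_mul, hx.eq_mulVec n, Finset.mul_sum, mul_assoc]
      exact Finset.sum_comm
  refine ⟨(C * C)⁻¹, by positivity, inv_lt_one_of_one_lt₀ (by nlinarith), fun x y hx hy n i => ?_⟩
  obtain ⟨Z, hZ0, hZ1⟩ := hZ n
  have h1 : (∑ j, Z j) * y n i ≤ C := by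
    calc (∑ j, Z j) * y n i = ∑ j, Z j * y n i := Finset.sum_mul _ _ _
      _ ≤ ∑ j, C * (Z j * y n j) := Finset.sum_le_sum fun j _ => by
          rw [mul_left_comm]
          exact mul_le_mul_of_nonneg_left (hdist y hy n i j) (hZ0 j)
      _ = C := by rw [← Finset.mul_sum, hZ1 y hy, mul_one]
  have h2 : 1 ≤ C * ((∑ j, Z j) * x n i) := by
    calc 1 = ∑ j, Z j * x n j := (hZ1 x hx).symm
      _ ≤ ∑ j, Z j * (C * x n i) := Finset.sum_le_sum fun j _ =>
          mul_le_mul_of_nonneg_left (hdist x hx n j i) (hZ0 j)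
      _ = C * ((∑ j, Z j) * x n i) := by rw [← Finset.sum_mul]; ring
  have hZpos : 0 < ∑ j, Z j := by
    refine lt_of_le_of_ne (Finset.sum_nonneg fun j _ => hZ0 j) fun h0 => ?_
    rw [← h0] at h2
    linarith [show C * (0 * x n i) = 0 by ring]
  rw [inv_mul_le_iff₀ (by positivity)]
  refine le_of_mul_le_mul_left ?_ hZpos
  nlinarith

/-- A positive matrix has at most one normalised backward orbit. -/
lemma IsBackwardOrbit.unique {M : Matrix ι ι ℝ} (hM : ∀ i j, 0 < M i j) {x y : ℕ → ι → ℝ}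
    (hx : IsBackwardOrbit M x) (hy : IsBackwardOrbit M y) : x = y := by
  obtain ⟨ε, hε, hε1, hle⟩ := IsBackwardOrbit.exists_le M hM
  -- the part of `x` that dominates `y` can be removed, and the rest still dominates `ε * y`
  have key : ∀ k : ℕ, ∀ x y, IsBackwardOrbit M x → IsBackwardOrbit M y →
      ∀ n i, (1 - (1 - ε) ^ k) * y n i ≤ x n i := by
    intro k x y hx hy
    induction k with
    | zero => intro n i; simpa using hx.nonneg n i
    | succ k ih =>
      set b := (1 - ε) ^ k with hb
      have hb0 : 0 < b := pow_pos (by linarith) k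
      have hz : IsBackwardOrbit M fun n i => (x n i - (1 - b) * y n i) / b := by
        refine ⟨fun n i => div_nonneg (by linarith [ih n i]) hb0.le, fun n i => ?_, ?_⟩
        · rw [hx.eq_mulVec n i, hy.eq_mulVec n i, Finset.mul_sum, ← Finset.sum_sub_distrib,
            Finset.sum_div]
          exact Finset.sum_congr rfl fun j _ => by ring
        · rw [← Finset.sum_div, Finset.sum_sub_distrib, ← Finset.mul_sum, hx.sum_eq_one,
            hy.sum_eq_one, mul_one, sub_sub_cancel, div_self hb0.ne']
      intro n i
      have h1 := hle _ _ hz hy n i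
      rw [le_div_iff₀ hb0] at h1
      rw [pow_succ, ← hb]
      linarith
  have hlim : ∀ x y, IsBackwardOrbit M x → IsBackwardOrbit M y → ∀ n i, y n i ≤ x n i := by
    intro x y hx hy n i
    have h1 : Tendsto (fun k : ℕ => (1 - (1 - ε) ^ k) * y n i) atTop (𝓝 ((1 - 0) * y n i)) :=
      (tendsto_const_nhds.sub (tendsto_pow_atTop_nhds_zero_of_lt_one (by linarith)
        (by linarith))).mul_const _
    rw [sub_zero, one_mul] at h1
    exact le_of_tendsto h1 (Eventually.of_forall fun k => key k x y hx hy n i)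
  funext n i
  exact le_antisymm (hlim y x hy hx n i) (hlim x y hx hy n i)

end PerronFrobenius

namespace IntervalExchange

/-! ### Existence and uniqueness of the conformal measure -/

section ConformalMeasures

variable {d m : ℕ} {F : IntervalExchange d} {φ : Fin d → Fin m → ℤ} {c : ℝ}
  {h : Fin d → ℕ}

lemma IsUnitExchange.total_scale (hF : F.IsUnitExchange) (c : ℝ) : (F.scale c).total = c := by
  rw [IntervalExchange.total_scale, hF.total_eq, mul_one]

/-- A set function `μ a b` of intervals `[a, b)` that is multiplied by `exp (-ψ (φ i))` when a
subinterval of `I_i` is translated by `F`. -/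
def IsConformalOnIntervals (F : IntervalExchange d) (φ : Fin d → Fin m → ℤ)
    (ψ : (Fin m → ℤ) →ₜ+ ℝ) (μ : ℝ → ℝ → ℝ) : Prop :=
  ∀ i a b, F.topLeft i ≤ a → a < b → b ≤ F.topLeft i + F.len i →
    μ (a + (F.botLeft i - F.topLeft i)) (b + (F.botLeft i - F.topLeft i)) =
      Real.exp (-ψ (φ i)) * μ a b

lemma IsConformalOnIntervals.tower {ψ : (Fin m → ℤ) →ₜ+ ℝ} {μ : ℝ → ℝ → ℝ}
    (hμ : IsConformalOnIntervals F φ ψ μ) (hF : F.LenPos) {H : IntervalExchange d} (hH : H.LenPos)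
    (hT : Tower F H h) {j : Fin d} {a b : ℝ} (ha : H.topLeft j ≤ a) (hab : a < b)
    (hb : b ≤ H.topLeft j + H.len j) {t : ℕ} (ht : t ≤ h j) :
    μ (F.map^[t] a) (F.map^[t] a + (b - a)) =
      Real.exp (-ψ (birkhoffSum F.map (F.cocycle φ) t a)) * μ a b := by
  have haj : a ∈ H.interval j := ⟨ha, hab.trans_le hb⟩
  induction t with
  | zero => simp
  | succ t ih =>
    obtain ⟨i, hi⟩ := hT.mem j t (by omega)
    obtain ⟨-, h2⟩ := hT.floor_subset hF hH (by omega) hi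
    have hia := hi a haj
    have heq := hT.iterate_eq hF hH (show t ≤ h j by omega) haj
    have := hμ i (F.map^[t] a) (F.map^[t] a + (b - a)) hia.1 (by linarith) (by linarith)
    rw [Function.iterate_succ_apply', birkhoffSum_succ, hF.map_eq hia, hF.cocycle_eq φ hia, map_add,
      neg_add, Real.exp_add, mul_right_comm, ← ih (by omega), mul_comm, ← this]
    congr 1
    ring

/-- By self-similarity, conformal set functions can be rescaled. -/
lemma IsConformalOnIntervals.rescale {ψ : (Fin m → ℤ) →ₜ+ ℝ} {μ : ℝ → ℝ → ℝ}
    (hμ : IsConformalOnIntervals F φ ψ μ) (hF : F.LenPos) (hs : SelfSimilar F φ c h) :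
    IsConformalOnIntervals F φ ψ fun a b => μ (c * a) (c * b) := by
  intro i a b ha hab hb
  have hm : c * a ∈ (F.scale c).interval i :=
    (mul_mem_interval_scale hs.pos).2 ⟨ha, hab.trans_le hb⟩
  have hb' : c * b ≤ (F.scale c).topLeft i + (F.scale c).len i := by
    rw [topLeft_scale]
    change c * b ≤ c * F.topLeft i + c * F.len i
    rw [← mul_add]
    exact mul_le_mul_of_nonneg_left hb hs.pos.le
  have := hμ.tower hF (hF.scale hs.pos) hs.tower hm.1 (mul_lt_mul_of_pos_left hab hs.pos) hb'
    (le_refl (h i))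
  rw [hs.tower.ret i _ hm, map_scale hs.pos, hF.map_eq ⟨ha, hab.trans_le hb⟩, hs.sum i _ hm] at this
  have e : c * (b + (F.botLeft i - F.topLeft i)) =
      c * (a + (F.botLeft i - F.topLeft i)) + (c * b - c * a) := by ring
  rw [← this]
  dsimp only
  rw [e]

lemma IsConformalOnIntervals.rescale_pow {ψ : (Fin m → ℤ) →ₜ+ ℝ} {μ : ℝ → ℝ → ℝ}
    (hμ : IsConformalOnIntervals F φ ψ μ) (hF : F.LenPos) (hs : SelfSimilar F φ c h) (n : ℕ) :
    IsConformalOnIntervals F φ ψ fun a b => μ (c ^ n * a) (c ^ n * b) := by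
  obtain ⟨h', hs'⟩ := hs.pow hF n
  exact hμ.rescale hF hs'

/-- The renormalisation matrix: its entry `(i, j)` is the sum, over the floors in `I_i` of the tower
over the `j`-th interval, of the products of the density `exp (-ψ ∘ φ)` along the tower from the
base up to the floor. The floors are located by the orbit of their left endpoint. -/
noncomputable def weightMatrix (F : IntervalExchange d) (φ : Fin d → Fin m → ℤ)
    (ψ : (Fin m → ℤ) →ₜ+ ℝ) (c : ℝ) (h : Fin d → ℕ) : Matrix (Fin d) (Fin d) ℝ := fun i j =>
  open Classical in ∑ t : Fin (h j), if F.map^[t] (c * F.topLeft j) ∈ F.interval i then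
    Real.exp (-ψ (birkhoffSum F.map (F.cocycle φ) t (c * F.topLeft j))) else 0

lemma weightMatrix_pos (hs : SelfSimilar F φ c h) (hF : F.LenPos) (ψ : (Fin m → ℤ) →ₜ+ ℝ)
    (hvisit : ∀ i j, ∃ t < h j, ∀ x ∈ (F.scale c).interval j, F.map^[t] x ∈ F.interval i)
    (i j : Fin d) : 0 < weightMatrix F φ ψ c h i j := by
  obtain ⟨t, ht, hti⟩ := hvisit i j
  refine Finset.sum_pos' (fun t _ => ?_) ⟨⟨t, ht⟩, Finset.mem_univ _, ?_⟩
  · split_ifs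
    · exact (Real.exp_pos _).le
    · exact le_rfl
  · rw [if_pos]
    · exact Real.exp_pos _
    · have := hti _ ((hF.scale hs.pos).topLeft_mem j)
      rwa [topLeft_scale] at this

lemma SelfSimilar.exists_tower (hF : F.IsUnitExchange) (hs : SelfSimilar F φ c h) (hc : c < 1)
    {δ : ℝ} (hδ : 0 < δ) : ∃ n h', (F.scale (c ^ n)).total < δ ∧ SelfSimilar F φ (c ^ n) h' := by
  obtain ⟨n, hn⟩ := exists_pow_lt_of_lt_one hδ hc
  obtain ⟨h', hs'⟩ := hs.pow hF.lenPos n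
  exact ⟨n, h', by rwa [hF.total_scale], hs'⟩

lemma SelfSimilar.hasSmallTowers (hF : F.IsUnitExchange) (hs : SelfSimilar F φ c h)
    (hc : c < 1) : F.HasSmallTowers := by
  intro δ hδ
  obtain ⟨n, h', hlt, hs'⟩ := hs.exists_tower hF hc hδ
  exact ⟨_, h', hF.lenPos.scale hs'.pos, hlt, hs'.tower⟩

variable [NeZero d]

lemma surjective_T (hF : F.IsUnitExchange) (hT : F.HasSmallTowers) :
    Function.Surjective (F.T hF) := by
  intro w
  have hU : ∀ y, y ∈ Ico (0 : ℝ) 1 ↔ ∃ i, y ∈ Ico (F.botLeft i) (F.botLeft i + F.len i) := by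
    intro y
    rw [← hF.total_eq]
    exact ⟨fun hy => hF.lenPos.inv.exists_mem_interval hy,
      fun ⟨i, hi⟩ => hF.lenPos.inv.interval_subset i hi⟩
  have hw := mem_seg_zero_one w
  rw [seg_eq_iUnion (fun i => lt_add_of_pos_right _ (hF.lenPos i)) hU] at hw
  obtain ⟨i, hi⟩ := mem_iUnion.1 hw
  have himg := T_image_seg hF hT (le_refl (F.topLeft i)) (le_refl (F.topLeft i + F.len i))
  rw [add_sub_cancel, show F.topLeft i + F.len i + (F.botLeft i - F.topLeft i) =
    F.botLeft i + F.len i by ring] at himg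
  rw [← himg] at hi
  obtain ⟨z, -, hz⟩ := hi
  exact ⟨z, hz⟩

/-- The density `exp (-ψ ∘ φ)` as a continuous function on `K`. -/
noncomputable def density (hF : F.IsUnitExchange) (hT : F.HasSmallTowers)
    (φ : Fin d → Fin m → ℤ) (ψ : (Fin m → ℤ) →ₜ+ ℝ) : C(F.K, ℝ) where
  toFun z := Real.exp (-ψ (F.cocycleK φ z))
  continuous_toFun := Real.continuous_exp.comp
    (ψ.continuous_toFun.comp (continuous_cocycleK hF hT φ)).neg

lemma hasJacobian_iff (hd : 2 ≤ d) (hF : F.IsUnitExchange) (hK : F.Keane)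
    (hT : F.HasSmallTowers) (ψ : (Fin m → ℤ) →ₜ+ ℝ) (ν : Measure F.K) [IsFiniteMeasure ν] :
    HasJacobian (F.T hF) (F.cocycleK φ) ψ ν ↔
      IsConformalMeasure (F.T hF) (density hF hT φ ψ) ν := by
  have : CompactSpace F.K := isCompact_iff_compactSpace.1 (isCompact_K hd hF hK)
  rw [isConformalMeasure_iff (continuous_T hd hF hK hT)
    ⟨injective_T hd hF hK hT, surjective_T hF hT⟩ _ fun z => (Real.exp_pos _).le]
  rfl

lemma iterate_T_r (hF : F.IsUnitExchange) (hT : F.HasSmallTowers) {z : F.K} {x : ℝ}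
    (hx : x ∈ Ico (0 : ℝ) 1) (hz : F.r x = z) (n : ℕ) :
    F.r (F.map^[n] x) = ((F.T hF)^[n] z : F.K) := by
  induction n with
  | zero => exact hz
  | succ n ih =>
    rw [Function.iterate_succ_apply', Function.iterate_succ_apply',
      T_of_eq_r hF hT (hF.total_eq ▸ hF.lenPos.iterate_mem (hF.total_eq.symm ▸ hx) n) ih]

lemma cocycleK_of_eq_r (hF : F.IsUnitExchange) (hT : F.HasSmallTowers) {z : F.K} {x : ℝ}
    (hx : x ∈ Ico (0 : ℝ) 1) (hz : F.r x = z) : F.cocycleK φ z = F.cocycle φ x := by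
  obtain ⟨i, hi⟩ := hF.lenPos.exists_mem_interval (hF.total_eq.symm ▸ hx)
  rw [hF.lenPos.cocycle_eq φ hi]
  exact cocycleK_eq hF hT φ (Or.inl ⟨x, hi, hz⟩)

/-- Conformal measures exist: `0` returns to shorter and shorter initial intervals, at times at
which the cocycle always has the same sum. -/
lemma SelfSimilar.exists_conformal (hd : 2 ≤ d) (hF : F.IsUnitExchange) (hK : F.Keane)
    (hs : SelfSimilar F φ c h) (hc : c < 1) (ψ : (Fin m → ℤ) →ₜ+ ℝ) :
    ∃ ν : Measure F.K, IsProbabilityMeasure ν ∧ HasJacobian (F.T hF) (F.cocycleK φ) ψ ν := by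
  have : CompactSpace F.K := isCompact_iff_compactSpace.1 (isCompact_K hd hF hK)
  have hT := hs.hasSmallTowers hF hc
  have hFp := hF.lenPos
  have h0 : (0 : ℝ) ∈ Ico (0 : ℝ) 1 := ⟨le_rfl, zero_lt_one⟩
  have horb : ∀ n, F.map^[n] 0 ∈ Ico (0 : ℝ) 1 := fun n =>
    hF.total_eq ▸ hFp.iterate_mem (hF.total_eq.symm ▸ h0) n
  let p : F.K := ⟨F.r 0, Or.inr ⟨0, h0, rfl⟩⟩
  obtain ⟨i0, hi0⟩ := hFp.exists_topLeft_eq_zero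
  have hprod : ∀ n, ∏ t ∈ Finset.range n, density hF hT φ ψ ((F.T hF)^[t] p) =
      Real.exp (-ψ (birkhoffSum F.map (F.cocycle φ) n 0)) := by
    intro n
    induction n with
    | zero => simp
    | succ n ih =>
      rw [Finset.prod_range_succ, ih, birkhoffSum_succ, map_add, neg_add, Real.exp_add]
      congr 1
      change Real.exp (-ψ (F.cocycleK φ ((F.T hF)^[n] p))) = _
      rw [cocycleK_of_eq_r hF hT (horb n) (iterate_T_r hF hT h0 rfl n)]
  have hinf : {n : ℕ | ∏ t ∈ Finset.range n, density hF hT φ ψ ((F.T hF)^[t] p) =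
      Real.exp (-ψ (φ i0))}.Infinite := by
    refine Set.infinite_of_forall_exists_gt fun B => ?_
    -- a return to a short interval takes a long time, as `0` is not periodic
    have hev : ∀ᶠ δ in 𝓝[>] (0 : ℝ), ∀ k : Fin B, δ ≤ F.map^[k + 1] 0 := by
      refine eventually_all.2 fun k => ?_
      have hpos : 0 < F.map^[k + 1] 0 := by
        refine lt_of_le_of_ne (horb _).1 fun e => ?_
        rw [← hi0] at e
        exact (hK.iterate_ne_zero hd hFp (e.symm.trans hi0)).2 hi0
      filter_upwards [Ioo_mem_nhdsGT hpos] with δ hδ using hδ.2.le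
    obtain ⟨δ, hδ, hδ0⟩ := (hev.and self_mem_nhdsWithin).exists
    obtain ⟨n, h', hlt, hs'⟩ := hs.exists_tower hF hc hδ0
    have hS := hFp.scale hs'.pos
    have hm : (0 : ℝ) ∈ (F.scale (c ^ n)).interval i0 := by
      have := hS.topLeft_mem i0
      rwa [topLeft_scale, hi0, mul_zero] at this
    refine ⟨h' i0, ?_, ?_⟩
    · rw [mem_ofPred_eq, hprod, hs'.sum i0 0 hm]
    · by_contra hle
      have h1 := hδ ⟨h' i0 - 1, by have := hs'.tower.pos i0; omega⟩
      simp only [Nat.sub_add_cancel (hs'.tower.pos i0)] at h1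
      rw [hs'.tower.ret i0 0 hm] at h1
      linarith [(hS.map_mem (hS.interval_subset i0 hm)).2]
  obtain ⟨ν, hν, hconf⟩ := exists_isConformalMeasure (continuous_T hd hF hK hT)
    (density hF hT φ ψ) (fun z => Real.exp_pos _) p _ hinf
  exact ⟨ν, hν, (hasJacobian_iff hd hF hK hT ψ ν).2 hconf⟩

lemma _root_.HasJacobian.isConformalOnIntervals (hF : F.IsUnitExchange)
    (hT : F.HasSmallTowers) {ψ : (Fin m → ℤ) →ₜ+ ℝ} {ν : Measure F.K}
    (hν : HasJacobian (F.T hF) (F.cocycleK φ) ψ ν) :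
    IsConformalOnIntervals F φ ψ fun a b => ν.real (F.seg a b) := by
  intro i a b ha hab hb
  have hFp := hF.lenPos
  have hmeas : MeasurableSet (F.seg a b) :=
    (isClosed_seg hF hT ((hFp.topLeft_nonneg i).trans ha) hab
      (hb.trans (hF.total_eq ▸ hFp.topLeft_add_le_total i))).measurableSet
  have hsub : ∀ z ∈ F.seg a b, F.cocycleK φ z = φ i := fun z hz =>
    cocycleK_eq hF hT φ (seg_mono ha hb hz)
  dsimp only
  rw [← T_image_seg hF hT ha hb, measureReal_def, hν _ hmeas,
    setLIntegral_congr_fun hmeas fun z hz => by rw [hsub z hz], setLIntegral_const,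
    ENNReal.toReal_mul, ENNReal.toReal_ofReal (Real.exp_pos _).le, measureReal_def]

/-- The masses of the base intervals of all levels form a backward orbit of the renormalisation
matrix, as the base of one level is partitioned by floors of towers over the next one. -/
lemma SelfSimilar.isBackwardOrbit (hF : F.IsUnitExchange) (hs : SelfSimilar F φ c h) (hc : c < 1)
    {ψ : (Fin m → ℤ) →ₜ+ ℝ} {ν : Measure F.K} [IsProbabilityMeasure ν]
    (hν : HasJacobian (F.T hF) (F.cocycleK φ) ψ ν) :
    IsBackwardOrbit (weightMatrix F φ ψ c h) fun n j =>
      ν.real (F.seg (c ^ n * F.topLeft j) (c ^ n * (F.topLeft j + F.len j))) := by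
  classical
  have hT := hs.hasSmallTowers hF hc
  have hFp := hF.lenPos
  have hS := hFp.scale hs.pos
  refine ⟨fun n j => measureReal_nonneg, fun n i => ?_, ?_⟩
  · have hcn : 0 < c ^ n := pow_pos hs.pos n
    have hcn1 : c ^ n ≤ 1 := pow_le_one₀ hs.pos.le hc.le
    have hcont := (hν.isConformalOnIntervals hF hT).rescale_pow hFp hs n
    -- the floors of the towers over the next level that lie in `c ^ n * I_i`
    set J := {p : Σ j, Fin (h j) // F.map^[p.2] (c * F.topLeft p.1) ∈ F.interval i} with hJ
    let a : (Σ j, Fin (h j)) → ℝ := fun p => F.map^[p.2] (c * F.topLeft p.1)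
    let ℓ : (Σ j, Fin (h j)) → ℝ := fun p => c * F.len p.1
    have hℓ : ∀ p, 0 < ℓ p := fun p => mul_pos hs.pos (hFp _)
    have hfloor : ∀ p : Σ j, Fin (h j), ∀ y, y ∈ Ico (a p) (a p + ℓ p) ↔
        ∃ x ∈ (F.scale c).interval p.1, F.map^[p.2] x = y := by
      intro p y
      have := hs.tower.image_floor hFp hS (s := p.2) p.2.2.le (y := y)
      rwa [topLeft_scale] at this
    have hbounds : ∀ p, 0 ≤ a p ∧ a p + ℓ p ≤ 1 := by
      intro p
      have := hs.tower.floor_bounds hF hS (s := p.2) p.2.2.le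
      rw [topLeft_scale] at this
      exact ⟨this.1, this.2.2⟩
    have hscale : ∀ (y u v : ℝ), y ∈ Ico (c ^ n * u) (c ^ n * v) ↔ y / c ^ n ∈ Ico u v := by
      intro y u v
      rw [mem_Ico, mem_Ico, le_div_iff₀' hcn, div_lt_iff₀' hcn]
    have hU : ∀ y, y ∈ Ico (c ^ n * F.topLeft i) (c ^ n * (F.topLeft i + F.len i)) ↔
        ∃ p : J, y ∈ Ico (c ^ n * a p.1) (c ^ n * (a p.1 + ℓ p.1)) := by
      intro y
      simp only [hscale]
      constructor
      · intro hy
        obtain ⟨j, t, ht, x, hx, e⟩ := hs.tower.cover _ (hFp.interval_subset i hy)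
        refine ⟨⟨⟨j, ⟨t, ht⟩⟩, ?_⟩, (hfloor ⟨j, ⟨t, ht⟩⟩ _).2 ⟨x, hx, e⟩⟩
        obtain ⟨k, hk⟩ := hs.tower.mem j t ht
        obtain rfl := hFp.index_unique (hk x hx) (e ▸ hy)
        have := hk _ (hS.topLeft_mem j)
        rwa [topLeft_scale] at this
      · rintro ⟨⟨⟨j, t⟩, hp⟩, hy⟩
        obtain ⟨x, hx, e⟩ := (hfloor _ _).1 hy
        obtain ⟨k, hk⟩ := hs.tower.mem j t t.2
        have h1 := hk _ (hS.topLeft_mem j)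
        rw [topLeft_scale] at h1
        obtain rfl := hFp.index_unique h1 hp
        exact e ▸ hk x hx
    -- the floors begin at points of `D ∪ {0}`
    have hleft : ∀ p, c ^ n * a p = 0 ∨ c ^ n * a p ∈ F.splitPoints := by
      rintro ⟨j, t⟩
      obtain ⟨hn, hsn⟩ := hs.pow hFp n
      obtain ⟨hn', hsn'⟩ := hs.pow hFp (n + 1)
      have hcx : c * F.topLeft j ∈ Ico 0 F.total := by
        have h1 := hS.interval_subset j (hS.topLeft_mem j)
        rw [topLeft_scale] at h1
        exact ⟨h1.1, h1.2.trans_le hs.tower.total_le⟩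
      have hmem : c ^ n * (c * F.topLeft j) ∈ Ico 0 (F.scale (c ^ n)).total := by
        rw [total_scale]
        exact ⟨mul_nonneg hcn.le hcx.1, mul_lt_mul_of_pos_left hcx.2 hcn⟩
      obtain ⟨k, -, hk⟩ := hsn.tower.exists_iterate (hFp.scale hcn) hmem t
      rw [iterate_map_scale hcn] at hk
      change c ^ n * F.map^[t] (c * F.topLeft j) = 0 ∨ _ ∈ _
      rw [← hk]
      have := hsn'.tower.floor_left_mem hF (hFp.scale hsn'.pos) j k
      rwa [topLeft_scale, pow_succ, mul_assoc] at this
    have hdisj : Pairwise (Function.onFun Disjoint fun p : J =>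
        F.seg (c ^ n * a p.1) (c ^ n * (a p.1 + ℓ p.1))) := by
      intro p q hpq
      have hlt : ∀ p, c ^ n * a p < c ^ n * (a p + ℓ p) := fun p =>
        mul_lt_mul_of_pos_left (lt_add_of_pos_right _ (hℓ p)) hcn
      have hle : ∀ p, c ^ n * (a p + ℓ p) ≤ 1 := fun p =>
        mul_le_one₀ hcn1 (by linarith [(hbounds p).1, hℓ p]) (hbounds p).2
      refine disjoint_seg hF hT (mul_nonneg hcn.le (hbounds _).1) (hlt _) (hle _)
        (mul_nonneg hcn.le (hbounds _).1) (hlt _) (hle _) (hleft _) (hleft _) ?_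
      refine disjoint_left.2 fun y hy hy' => hpq ?_
      rw [hscale] at hy hy'
      obtain ⟨x, hx, e⟩ := (hfloor _ _).1 hy
      obtain ⟨x', hx', e'⟩ := (hfloor _ _).1 hy'
      obtain ⟨h1, h2, -⟩ := hs.tower.floor_unique hFp hS p.1.2.2 q.1.2.2 hx hx' (e.trans e'.symm)
      refine Subtype.ext ?_
      obtain ⟨⟨j, t⟩, hp⟩ := p
      obtain ⟨⟨j', t'⟩, hq⟩ := q
      simp only at h1 h2
      subst h2
      obtain rfl : t = t' := Fin.ext h1
      rfl
    have hmeas : ∀ p : J, MeasurableSet (F.seg (c ^ n * a p.1) (c ^ n * (a p.1 + ℓ p.1))) := by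
      intro p
      exact (isClosed_seg hF hT (mul_nonneg hcn.le (hbounds _).1)
        (mul_lt_mul_of_pos_left (lt_add_of_pos_right _ (hℓ _)) hcn)
        (mul_le_one₀ hcn1 (by linarith [(hbounds p.1).1, hℓ p.1]) (hbounds _).2)).measurableSet
    have hmass : ∀ p : Σ j, Fin (h j),
        ν.real (F.seg (c ^ n * a p) (c ^ n * (a p + ℓ p))) =
          Real.exp (-ψ (birkhoffSum F.map (F.cocycle φ) p.2 (c * F.topLeft p.1))) *
          ν.real (F.seg (c ^ (n + 1) * F.topLeft p.1)
            (c ^ (n + 1) * (F.topLeft p.1 + F.len p.1))) := by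
      intro p
      have := hcont.tower hFp hS hs.tower (j := p.1) (a := c * F.topLeft p.1)
        (b := c * F.topLeft p.1 + c * F.len p.1) (topLeft_scale c p.1).le
        (lt_add_of_pos_right _ (hℓ p)) (by rw [topLeft_scale]; rfl) p.2.2.le
      rw [add_sub_cancel_left] at this
      rw [this, ← mul_add, ← mul_assoc, ← mul_assoc, ← pow_succ]
    rw [seg_eq_iUnion (ι := J) (fun p => mul_lt_mul_of_pos_left
      (lt_add_of_pos_right _ (hℓ p.1)) hcn) hU, measureReal_iUnion_fintype hdisj hmeas]
    have hsum : ∀ f : (Σ j, Fin (h j)) → ℝ,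
        ∑ p : J, f p.1 = ∑ j, ∑ t : Fin (h j),
          if F.map^[t] (c * F.topLeft j) ∈ F.interval i then f ⟨j, t⟩ else 0 := by
      intro f
      rw [← Finset.sum_subtype (Finset.univ.filter fun p : Σ j, Fin (h j) =>
        F.map^[p.2] (c * F.topLeft p.1) ∈ F.interval i) (by simp) f, Finset.sum_filter,
        Fintype.sum_sigma]
    rw [hsum fun p => ν.real (F.seg (c ^ n * a p) (c ^ n * (a p + ℓ p)))]
    refine Finset.sum_congr rfl fun j _ => ?_
    rw [weightMatrix, Finset.sum_mul]
    refine Finset.sum_congr rfl fun t _ => ?_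
    rw [ite_mul, zero_mul, hmass]
  · simp only [pow_zero, one_mul]
    have hdisj : Pairwise (Function.onFun Disjoint F.piece) := fun i j hij =>
      disjoint_piece hF hT hij
    have hmeas : ∀ i, MeasurableSet (F.piece i) := fun i =>
      (isClopen_piece hF hT i).isClosed.measurableSet
    have hU : ⋃ i, F.piece i = univ := eq_univ_of_forall fun z =>
      mem_iUnion.2 (exists_mem_piece hF z)
    change ∑ i, ν.real (F.piece i) = 1
    rw [← measureReal_iUnion_fintype hdisj hmeas, hU]
    simp

lemma SelfSimilar.conformal_unique (hd : 2 ≤ d) (hF : F.IsUnitExchange) (hK : F.Keane)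
    (hs : SelfSimilar F φ c h) (hc : c < 1)
    (hvisit : ∀ i j, ∃ t < h j, ∀ x ∈ (F.scale c).interval j, F.map^[t] x ∈ F.interval i)
    {ψ : (Fin m → ℤ) →ₜ+ ℝ} {ν ν' : Measure F.K} [IsProbabilityMeasure ν]
    [IsProbabilityMeasure ν'] (hν : HasJacobian (F.T hF) (F.cocycleK φ) ψ ν)
    (hν' : HasJacobian (F.T hF) (F.cocycleK φ) ψ ν') : ν = ν' := by
  have : CompactSpace F.K := isCompact_iff_compactSpace.1 (isCompact_K hd hF hK)
  have hT := hs.hasSmallTowers hF hc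
  have hFp := hF.lenPos
  have heq := (hs.isBackwardOrbit hF hc hν).unique (weightMatrix_pos hs hFp ψ hvisit)
    (hs.isBackwardOrbit hF hc hν')
  refine eq_of_forall_partition fun ε hε => ?_
  obtain ⟨δ, hδ, hlt⟩ := hK.exists_tower_dist_lt hd hF hT hε
  obtain ⟨n, h', hnδ, hs'⟩ := hs.exists_tower hF hc hδ
  have hS := hFp.scale hs'.pos
  refine ⟨Σ j, Fin (h' j), inferInstance, fun p => F.floor (F.scale (c ^ n)) p.1 p.2,
    fun p => (hs'.tower.isClosed_floor hF hT hS p.2.2.le).measurableSet, ?_, ?_,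
    fun p => hlt _ h' hS hnδ hs'.tower p.1 p.2 p.2.2.le, ?_⟩
  · rintro ⟨j, t⟩ ⟨j', t'⟩ hne
    refine hs'.tower.disjoint_floor hF hT hS (e := 0) (by omega) t.2 t'.2 ?_
    rintro ⟨rfl, h2⟩
    obtain rfl : _ = t' := Fin.ext h2
    exact hne rfl
  · refine eq_univ_of_forall fun z => ?_
    obtain ⟨j, t, ht, hz⟩ := hs'.tower.exists_mem_floor hF hS z
    exact mem_iUnion.2 ⟨⟨j, ⟨t, ht⟩⟩, hz⟩
  · rintro ⟨j, t⟩
    have hmass : ∀ κ : Measure F.K, HasJacobian (F.T hF) (F.cocycleK φ) ψ κ →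
        κ.real (F.floor (F.scale (c ^ n)) j t) =
          Real.exp (-ψ (birkhoffSum F.map (F.cocycle φ) t (c ^ n * F.topLeft j))) *
            κ.real (F.seg (c ^ n * F.topLeft j) (c ^ n * (F.topLeft j + F.len j))) := by
      intro κ hκ
      have := (hκ.isConformalOnIntervals hF hT).tower hFp hS hs'.tower (j := j) le_rfl
        (lt_add_of_pos_right _ (hS j)) le_rfl t.2.le
      rw [add_sub_cancel_left] at this
      unfold floor
      rw [this, topLeft_scale, mul_add]
      rfl
    refine (measureReal_eq_measureReal_iff (measure_ne_top _ _) (measure_ne_top _ _)).1 ?_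
    rw [hmass ν hν, hmass ν' hν']
    exact congrArg _ (congrFun (congrFun heq n) j)

end ConformalMeasures

end IntervalExchange

/-! ### Continuous dependence on the homomorphism -/

namespace IntervalExchange

variable {d m : ℕ} [NeZero d] {F : IntervalExchange d}

lemma continuous_density (hd : 2 ≤ d) (hF : F.IsUnitExchange) (hK : F.Keane)
    (hT : F.HasSmallTowers) (φ : Fin d → Fin m → ℤ) :
    Continuous fun ψ : (Fin m → ℤ) →ₜ+ ℝ => density hF hT φ ψ := by
  have : CompactSpace F.K := isCompact_iff_compactSpace.1 (isCompact_K hd hF hK)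
  refine ContinuousMap.continuous_of_continuous_uncurry _ ?_
  change Continuous fun p : ((Fin m → ℤ) →ₜ+ ℝ) × F.K => Real.exp (-p.1 (F.cocycleK φ p.2))
  refine continuous_iff_continuousAt.2 fun p => ?_
  -- The cocycle is locally constant, so evaluation at a fixed point suffices locally.
  have hloc : ∀ᶠ q : ((Fin m → ℤ) →ₜ+ ℝ) × F.K in 𝓝 p, F.cocycleK φ q.2 = F.cocycleK φ p.2 :=
    (((continuous_cocycleK hF hT φ).comp continuous_snd).tendsto p).eventually
      ((isOpen_discrete {F.cocycleK φ p.2}).mem_nhds rfl)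
  have hcont : Continuous fun q : ((Fin m → ℤ) →ₜ+ ℝ) × F.K =>
      Real.exp (-q.1 (F.cocycleK φ p.2)) :=
    Real.continuous_exp.comp ((continuous_eval_const (F := (Fin m → ℤ) →ₜ+ ℝ) _).comp
      continuous_fst).neg
  refine hcont.continuousAt.congr ?_
  filter_upwards [hloc] with q hq
  rw [hq]

end IntervalExchange

theorem theorem2 {d m : ℕ} [NeZero d] (hd : 2 ≤ d)
    (F : IntervalExchange d) (hF : F.IsUnitExchange) (hKeane : F.Keane)
    (hcomplete : F.InfinitelyComplete)
    (φ : Fin d → (Fin m → ℤ)) (hperiodic : F.PeriodicType φ) :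
    (∀ ψ : (Fin m → ℤ) →ₜ+ ℝ, ∃! ν : Measure F.K,
      IsProbabilityMeasure ν ∧ HasJacobian (F.T hF) (F.cocycleK φ) ψ ν) ∧
    ∀ ν : ((Fin m → ℤ) →ₜ+ ℝ) → Measure F.K,
      (∀ ψ, IsProbabilityMeasure (ν ψ) ∧ HasJacobian (F.T hF) (F.cocycleK φ) ψ (ν ψ)) →
      ∀ f : F.K × (Fin m → ℤ) → ℝ, Continuous f → HasCompactSupport f →
        Continuous fun ψ : (Fin m → ℤ) →ₜ+ ℝ => ∫ p, f p ∂(maharam ψ (ν ψ)) := by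
  have : CompactSpace F.K :=
    isCompact_iff_compactSpace.1 (IntervalExchange.isCompact_K hd hF hKeane)
  obtain ⟨c₀, h₀, hc₀, hs₀⟩ := hperiodic.selfSimilar hd hF hKeane
  obtain ⟨c, h, hc, hs, hvisit⟩ := hs₀.exists_visits hd hF hKeane hcomplete hc₀
  have hT := hs.hasSmallTowers hF hc
  have huniq : ∀ (ψ : (Fin m → ℤ) →ₜ+ ℝ) (ν ν' : Measure F.K), IsProbabilityMeasure ν →
      IsProbabilityMeasure ν' → HasJacobian (F.T hF) (F.cocycleK φ) ψ ν →
      HasJacobian (F.T hF) (F.cocycleK φ) ψ ν' → ν = ν' := fun ψ ν ν' _ _ hν hν' =>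
    hs.conformal_unique hd hF hKeane hc hvisit hν hν'
  refine ⟨fun ψ => ?_, fun ν hν f hf hfc => ?_⟩
  · obtain ⟨ν, hνp, hν⟩ := hs.exists_conformal hd hF hKeane hc ψ
    exact ⟨ν, ⟨hνp, hν⟩, fun ν' hν' => huniq ψ ν' ν hν'.1 hνp hν'.2 hν⟩
  · let P : ((Fin m → ℤ) →ₜ+ ℝ) → ProbabilityMeasure F.K := fun ψ => ⟨ν ψ, (hν ψ).1⟩
    have hPc : Continuous P := by
      refine continuous_of_isConformalMeasure (IntervalExchange.continuous_T hd hF hKeane hT)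
        (fun ψ => IntervalExchange.density hF hT φ ψ)
        (IntervalExchange.continuous_density hd hF hKeane hT φ) P
        (fun ψ => (IntervalExchange.hasJacobian_iff hd hF hKeane hT ψ
          (P ψ : Measure F.K)).1 (hν ψ).2)
        fun ψ κ hκ => Subtype.ext (huniq ψ _ _ κ.2 (hν ψ).1
          ((IntervalExchange.hasJacobian_iff hd hF hKeane hT ψ (κ : Measure F.K)).2 hκ) (hν ψ).2)
    obtain ⟨A, hA⟩ := exists_integral_maharam f hf hfc
    simp_rw [fun ψ => hA ψ (ν ψ) (hν ψ).1]
    refine continuous_finsetSum _ fun a _ => ?_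
    refine (Real.continuous_exp.comp
      (continuous_eval_const (F := (Fin m → ℤ) →ₜ+ ℝ) a)).mul ?_
    exact (ProbabilityMeasure.continuous_integral_continuousMap
      (⟨fun x => f (x, a), hf.comp (Continuous.prodMk_left a)⟩ : C(F.K, ℝ))).comp hPc
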